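/- **Setting.** Let $\Omega$ be a smooth Riemannian $3$-manifold (Hausdorff, second countable; for instance an open subset of an orientable Riemannian $3$-manifold), and let $\Sigma\subset\Omega$ be an embedded smooth surface (without boundary). Let $N\Sigma$ be its normal bundle and $\exp^\perp$ its normal exponential map. For $A\subset\Sigma$ and $\epsilon>0$ let $U_\epsilon(A)$ be the set of $(x,\mathbf v)\in N\Sigma$ with $x\in A$, $|\mathbf v|<\epsilon$, and $\mathcal N_\epsilon(A)=\exp^\perp(U_\epsilon(A))$. It is *regular* if $\exp^\perp$ is a diffeomorphism from some open $V\subset N\Sigma$ with $V\supset U_\epsilon(A)$ onto an open subset of $\Omega$; then $\Pi_\Sigma:\exp^\perp(x,\mathbf v)\mapsto x$ is the projection. A tangent vector $\mathbf v=\mathbf v^\perp+\mathbf v^T$ at a point of $\exp^\perp(V)$, with $\mathbf v^\perp$ tangent and $\mathbf v^T$ perpendicular to the fibre of $\Pi_\Sigma$, is *$\delta$-parallel* to $\Sigma$ if $|\mathbf v^\perp|\le\delta|\mathbf v|$ and $\frac1{1+\delta}|\mathbf v^T|\le|d\Pi_\Sigma(\mathbf v)|\le(1+\delta)|\mathbf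 v^T|$. Let $U\subset\Sigma$ be open. An embedded surface $\Gamma$ is a *$\delta$-graph* over $U$ if, for some $\epsilon>0$, $\mathcal N_\epsilon(U)$ is regular, $\Gamma$ is a relatively closed subset of $\mathcal N_\epsilon(U)$ or of $\mathcal N_\epsilon(U)\setminus U$, and all tangent vectors of $\Gamma$ are $\delta$-parallel; it is a *$\delta$-cover* of $U$ if moreover it is connected and $\Pi_\Sigma(\Gamma)=U$. A *$\delta$-lift* of a (piecewise) smooth curve $\gamma:[0,1]\to\Sigma$ is a piecewise smooth curve $\widehat\gamma:[0,1]\to\mathcal N_\delta(\gamma)$ such that $\mathcal N_\delta(\gamma)$ is regular, $\Pi_\Sigma\circ\widehat\gamma=\gamma$, and all (one-sided) velocities of $\widehat\gamma$ are $\delta$-parallel. (A curve and its image are denoted by the same letter.) Let $\gamma_1,\dots,\gamma_n$ ($n\ge1$) be curves lying in a pre-compact open $U\subset\Sigma$ and passing through $p$. A *generalised simple $\delta$-lift* of them in $U$, pointed at $(p,q)$, consists of $\delta$-lifts $\widehat\gamma_i$ of $\gamma_i$ for which there are $\epsilon>0$ and an embedded (open) disk $\Delta\subset\Omega$ such that: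 (1) $\widehat\gamma_i\subset\Delta\cap\mathcal N_\epsilon(U)$; (2) $\Delta\cap\mathcal N_\epsilon(U)$ is a $\delta$-graph over $U$; (3) $q\in\mathcal N_\epsilon(p)\cap\Delta$ and $q\in\widehat\gamma_i$ for all $i$; (4) the connected component of $\Delta\cap\mathcal N_\epsilon(U)$ containing $\widehat\gamma_i$ is a $\delta$-cover of $U$. The surface $\Sigma$ has the *generalised simple lift property* if for every non-empty connected pre-compact open $U\subset\Sigma$ there is $\delta_1>0$ such that for all $0<\delta<\delta_1$, all $p\in U$ and all $n\ge 1$, any smooth curves $\gamma_1,\dots,\gamma_n:[0,1]\to U$ passing through $p$ have a generalised simple $\delta$-lift in $U$ pointed at $(p,q)$ for some $q$. Below, a *generalised simple $\delta$-lift* of a single curve $\gamma$ is one in some pre-compact open $U\supset\gamma$, pointed at some $(p',q)$ with $p'\in\gamma$. A closed curve $\gamma$ in $\Sigma$ has the *open lift property* if there is $\delta_0>0$ such that for no $0<\delta<\delta_0$ does $\gamma$ have a closed generalised simple $\delta$-lift; otherwise it has the *closed lift property*. It has the *embedded lift property* (resp. *embedded closed lift property*) if for some sequence $\delta_i\to0$,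 $\delta_i>0$, it has generalised simple $\delta_i$-lifts (resp. closed generalised simple $\delta_i$-lifts) without self-intersections (other than the coincidence of the two end points of a closed lift). **Proposition (Lifting lemma).** Let $\Sigma\subset\Omega$ be an embedded surface with the generalised simple lift property, and let $\alpha,\beta:[0,1]\to\Sigma$ be smooth closed curves such that 1. both $\alpha$ and $\beta$ have the open lift property; 2. $\alpha\cap\beta=\{p\}$, where $p=\alpha(0)=\beta(0)$; 3. there is a two-sided (i.e. with trivial normal bundle) pre-compact open set $U\subset\Sigma$ with $\alpha\cup\beta\subset U$. Then the curve $\mu:=\alpha\beta\alpha^{-1}\beta^{-1}$ (first $\alpha$, then $\beta$, then $\alpha$ and $\beta$ backwards) has the closed lift property. If, in addition, $\alpha$ and $\beta$ are Jordan curves and have the embedded lift property, then one of the curves $\mu$, $\alpha\beta$, $\beta\alpha^{-1}$ has the embedded closed lift property. -/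

import Mathlib

open Set Filter Topology Bundle
open scoped Manifold ContDiff

noncomputable section

namespace LiftProperty

/-- The model space of three-dimensional manifolds. -/
abbrev E3 : Type := EuclideanSpace ℝ (Fin 3)

section Basic

variable {Ω : Type*} [TopologicalSpace Ω] [ChartedSpace E3 Ω]

/-- The velocity vector at time `t` of the curve `c`, regarded as a curve on `J ⊆ ℝ`
(a one-sided velocity when `t` is an end point of an interval `J`). -/
def velocity (c : ℝ → Ω) (J : Set ℝ) (t : ℝ) : TangentBundle (𝓡 3) Ω :=
  ⟨c t, mfderivWithin 𝓘(ℝ, ℝ) (𝓡 3) c J t (1 : ℝ)⟩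

/-- `c` restricted to `[0,1]` is a smooth curve with values in `S`. -/
def IsSmoothCurveIn (S : Set Ω) (c : ℝ → Ω) : Prop :=
  ContMDiffOn 𝓘(ℝ, ℝ) (𝓡 3) ∞ c (Icc 0 1) ∧ MapsTo c (Icc 0 1) S

/-- The image of the curve `c : [0,1] → Ω`. -/
def curveImage (c : ℝ → Ω) : Set Ω := c '' Icc 0 1

/-- The curve `c : [0,1] → Ω` is closed. -/
def IsClosedCurve (c : ℝ → Ω) : Prop := c 0 = c 1

/-- The curve `c : [0,1] → Ω` has no self-intersections, except that its two end points may
coincide. For a closed curve this says that it is a Jordan curve. -/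
def IsEmbeddedCurve (c : ℝ → Ω) : Prop :=
  ∀ s ∈ Icc (0 : ℝ) 1, ∀ t ∈ Icc (0 : ℝ) 1, c s = c t →
    s = t ∨ (s = 0 ∧ t = 1) ∨ (s = 1 ∧ t = 0)

/-- Concatenation: first run through `c`, then through `d`. -/
def concatCurve (c d : ℝ → Ω) : ℝ → Ω := fun t => if t ≤ 1 / 2 then c (2 * t) else d (2 * t - 1)

/-- The curve `c` run backwards. -/
def revCurve (c : ℝ → Ω) : ℝ → Ω := fun t => c (1 - t)

/-- The commutatorCurve: `c`, then `d`, then `c` backwards, then `d` backwards. -/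
def commutatorCurve (c d : ℝ → Ω) : ℝ → Ω := concatCurve (concatCurve c d) (concatCurve (revCurve c) (revCurve d))

/-- `S` is an embedded smooth surface (two-dimensional embedded submanifold without boundary,
not necessarily closed or connected): near each of its points it is a coordinate plane in a suitable
smooth chart. -/
def IsEmbeddedSurface (S : Set Ω) : Prop :=
  ∀ x ∈ S, ∃ e ∈ IsManifold.maximalAtlas (𝓡 3) ∞ Ω, x ∈ e.source ∧
    e '' (S ∩ e.source) = e.target ∩ {y : E3 | y 2 = 0}

/-- `D` is an embedded disk: the image of a smooth embedding of the plane (equivalently, of the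
open unit disk). -/
def IsEmbeddedDisk (D : Set Ω) : Prop :=
  ∃ f : EuclideanSpace ℝ (Fin 2) → Ω, Manifold.IsSmoothEmbedding (𝓡 2) (𝓡 3) ∞ f ∧ range f = D

/-- `U` is a pre-compact open subset of the surface `S`. -/
def IsPrecompactOpenIn (S U : Set Ω) : Prop :=
  (∃ W : Set Ω, IsOpen W ∧ U = W ∩ S) ∧ ∃ K : Set Ω, IsCompact K ∧ K ⊆ S ∧ U ⊆ K

/-- The tangent bundle of an embedded surface `S`, as a set of tangent vectors of the ambient
manifold: the velocities of smooth curves in `S`. -/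
def tangentSet (S : Set Ω) : Set (TangentBundle (𝓡 3) Ω) :=
  {v | ∃ (c : ℝ → Ω) (r : ℝ), 0 < r ∧ ContMDiffOn 𝓘(ℝ, ℝ) (𝓡 3) ∞ c (Ioo (-r) r) ∧
    MapsTo c (Ioo (-r) r) S ∧ velocity c (Ioo (-r) r) 0 = v}

end Basic

section Riemannian

variable {Ω : Type*} [TopologicalSpace Ω] [ChartedSpace E3 Ω] [IsManifold (𝓡 3) ∞ Ω]
  [RiemannianBundle (fun x : Ω => TangentSpace (𝓡 3) x)]

/-- The normal bundle `NS` of an embedded surface `S`. -/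
def normalSet (S : Set Ω) : Set (TangentBundle (𝓡 3) Ω) :=
  {v | v.proj ∈ S ∧ ∀ w : TangentSpace (𝓡 3) v.proj,
    (⟨v.proj, w⟩ : TangentBundle (𝓡 3) Ω) ∈ tangentSet S → inner ℝ v.2 w = 0}

/-- The open subset `U` of `S` is two-sided: the normal line bundle of `S` is trivial over `U`,
that is, it has a continuous nowhere vanishing section over `U`. -/
def IsTwoSided (S U : Set Ω) : Prop :=
  ∃ ν : (x : Ω) → TangentSpace (𝓡 3) x,
    ContinuousOn (fun x => (⟨x, ν x⟩ : TangentBundle (𝓡 3) Ω)) U ∧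
    ∀ x ∈ U, (⟨x, ν x⟩ : TangentBundle (𝓡 3) Ω) ∈ normalSet S ∧ ν x ≠ 0

/-- The Riemannian metric in the coordinates of the preferred chart at `x₀`, at the coordinate
point `y` and for coordinate vectors `v`, `w`. -/
def chartMetric (x₀ : Ω) (y v w : E3) : ℝ :=
  inner ℝ (mfderiv 𝓘(ℝ, E3) (𝓡 3) (extChartAt (𝓡 3) x₀).symm y v)
    (mfderiv 𝓘(ℝ, E3) (𝓡 3) (extChartAt (𝓡 3) x₀).symm y w)

/-- `c` is a geodesic on the open set `J` of times: it is smooth there, and in the coordinates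
`x = (x¹, x², x³)` of the chart at `c t` it satisfies at `t` the geodesic equation
`(d/dt) g_x(x', w) = (1/2) (∂_w g)_x(x', x')` for every constant coordinate vector `w`. This is
the equation `x'' + Γ(x', x') = 0`, with the upper index lowered by the metric. -/
def IsGeodesicOn (c : ℝ → Ω) (J : Set ℝ) : Prop :=
  ContMDiffOn 𝓘(ℝ, ℝ) (𝓡 3) ∞ c J ∧
  ∀ t ∈ J, ∀ w : E3,
    HasDerivAt
      (fun s => chartMetric (c t) (extChartAt (𝓡 3) (c t) (c s))
        (deriv (fun r => extChartAt (𝓡 3) (c t) (c r)) s) w)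
      (1 / 2 * fderiv ℝ
        (fun y => chartMetric (c t) y (deriv (fun r => extChartAt (𝓡 3) (c t) (c r)) t)
          (deriv (fun r => extChartAt (𝓡 3) (c t) (c r)) t))
        (extChartAt (𝓡 3) (c t) (c t)) w)
      t

/-- `q` is the point at time `1` of a geodesic, defined on a neighbourhood of `[0,1]`, with
initial velocity `v`. -/
def ExpRel (v : TangentBundle (𝓡 3) Ω) (q : Ω) : Prop :=
  ∃ (c : ℝ → Ω) (J : Set ℝ), IsOpen J ∧ Icc 0 1 ⊆ J ∧ IsGeodesicOn c J ∧
    velocity c J 0 = v ∧ c 1 = q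

/-- The domain of the exponential map. -/
def expDomain : Set (TangentBundle (𝓡 3) Ω) := {v | ∃ q, ExpRel v q}

open Classical in
/-- The exponential map (with the irrelevant value `v.proj` outside its domain). Its restriction to
`normalSet S` is the normal exponential map of `S`. -/
def expMap (v : TangentBundle (𝓡 3) Ω) : Ω :=
  if h : ∃ q, ExpRel v q then h.choose else v.proj

/-- The normal vectors of `S` of length less than `ε` with base point in `A`. -/
def normalDisc (S A : Set Ω) (ε : ℝ) : Set (TangentBundle (𝓡 3) Ω) :=
  {v | v ∈ normalSet S ∧ v.proj ∈ A ∧ ‖v.2‖ < ε}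

/-- The `ε`-neighbourhood of the subset `A` of `S`. -/
def tube (S A : Set Ω) (ε : ℝ) : Set Ω := expMap '' normalDisc S A ε

/-- `V` is an open subset of the normal bundle of `S` on which the normal exponential map is defined
and is a diffeomorphism onto an open subset of the ambient manifold.
(Smoothness of a map on the submanifold `V` of the tangent bundle of `Ω` is smoothness
within the set `V`.) -/
def IsRegularDomain (S : Set Ω) (V : Set (TangentBundle (𝓡 3) Ω)) : Prop :=
  (∃ W : Set (TangentBundle (𝓡 3) Ω), IsOpen W ∧ V = W ∩ normalSet S) ∧
  V ⊆ expDomain ∧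
  ContMDiffOn (𝓡 3).tangent (𝓡 3) ∞ (expMap : TangentBundle (𝓡 3) Ω → Ω) V ∧
  IsOpen (expMap '' V) ∧
  ∃ ψ : Ω → TangentBundle (𝓡 3) Ω,
    ContMDiffOn (𝓡 3) (𝓡 3).tangent ∞ ψ (expMap '' V) ∧ ∀ v ∈ V, ψ (expMap v) = v

open Classical in
/-- The projection `Π_S` onto `S` along the normal geodesics, for a regular domain `V`:
it sends `exp v` to the base point of `v`, for `v ∈ V`. -/
def footMap (V : Set (TangentBundle (𝓡 3) Ω)) (q : Ω) : Ω :=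
  if h : ∃ v ∈ V, expMap v = q then h.choose.proj else q

/-- The tangent vector `v` is `δ`-parallel to the surface: if `v = a + b` with `a` tangent to
the fibre of the projection and `b` perpendicular to that fibre, then `|a| ≤ δ |v|` and
`(1 + δ)⁻¹ |b| ≤ |dΠ v| ≤ (1 + δ) |b|`. -/
def IsParallel (V : Set (TangentBundle (𝓡 3) Ω)) (δ : ℝ) (v : TangentBundle (𝓡 3) Ω) : Prop :=
  ∃ a b : TangentSpace (𝓡 3) v.proj,
    v.2 = a + b ∧
    mfderiv (𝓡 3) (𝓡 3) (footMap V) v.proj a = 0 ∧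
    (∀ w : TangentSpace (𝓡 3) v.proj,
      mfderiv (𝓡 3) (𝓡 3) (footMap V) v.proj w = 0 → inner ℝ b w = 0) ∧
    ‖a‖ ≤ δ * ‖v.2‖ ∧
    1 / (1 + δ) * ‖b‖ ≤ ‖mfderiv (𝓡 3) (𝓡 3) (footMap V) v.proj v.2‖ ∧
    ‖mfderiv (𝓡 3) (𝓡 3) (footMap V) v.proj v.2‖ ≤ (1 + δ) * ‖b‖

/-- `G` is a smooth `δ`-graph over the open subset `U` of `S`, inside the regular
`ε`-neighbourhood of `U`, whose regularity is witnessed by `V`. A subset of a space is proper in it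
when it is relatively closed. -/
def IsDeltaGraphIn (S U : Set Ω) (δ ε : ℝ) (V : Set (TangentBundle (𝓡 3) Ω)) (G : Set Ω) : Prop :=
  IsRegularDomain S V ∧ normalDisc S U ε ⊆ V ∧
  IsEmbeddedSurface G ∧
  ((G ⊆ tube S U ε ∧ closure G ∩ tube S U ε ⊆ G) ∨
    (G ⊆ tube S U ε \ U ∧ closure G ∩ (tube S U ε \ U) ⊆ G)) ∧
  ∀ v ∈ tangentSet G, IsParallel V δ v

/-- `G` is a smooth `δ`-graph over the open subset `U` of `S`. -/
def IsDeltaGraph (S U : Set Ω) (δ : ℝ) (G : Set Ω) : Prop :=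
  ∃ ε > 0, ∃ V, IsDeltaGraphIn S U δ ε V G

/-- `G` is a smooth `δ`-cover of the open subset `U` of `S`: a connected `δ`-graph that projects
onto `U`. -/
def IsDeltaCover (S U : Set Ω) (δ : ℝ) (G : Set Ω) : Prop :=
  ∃ ε > 0, ∃ V, IsDeltaGraphIn S U δ ε V G ∧ IsConnected G ∧ footMap V '' G = U

/-- The curve `l : [0,1] → Ω` is a `δ`-lift of the (piecewise smooth) curve `c : [0,1] → S`:
the `δ`-neighbourhood of `c` is regular, `l` takes values in it and projects to `c`, and `l` is
piecewise smooth with `δ`-parallel (one-sided) velocities. -/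
def IsDeltaLift (S : Set Ω) (δ : ℝ) (c l : ℝ → Ω) : Prop :=
  ∃ V, IsRegularDomain S V ∧ normalDisc S (curveImage c) δ ⊆ V ∧
    MapsTo l (Icc 0 1) (tube S (curveImage c) δ) ∧
    (∀ t ∈ Icc (0 : ℝ) 1, footMap V (l t) = c t) ∧
    ∃ (k : ℕ) (s : ℕ → ℝ), s 0 = 0 ∧ s k = 1 ∧
      ∀ i < k, s i < s (i + 1) ∧
        ContMDiffOn 𝓘(ℝ, ℝ) (𝓡 3) ∞ l (Icc (s i) (s (i + 1))) ∧
        ∀ t ∈ Icc (s i) (s (i + 1)), IsParallel V δ (velocity l (Icc (s i) (s (i + 1))) t)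

/-- `l 0, …, l (n-1)` form a generalised simple `δ`-lift of the curves `c 0, …, c (n-1)`, pointed at
`(p, q)`, with respect to the open subset `U` of `S`, the number `ε` and the embedded disk `D`. -/
structure IsGenSimpleLift (S U : Set Ω) (δ ε : ℝ) (D : Set Ω) (p q : Ω) {n : ℕ}
    (c l : Fin n → ℝ → Ω) : Prop where
  disk : IsEmbeddedDisk D
  lift : ∀ i, IsDeltaLift S δ (c i) (l i)
  mapsTo : ∀ i, MapsTo (l i) (Icc 0 1) (D ∩ tube S U ε)
  graph : IsDeltaGraph S U δ (D ∩ tube S U ε)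
  point_mem : q ∈ tube S {p} ε ∩ D
  pointed : ∀ i, q ∈ curveImage (l i)
  cover : ∀ i, IsDeltaCover S U δ (connectedComponentIn (D ∩ tube S U ε) (l i 0))

/-- The generalised simple lift property of a surface `S`: for every non-empty connected pre-compact
open subset `U` of `S`, all sufficiently small `δ > 0` and every `p ∈ U`, every finite
non-empty family of smooth curves in `U` passing through `p` has a generalised simple `δ`-lift
pointed at `(p, q)` for some `q`. -/
def HasGenSimpleLiftProperty (S : Set Ω) : Prop :=
  ∀ U : Set Ω, IsPrecompactOpenIn S U → IsConnected U →
    ∃ δ₁ > 0, ∀ δ : ℝ, 0 < δ → δ < δ₁ → ∀ p ∈ U,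
      ∀ (n : ℕ) (c : Fin n → ℝ → Ω), 0 < n → (∀ i, IsSmoothCurveIn U (c i)) →
        (∀ i, p ∈ curveImage (c i)) →
        ∃ ε > 0, ∃ (D : Set Ω) (q : Ω) (l : Fin n → ℝ → Ω), IsGenSimpleLift S U δ ε D p q c l

/-- `l` is a generalised simple `δ`-lift of the single curve `c`. -/
def IsSimpleLift (S : Set Ω) (δ : ℝ) (c l : ℝ → Ω) : Prop :=
  ∃ U : Set Ω, IsPrecompactOpenIn S U ∧ curveImage c ⊆ U ∧
    ∃ ε > 0, ∃ (D : Set Ω) (p q : Ω), p ∈ curveImage c ∧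
      IsGenSimpleLift S U δ ε D p q (fun _ : Fin 1 => c) (fun _ : Fin 1 => l)

/-- The open lift property of a closed curve `c` in `S`. -/
def HasOpenLiftProperty (S : Set Ω) (c : ℝ → Ω) : Prop :=
  ∃ δ₀ > 0, ∀ δ : ℝ, 0 < δ → δ < δ₀ → ¬ ∃ l : ℝ → Ω, IsSimpleLift S δ c l ∧ IsClosedCurve l

/-- The closed lift property of a closed curve `c` in `S`. -/
def HasClosedLiftProperty (S : Set Ω) (c : ℝ → Ω) : Prop := ¬ HasOpenLiftProperty S c

/-- The embedded lift property of `c`: there are embedded generalised simple `δᵢ`-lifts of `c` for a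
sequence `δᵢ → 0`. -/
def HasEmbeddedLiftProperty (S : Set Ω) (c : ℝ → Ω) : Prop :=
  ∃ (δ : ℕ → ℝ) (l : ℕ → ℝ → Ω), (∀ i, 0 < δ i) ∧ Tendsto δ atTop (𝓝 0) ∧
    ∀ i, IsSimpleLift S (δ i) c (l i) ∧ IsEmbeddedCurve (l i)

/-- The embedded closed lift property of `c`: there are closed embedded generalised simple
`δᵢ`-lifts of `c` for a sequence `δᵢ → 0`. -/
def HasEmbeddedClosedLiftProperty (S : Set Ω) (c : ℝ → Ω) : Prop :=
  ∃ (δ : ℕ → ℝ) (l : ℕ → ℝ → Ω), (∀ i, 0 < δ i) ∧ Tendsto δ atTop (𝓝 0) ∧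
    ∀ i, IsSimpleLift S (δ i) c (l i) ∧ IsClosedCurve (l i) ∧ IsEmbeddedCurve (l i)

end Riemannian

end LiftProperty

end

open LiftProperty

/-! Over a point `x` of a two-sided `U`, a graph `G` is a set of heights on the normal line, which a
continuous normal frame orders. Any two of these heights have only finitely many others between
them. The main point is that the signed number of sheets of `G` between two lifts of the same curve
does not change along the curve (`exists_height_signedCount_eq`): above a curve `G` is locally the
graph of a height function (`isLocallyGraphOver`), and the part of it between two lifts is compact
(`isCompact_between`). Lifting along a loop at `p` therefore shifts the ordered fibre over `p` by a
fixed number of places, wherever such lifts exist, and two shifts commute. Concretely, let `a₀, …,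
a₄` be the successive corners of a lift of the commutator and `[x, y]` the signed count. Comparing
the two passages over `α` gives `[a₀, a₃] = [a₁, a₂]`, and those over `β` give `[a₁, a₄] = [a₂,
a₃]`. Additivity leaves `[a₀, a₄] = 0`, so `a₄ = a₀` (`commutator_closed`).

Compactness is delicate when `G` is closed only in the complement of `U`. Then `G`, being connected
and disjoint from the zero section, stays on one side of it, so height `0` never lies between two
points of a fibre (`mem_fibreHeights_of_mem_closure`). This uses that the exponential of a zero
vector is its base point, which follows from conservation of energy along geodesics
(`hasDerivAt_energy`).

The lift property concerns smooth curves, whereas the commutator has corners. Slowing the pieces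
down near their ends makes the concatenation smooth, and the lift is reparametrised afterwards
(`exists_lifts`). Continuous lifts suffice throughout: a lift inside `G` is automatically piecewise
smooth and parallel, and every piece is itself a generalised simple lift with the same disk
(`isSimpleLift`).

For the embedded statement, the open lift property makes consecutive corners of the closed
quadrilateral `a₀ a₁ a₂ a₃` distinct. If `a₀ = a₂`, the lift of `αβ` closes up; if `a₁ = a₃`, that
of `βα⁻¹` does; otherwise all four corners differ and the lift of the commutator is embedded. One of
the three alternatives occurs for arbitrarily small `δ`. -/

namespace LiftProperty

/-! ### Velocities of curves. -/

section Velocity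

variable {Ω : Type*} [TopologicalSpace Ω] [ChartedSpace E3 Ω]

theorem velocity_congr {c d : ℝ → Ω} {J : Set ℝ} {t : ℝ} (h : c =ᶠ[𝓝[J] t] d) (ht : c t = d t) :
    velocity c J t = velocity d J t := by
  have h1 : (mfderivWithin 𝓘(ℝ, ℝ) (𝓡 3) c J t : ℝ →L[ℝ] E3) =
      mfderivWithin 𝓘(ℝ, ℝ) (𝓡 3) d J t := h.mfderivWithin_eq ht
  refine TotalSpace.ext ht ?_
  exact heq_of_eq (congrArg (fun L : ℝ →L[ℝ] E3 => L 1) h1)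

theorem velocity_comp {E : Type*} [NormedAddCommGroup E] [NormedSpace ℝ E]
    {H : Type*} [TopologicalSpace H] {I : ModelWithCorners ℝ E H}
    {M : Type*} [TopologicalSpace M] [ChartedSpace H M] {f : M → Ω} {x : ℝ → M}
    {J : Set ℝ} {t : ℝ} (hJ : UniqueDiffWithinAt ℝ J t) (hf : MDifferentiableAt I (𝓡 3) f (x t))
    (hx : MDifferentiableWithinAt 𝓘(ℝ, ℝ) I x J t) :
    velocity (f ∘ x) J t =
      ⟨f (x t), mfderiv I (𝓡 3) f (x t) (mfderivWithin 𝓘(ℝ, ℝ) I x J t (1 : ℝ))⟩ := by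
  refine TotalSpace.ext rfl (heq_of_eq ?_)
  have h := mfderiv_comp_mfderivWithin t hf hx (uniqueMDiffWithinAt_iff_uniqueDiffWithinAt.2 hJ)
  exact congrArg (fun L : ℝ →L[ℝ] E3 => L 1) h

theorem velocity_comp_vectorSpace {E : Type*} [NormedAddCommGroup E] [NormedSpace ℝ E]
    {f : E → Ω} {x : ℝ → E}
    {J : Set ℝ} {t : ℝ} (hJ : UniqueDiffWithinAt ℝ J t)
    (hf : MDifferentiableAt 𝓘(ℝ, E) (𝓡 3) f (x t)) {v : E} (hx : HasDerivWithinAt x v J t) :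
    velocity (f ∘ x) J t = ⟨f (x t), mfderiv 𝓘(ℝ, E) (𝓡 3) f (x t) v⟩ := by
  rw [velocity_comp (I := 𝓘(ℝ, E)) hJ hf hx.differentiableWithinAt.mdifferentiableWithinAt,
    ← hx.derivWithin hJ]
  refine TotalSpace.ext rfl (heq_of_eq ?_)
  simp only [mfderivWithin_eq_fderivWithin]
  rfl

end Velocity

/-! ### Conservation of energy and the exponential of zero vectors. -/

section Energy

variable {Ω : Type*} [TopologicalSpace Ω] [ChartedSpace E3 Ω] [IsManifold (𝓡 3) ∞ Ω]

theorem contMDiffAt_mfderiv_apply_of_isOpen {f : E3 → Ω} {s : Set E3} (hs : IsOpen s)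
    (hf : ContMDiffOn 𝓘(ℝ, E3) (𝓡 3) ∞ f s) {y : E3} (hy : y ∈ s) (w : E3) :
    ContMDiffAt 𝓘(ℝ, E3) (𝓡 3).tangent ∞
      (fun m => (⟨f m, mfderiv 𝓘(ℝ, E3) (𝓡 3) f m w⟩ : TangentBundle (𝓡 3) Ω)) y := by
  have h1 := hf.contMDiffOn_tangentMapWithin (m := ∞) (by simp) hs.uniqueMDiffOn
  have h2 : ContMDiff 𝓘(ℝ, E3) 𝓘(ℝ, E3).tangent ∞
      (fun m : E3 => (⟨m, w⟩ : TangentBundle 𝓘(ℝ, E3) E3)) := by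
    intro m
    refine (contMDiffAt_section (E := TangentSpace 𝓘(ℝ, E3)) (s := fun _ => w) m).2 ?_
    have h : ∀ x : E3, (trivializationAt E3 (TangentSpace 𝓘(ℝ, E3)) m
        (⟨x, w⟩ : TangentBundle 𝓘(ℝ, E3) E3)).2 = w := by
      intro x
      simp
    exact (contMDiffAt_const (c := w)).congr_of_eventuallyEq (.of_forall h)
  have h3 : ContMDiffOn 𝓘(ℝ, E3) (𝓡 3).tangent ∞
      (fun m => tangentMapWithin 𝓘(ℝ, E3) (𝓡 3) f s (⟨m, w⟩ : TangentBundle 𝓘(ℝ, E3) E3)) s :=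
    h1.comp h2.contMDiffOn (fun m hm => hm)
  refine (h3.contMDiffAt (hs.mem_nhds hy)).congr_of_eventuallyEq ?_
  filter_upwards [hs.mem_nhds hy] with m hm
  simp [tangentMapWithin, mfderivWithin_of_isOpen hs hm]

variable [RiemannianBundle (fun x : Ω => TangentSpace (𝓡 3) x)]
  [IsContMDiffRiemannianBundle (𝓡 3) ∞ E3 (fun x : Ω => TangentSpace (𝓡 3) x)]

theorem contDiffAt_chartMetric (x₀ : Ω) {y : E3} (hy : y ∈ (extChartAt (𝓡 3) x₀).target)
    (v w : E3) : ContDiffAt ℝ ∞ (fun y => chartMetric x₀ y v w) y := by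
  have ho : IsOpen (extChartAt (𝓡 3) x₀).target := isOpen_extChartAt_target x₀
  have hf := contMDiffOn_extChartAt_symm (I := 𝓡 3) (n := ∞) x₀
  exact ((contMDiffAt_mfderiv_apply_of_isOpen ho hf hy v).inner_bundle
    (contMDiffAt_mfderiv_apply_of_isOpen ho hf hy w)).contDiffAt

theorem isContinuousRiemannianBundle_tangentSpace :
    IsContinuousRiemannianBundle E3 (fun x : Ω => TangentSpace (𝓡 3) x) := by
  obtain ⟨g, hg, h⟩ := IsContMDiffRiemannianBundle.exists_contMDiff (IB := 𝓡 3) (n := ∞) (F := E3)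
    (E := fun x : Ω => TangentSpace (𝓡 3) x)
  exact ⟨g, hg.continuous, h⟩

/-- Uniformity in both `y` and `v` is what makes the error term in `hasDerivAt_energy` quadratic. -/
theorem eventually_abs_chartMetric_le (x₀ : Ω) : ∃ C : ℝ, ∀ᶠ y in 𝓝 (extChartAt (𝓡 3) x₀ x₀),
    ∀ v : E3, |chartMetric x₀ y v v| ≤ C * ‖v‖ ^ 2 := by
  have := isContinuousRiemannianBundle_tangentSpace (Ω := Ω)
  obtain ⟨C, hC, h⟩ := eventually_norm_mfderivWithin_symm_extChartAt_lt (𝓡 3) x₀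
  simp only [ModelWithCorners.range_eq_univ, nhdsWithin_univ, mfderivWithin_univ] at h
  refine ⟨C ^ 2, ?_⟩
  filter_upwards [h] with y hy v
  have h1 : ‖mfderiv 𝓘(ℝ, E3) (𝓡 3) (extChartAt (𝓡 3) x₀).symm y v‖ ≤ C * ‖v‖ :=
    (ContinuousLinearMap.le_opNorm _ v).trans (by gcongr; exact hy.le)
  rw [chartMetric, real_inner_self_eq_norm_sq, abs_of_nonneg (by positivity), ← mul_pow]
  gcongr

omit [IsManifold (𝓡 3) ∞ Ω] [IsContMDiffRiemannianBundle (𝓡 3) ∞ E3 fun x : Ω => TangentSpace (𝓡 3) x] in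
theorem chartMetric_add_add (x₀ : Ω) (y u w : E3) :
    chartMetric x₀ y (u + w) (u + w) =
      2 * chartMetric x₀ y (u + w) w - chartMetric x₀ y w w + chartMetric x₀ y u u := by
  simp only [chartMetric]
  have h : mfderiv 𝓘(ℝ, E3) (𝓡 3) (extChartAt (𝓡 3) x₀).symm y (u + w) =
      mfderiv 𝓘(ℝ, E3) (𝓡 3) (extChartAt (𝓡 3) x₀).symm y u +
      mfderiv 𝓘(ℝ, E3) (𝓡 3) (extChartAt (𝓡 3) x₀).symm y w := map_add _ _ _
  rw [h]
  simp only [inner_add_left, inner_add_right]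
  rw [real_inner_comm (mfderiv 𝓘(ℝ, E3) (𝓡 3) (extChartAt (𝓡 3) x₀).symm y u)
    (mfderiv 𝓘(ℝ, E3) (𝓡 3) (extChartAt (𝓡 3) x₀).symm y w)]
  ring

/-- Freeze `w = x'(t)` and expand `g(x', x')` around it by `chartMetric_add_add`. The geodesic
equation tested on `w` shows that the first term has derivative `∂_w g(w, w)`, which cancels against
that of `g(w, w)`. The remainder is quadratic in `x' - w`, hence `O((s - t) ^ 2)`, and has
derivative zero. -/
theorem hasDerivAt_energy {c : ℝ → Ω} {J : Set ℝ} (hJ : IsOpen J) (hc : IsGeodesicOn c J) {t : ℝ}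
    (ht : t ∈ J) : HasDerivAt (fun s => ‖(velocity c J s).2‖ ^ 2) 0 t := by
  set φ := extChartAt (𝓡 3) (c t) with hφ
  set x : ℝ → E3 := fun r => φ (c r) with hx
  have hcs : ∀ s ∈ J, ContMDiffAt 𝓘(ℝ, ℝ) (𝓡 3) ∞ c s := fun s hs =>
    hc.1.contMDiffAt (hJ.mem_nhds hs)
  have hsrc : ∀ᶠ s in 𝓝 t, s ∈ J ∧ c s ∈ φ.source :=
    Filter.Eventually.and (hJ.mem_nhds ht) ((hcs t ht).continuousAt.eventually
      ((isOpen_extChartAt_source (c t)).mem_nhds (mem_extChartAt_source (c t))))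
  have hxs : ∀ s ∈ J, c s ∈ φ.source → ContDiffAt ℝ ∞ x s := fun s hs hs' =>
    ((contMDiffAt_extChartAt' (by simpa [hφ] using hs')).comp s (hcs s hs)).contDiffAt
  have hxt : ContDiffAt ℝ ∞ x t := hxs t ht (mem_extChartAt_source (c t))
  have hen : (fun s => ‖(velocity c J s).2‖ ^ 2) =ᶠ[𝓝 t]
      fun s => chartMetric (c t) (x s) (deriv x s) (deriv x s) := by
    filter_upwards [hsrc.eventually_nhds] with s hs
    have hs0 := hs.self_of_nhds
    have hxtar : x s ∈ φ.target := φ.map_source hs0.2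
    have h1 : velocity c J s = velocity (φ.symm ∘ x) J s := by
      refine velocity_congr (nhdsWithin_le_nhds ?_) (φ.left_inv hs0.2).symm
      filter_upwards [hs] with r hr using (φ.left_inv hr.2).symm
    have h2 := velocity_comp_vectorSpace (f := φ.symm) (hJ.uniqueDiffWithinAt hs0.1)
      (((contMDiffOn_extChartAt_symm (n := ∞) (c t)).contMDiffAt
        ((isOpen_extChartAt_target (c t)).mem_nhds hxtar)).mdifferentiableAt (by simp))
      ((hxs s hs0.1 hs0.2).differentiableAt (by simp)).hasDerivAt.hasDerivWithinAt
    rw [h1, h2, chartMetric, real_inner_self_eq_norm_sq]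
  set w : E3 := deriv x t with hw
  obtain ⟨C, hC⟩ := eventually_abs_chartMetric_le (c t)
  have hxc : ContinuousAt x t := hxt.continuousAt
  have hd1 := hc.2 t ht w
  have hd2 : HasDerivAt (fun s => chartMetric (c t) (x s) w w)
      (fderiv ℝ (fun y => chartMetric (c t) y w w) (x t) w) t := by
    have h := (((contDiffAt_chartMetric (c t) (mem_extChartAt_target (c t)) w w).differentiableAt
      (by simp)).hasFDerivAt (x := x t)).comp_hasDerivAt t (hxt.differentiableAt (by simp)).hasDerivAt
    exact h
  have hdd : DifferentiableAt ℝ (deriv x) t :=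
    (ContDiffAt.derivWithin (m := ∞) hxt (by simp)).differentiableAt (by simp)
  have hd3 : HasDerivAt (fun s => chartMetric (c t) (x s) (deriv x s - w) (deriv x s - w)) 0 t := by
    have hO : (fun s => chartMetric (c t) (x s) (deriv x s - w) (deriv x s - w)) =O[𝓝 t]
        fun s => (s - t) ^ 2 := by
      have h1 : (fun s => deriv x s - w) =O[𝓝 t] fun s => s - t := hdd.isBigO_sub
      have h2 : (fun s => chartMetric (c t) (x s) (deriv x s - w) (deriv x s - w)) =O[𝓝 t]
          fun s => ‖deriv x s - w‖ ^ 2 := by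
        refine Asymptotics.IsBigO.of_bound C ?_
        filter_upwards [hxc.eventually hC] with s hs
        simpa using hs (deriv x s - w)
      exact h2.trans (h1.norm_left.pow 2)
    have hO' := Asymptotics.IsBigO.hasFDerivAt (𝕜 := ℝ) (x₀ := t) (n := 2)
      (hO.trans (by simpa using Asymptotics.isBigO_refl (fun s : ℝ => (s - t) ^ 2) (𝓝 t))) (by simp)
    simpa using hO'.hasDerivAt
  have hsum := ((hd1.const_mul 2).sub hd2).add hd3
  have h0 : 2 * (1 / 2 * fderiv ℝ (fun y => chartMetric (c t) y (deriv x t) (deriv x t))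
      (φ (c t)) w) - fderiv ℝ (fun y => chartMetric (c t) y w w) (x t) w + 0 = 0 := by
    simp only [hx]; ring
  rw [h0] at hsum
  refine hsum.congr_of_eventuallyEq (hen.trans (.of_forall fun s => ?_))
  have := chartMetric_add_add (c t) (x s) (deriv x s - w) w
  rw [sub_add_cancel] at this
  exact this

/-- Constant speed forces the geodesic to have length zero, so `x` and `q` are at Riemannian
distance zero, and small distance balls separate distinct points. No uniqueness theorem for
geodesics is involved. -/
theorem ExpRel.eq_of_zero [T2Space Ω] {x q : Ω}
    (h : ExpRel (⟨x, 0⟩ : TangentBundle (𝓡 3) Ω) q) : q = x := by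
  obtain ⟨c, J, hJ, hIJ, hc, hv, hq⟩ := h
  have hcont := isContinuousRiemannianBundle_tangentSpace (Ω := Ω)
  have hreg : RegularSpace Ω := by
    have := Manifold.locallyCompact_of_finiteDimensional (𝓡 3) (M := Ω)
    infer_instance
  have hc0 : c 0 = x := congrArg TotalSpace.proj hv
  have hzero : ∀ s ∈ Icc (0 : ℝ) 1, ‖(velocity c J s).2‖ ^ 2 = ‖(velocity c J 0).2‖ ^ 2 := by
    refine constant_of_has_deriv_right_zero (f := fun s => ‖(velocity c J s).2‖ ^ 2) ?_ ?_
    · exact fun s hs => (hasDerivAt_energy hJ hc (hIJ hs)).continuousAt.continuousWithinAt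
    · exact fun s hs => (hasDerivAt_energy hJ hc (hIJ (Ico_subset_Icc_self hs))).hasDerivWithinAt
  have hnorm : ∀ s ∈ Icc (0 : ℝ) 1, mfderiv 𝓘(ℝ, ℝ) (𝓡 3) c s (1 : ℝ) = 0 := by
    intro s hs
    have h := hzero s hs
    rw [hv, norm_zero] at h
    simp only [ne_eq, OfNat.ofNat_ne_zero, not_false_eq_true, zero_pow, pow_eq_zero_iff,
      norm_eq_zero] at h
    rw [← mfderivWithin_of_isOpen hJ (hIJ hs)]
    exact h
  have hlen : Manifold.pathELength (𝓡 3) c 0 1 = 0 := by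
    rw [Manifold.pathELength_eq_lintegral_mfderiv_Icc]
    refine (MeasureTheory.setLIntegral_congr_fun (g := fun _ => 0) measurableSet_Icc
      fun s hs => ?_).trans (by simp)
    exact (congrArg (fun v : TangentSpace (𝓡 3) (c s) => ‖v‖ₑ) (hnorm s hs)).trans enorm_zero
  have hdist : Manifold.riemannianEDist (𝓡 3) x q = 0 := by
    refine le_antisymm ?_ bot_le
    rw [← hlen]
    exact Manifold.riemannianEDist_le_pathELength
      ((hc.1.mono hIJ).of_le (by simp)) hc0 hq zero_le_one
  by_contra hne
  obtain ⟨r, hr, hr'⟩ := setOfPred_riemannianEDist_lt_subset_nhds' (𝓡 3)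
    (isOpen_compl_singleton.mem_nhds (Ne.symm hne : x ≠ q))
  exact hr' (show q ∈ {y | Manifold.riemannianEDist (𝓡 3) x y < r} by
    simpa [hdist] using hr) rfl

theorem expMap_zero [T2Space Ω] {x : Ω}
    (h : (⟨x, 0⟩ : TangentBundle (𝓡 3) Ω) ∈ expDomain) :
    expMap (⟨x, 0⟩ : TangentBundle (𝓡 3) Ω) = x := by
  have h' : ∃ q, ExpRel (⟨x, 0⟩ : TangentBundle (𝓡 3) Ω) q := h
  rw [expMap, dif_pos h']
  exact h'.choose_spec.eq_of_zero

end Energy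

/-! ### Slice charts and tangent vectors of embedded surfaces. -/

section Surface

variable {Ω : Type*} [TopologicalSpace Ω] [ChartedSpace E3 Ω]

/-- `e` is a slice chart of `S`: a smooth chart in which `S` is the coordinate plane. -/
structure IsSliceChart (S : Set Ω) (e : OpenPartialHomeomorph Ω E3) : Prop where
  mem_maximalAtlas : e ∈ IsManifold.maximalAtlas (𝓡 3) ∞ Ω
  image_eq : e '' (S ∩ e.source) = e.target ∩ {y : E3 | y 2 = 0}

variable {S : Set Ω} {e : OpenPartialHomeomorph Ω E3}

theorem IsEmbeddedSurface.exists_isSliceChart (hS : IsEmbeddedSurface S) {x : Ω} (hx : x ∈ S) :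
    ∃ e, IsSliceChart S e ∧ x ∈ e.source := by
  obtain ⟨e, he, hxe, h⟩ := hS x hx
  exact ⟨e, ⟨he, h⟩, hxe⟩

namespace IsSliceChart

theorem apply_mem_iff (he : IsSliceChart S e) {x : Ω} (hx : x ∈ e.source) : e x 2 = 0 ↔ x ∈ S := by
  constructor
  · intro h
    have h1 : e x ∈ e '' (S ∩ e.source) := by
      rw [he.image_eq]; exact ⟨e.map_source hx, h⟩
    obtain ⟨y, ⟨hyS, hye⟩, hyx⟩ := h1
    rwa [← e.injOn hye hx hyx]
  · intro h
    have h1 : e x ∈ e.target ∩ {y : E3 | y 2 = 0} := by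
      rw [← he.image_eq]; exact mem_image_of_mem _ ⟨h, hx⟩
    exact h1.2

theorem symm_mem_iff (he : IsSliceChart S e) {y : E3} (hy : y ∈ e.target) :
    e.symm y ∈ S ↔ y 2 = 0 := by
  rw [← he.apply_mem_iff (e.map_target hy), e.right_inv hy]

theorem contMDiffAt (he : IsSliceChart S e) {x : Ω} (hx : x ∈ e.source) :
    ContMDiffAt (𝓡 3) (𝓡 3) ∞ e x :=
  contMDiffAt_of_mem_maximalAtlas he.mem_maximalAtlas hx

theorem contMDiffAt_symm (he : IsSliceChart S e) {y : E3} (hy : y ∈ e.target) :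
    ContMDiffAt (𝓡 3) (𝓡 3) ∞ e.symm y :=
  contMDiffAt_symm_of_mem_maximalAtlas he.mem_maximalAtlas hy

theorem mdifferentiable (he : IsSliceChart S e) : e.MDifferentiable (𝓡 3) (𝓡 3) :=
  ⟨(contMDiffOn_of_mem_maximalAtlas he.mem_maximalAtlas).mdifferentiableOn (by simp),
    (contMDiffOn_symm_of_mem_maximalAtlas he.mem_maximalAtlas).mdifferentiableOn (by simp)⟩

theorem eventually_line_mem (he : IsSliceChart S e) {y : E3} (hy : y ∈ e.target) (hy2 : y 2 = 0)
    {w : E3} (hw : w 2 = 0) :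
    ∀ᶠ s : ℝ in 𝓝 0, y + s • w ∈ e.target ∧ e.symm (y + s • w) ∈ S := by
  have hc : ContinuousAt (fun s : ℝ => y + s • w) 0 := by fun_prop
  have h1 : ∀ᶠ s : ℝ in 𝓝 0, y + s • w ∈ e.target :=
    hc.eventually (by simpa using e.open_target.mem_nhds hy)
  filter_upwards [h1] with s hs
  exact ⟨hs, (he.symm_mem_iff hs).2 (by simp [hy2, hw])⟩

/-- The vector is the velocity of a straight segment of the coordinate plane, carried back by the
chart. -/
theorem mfderiv_symm_mem_tangentSet (he : IsSliceChart S e) {y : E3} (hy : y ∈ e.target)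
    (hy2 : y 2 = 0) {w : E3} (hw : w 2 = 0) :
    (⟨e.symm y, mfderiv (𝓡 3) (𝓡 3) e.symm y w⟩ : TangentBundle (𝓡 3) Ω) ∈ tangentSet S := by
  obtain ⟨r, hr, h⟩ := Metric.eventually_nhds_iff_ball.1 (he.eventually_line_mem hy hy2 hw)
  rw [Real.ball_eq_Ioo] at h
  simp only [zero_sub, zero_add] at h
  have h0 : (0 : ℝ) ∈ Ioo (-r) r := ⟨by linarith, hr⟩
  have hd : HasDerivAt (fun s : ℝ => y + s • w) w 0 := by
    simpa using ((hasDerivAt_id (0 : ℝ)).smul_const w).const_add y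
  refine ⟨e.symm ∘ fun s : ℝ => y + s • w, r, hr, ?_, fun s hs => (h s hs).2, ?_⟩
  · intro s hs
    have h1 : ContMDiffAt 𝓘(ℝ, ℝ) 𝓘(ℝ, E3) ∞ (fun s : ℝ => y + s • w) s := by
      rw [contMDiffAt_iff_contDiffAt]
      fun_prop
    exact ((he.contMDiffAt_symm (h s hs).1).comp s h1).contMDiffWithinAt
  · have h1 := velocity_comp_vectorSpace (f := e.symm) (isOpen_Ioo.uniqueDiffWithinAt h0)
      ((he.contMDiffAt_symm (h 0 h0).1).mdifferentiableAt (by simp)) hd.hasDerivWithinAt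
    have h2 : y + (0 : ℝ) • w = y := by simp
    exact h1.trans (congrArg
      (fun z => (⟨e.symm z, mfderiv (𝓡 3) (𝓡 3) e.symm z w⟩ : TangentBundle (𝓡 3) Ω)) h2)

end IsSliceChart

/-- `tangentSet` asks for a smooth curve on a two-sided interval, while `l` may be only one-sidedly
differentiable at `t`. In a slice chart the third coordinate vanishes along `l`, so the velocity
lies in the coordinate plane and a straight segment realises it. -/
theorem velocity_mem_tangentSet {G : Set Ω} (hG : IsEmbeddedSurface G) {l : ℝ → Ω} {J : Set ℝ}
    {t : ℝ} (hJ : UniqueDiffWithinAt ℝ J t) (ht : t ∈ J) (hlG : MapsTo l J G)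
    (hl : MDifferentiableWithinAt 𝓘(ℝ, ℝ) (𝓡 3) l J t) : velocity l J t ∈ tangentSet G := by
  obtain ⟨e, he, hte⟩ := hG.exists_isSliceChart (hlG ht)
  have hel : MDifferentiableWithinAt 𝓘(ℝ, ℝ) 𝓘(ℝ, E3) (e ∘ l) J t :=
    ((he.contMDiffAt hte).mdifferentiableAt (by simp)).comp_mdifferentiableWithinAt t hl
  have hd : HasDerivWithinAt (e ∘ l) (derivWithin (e ∘ l) J t) J t :=
    hel.differentiableWithinAt.hasDerivWithinAt
  have hev : ∀ᶠ s in 𝓝[J] t, s ∈ J ∧ l s ∈ e.source :=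
    Filter.Eventually.and self_mem_nhdsWithin
      (hl.continuousWithinAt.eventually (e.open_source.mem_nhds hte))
  have h2 : (derivWithin (e ∘ l) J t) 2 = 0 := by
    have h3 : HasDerivWithinAt (fun s => (e (l s)) 2) ((derivWithin (e ∘ l) J t) 2) J t :=
      (EuclideanSpace.proj (𝕜 := ℝ) (2 : Fin 3)).hasFDerivAt.comp_hasDerivWithinAt t hd
    have h4 : HasDerivWithinAt (fun s => (e (l s)) 2) 0 J t := by
      refine (hasDerivWithinAt_const t J (0 : ℝ)).congr_of_eventuallyEq ?_ ?_
      · filter_upwards [hev] with s hs using (he.apply_mem_iff hs.2).2 (hlG hs.1)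
      · exact (he.apply_mem_iff hte).2 (hlG ht)
    exact hJ.eq_deriv _ h3 h4
  have hy : (e ∘ l) t ∈ e.target := e.map_source hte
  have h5 := velocity_comp_vectorSpace (f := e.symm) hJ
    ((he.contMDiffAt_symm hy).mdifferentiableAt (by simp)) hd
  have h6 : velocity l J t = velocity (e.symm ∘ (e ∘ l)) J t := by
    refine velocity_congr ?_ (e.left_inv hte).symm
    filter_upwards [hev] with s hs using (e.left_inv hs.2).symm
  rw [h6, h5]
  exact he.mfderiv_symm_mem_tangentSet hy ((he.apply_mem_iff hte).2 (hlG ht)) h2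

end Surface

/-! ### The normal line of a surface. -/

section Normal

variable {Ω : Type*} [TopologicalSpace Ω] [ChartedSpace E3 Ω] [IsManifold (𝓡 3) ∞ Ω]
  [RiemannianBundle (fun x : Ω => TangentSpace (𝓡 3) x)]

omit [IsManifold (𝓡 3) ∞ Ω] in
/-- The normal space of an embedded surface is spanned by any of its non-zero vectors. -/
theorem eq_smul_of_mem_normalSet {S : Set Ω} (hS : IsEmbeddedSurface S) {x : Ω}
    {ν v : TangentSpace (𝓡 3) x} (hν : (⟨x, ν⟩ : TangentBundle (𝓡 3) Ω) ∈ normalSet S)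
    (hν0 : ν ≠ 0) (hv : (⟨x, v⟩ : TangentBundle (𝓡 3) Ω) ∈ normalSet S) :
    v = (inner ℝ v ν / inner ℝ ν ν) • ν := by
  obtain ⟨e, he, hxe⟩ := hS.exists_isSliceChart hν.1
  obtain ⟨y, hy, rfl⟩ : ∃ y ∈ e.target, e.symm y = x := ⟨e x, e.map_source hxe, e.left_inv hxe⟩
  have hy2 : y 2 = 0 := (he.symm_mem_iff hy).1 hν.1
  have hsurj : Function.Surjective (mfderiv (𝓡 3) (𝓡 3) e.symm y) :=
    he.mdifferentiable.symm.mfderiv_surjective hy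
  set D : E3 →L[ℝ] TangentSpace (𝓡 3) (e.symm y) := mfderiv (𝓡 3) (𝓡 3) e.symm y with hD
  have horth : ∀ {n : TangentSpace (𝓡 3) (e.symm y)},
      (⟨e.symm y, n⟩ : TangentBundle (𝓡 3) Ω) ∈ normalSet S → ∀ w : E3, w 2 = 0 →
        inner ℝ n (D w) = 0 :=
    fun hn w hw => hn.2 _ (he.mfderiv_symm_mem_tangentSet hy hy2 hw)
  set u := v - (inner ℝ v ν / inner ℝ ν ν) • ν with hu
  have hνν : inner ℝ ν ν ≠ 0 := inner_self_eq_zero.not.2 hν0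
  have huν : inner ℝ u ν = 0 := by
    rw [hu, inner_sub_left, real_inner_smul_left]
    field_simp
    ring
  have huD : ∀ w : E3, w 2 = 0 → inner ℝ u (D w) = 0 := by
    intro w hw
    rw [hu, inner_sub_left, real_inner_smul_left, horth hv w hw, horth hν w hw]
    ring
  obtain ⟨n, hn⟩ : ∃ n : E3, D n = ν := hsurj ν
  obtain ⟨m, hm⟩ : ∃ m : E3, D m = u := hsurj u
  have hn2 : n 2 ≠ 0 := by
    intro h
    have := horth hν n h
    rw [hn] at this
    exact hνν this
  -- Subtracting a multiple of `n` moves `m` into the coordinate plane. Since `u` is also orthogonal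
  -- to `D n = ν`, it turns out to be orthogonal to itself.
  have h1 := huD (m - (m 2 / n 2) • n) (by simp; field_simp; ring)
  rw [map_sub, map_smul, hn, hm, inner_sub_right, real_inner_smul_right, huν, mul_zero,
    sub_zero, inner_self_eq_zero] at h1
  exact sub_eq_zero.1 (hu ▸ h1)

end Normal

/-! ### Foot point maps and local sections of graphs. -/

section RegularDomain

variable {Ω : Type*} [TopologicalSpace Ω] [ChartedSpace E3 Ω] [IsManifold (𝓡 3) ∞ Ω]
  [RiemannianBundle (fun x : Ω => TangentSpace (𝓡 3) x)]
  {S : Set Ω} {V V' : Set (TangentBundle (𝓡 3) Ω)}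

namespace IsRegularDomain

theorem injOn (hV : IsRegularDomain S V) : InjOn expMap V := by
  obtain ⟨-, -, -, -, ψ, -, hψ⟩ := hV
  intro v hv w hw h
  rw [← hψ v hv, ← hψ w hw, h]

theorem subset_normalSet (hV : IsRegularDomain S V) : V ⊆ normalSet S := by
  obtain ⟨⟨W, -, rfl⟩, -⟩ := hV
  exact inter_subset_right

theorem isOpen_image (hV : IsRegularDomain S V) : IsOpen (expMap '' V) := hV.2.2.2.1

theorem footMap_expMap (hV : IsRegularDomain S V) {v : TangentBundle (𝓡 3) Ω} (hv : v ∈ V) :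
    footMap V (expMap v) = v.proj := by
  have h : ∃ w ∈ V, expMap w = expMap v := ⟨v, hv, rfl⟩
  rw [footMap, dif_pos h, hV.injOn h.choose_spec.1 hv h.choose_spec.2]

theorem footMap_mem (hV : IsRegularDomain S V) {q : Ω} (hq : q ∈ expMap '' V) :
    footMap V q ∈ S := by
  obtain ⟨v, hv, rfl⟩ := hq
  rw [hV.footMap_expMap hv]
  exact (hV.subset_normalSet hv).1

theorem contMDiffAt_footMap (hV : IsRegularDomain S V) {q : Ω} (hq : q ∈ expMap '' V) :
    ContMDiffAt (𝓡 3) (𝓡 3) ∞ (footMap V) q := by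
  obtain ⟨-, -, -, ho, ψ, hψs, hψ⟩ := id hV
  have h1 : ContMDiffAt (𝓡 3) (𝓡 3) ∞ (fun y => (ψ y).proj) q :=
    (contMDiff_proj (TangentSpace (𝓡 3) : Ω → Type _)).contMDiffAt.comp q
      (hψs.contMDiffAt (ho.mem_nhds hq))
  refine h1.congr_of_eventuallyEq ?_
  filter_upwards [ho.mem_nhds hq] with y hy
  obtain ⟨v, hv, rfl⟩ := hy
  rw [hV.footMap_expMap hv, hψ v hv]

/-- The foot point maps of two regular domains agree near the image of a common vector. -/
theorem footMap_eventuallyEq (hV : IsRegularDomain S V) (hV' : IsRegularDomain S V')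
    {v : TangentBundle (𝓡 3) Ω} (hv : v ∈ V) (hv' : v ∈ V') :
    footMap V =ᶠ[𝓝 (expMap v)] footMap V' := by
  obtain ⟨⟨W, hW, hVW⟩, -, -, ho, ψ, hψs, hψ⟩ := id hV
  obtain ⟨⟨W', hW', hVW'⟩, -⟩ := id hV'
  have hq : expMap v ∈ expMap '' V := mem_image_of_mem _ hv
  have hc : ContinuousAt ψ (expMap v) := (hψs.contMDiffAt (ho.mem_nhds hq)).continuousAt
  have h1 : ∀ᶠ y in 𝓝 (expMap v), ψ y ∈ W' :=
    hc.eventually (hW'.mem_nhds (by rw [hψ v hv]; rw [hVW'] at hv'; exact hv'.1))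
  filter_upwards [h1, ho.mem_nhds hq] with y hy hy'
  obtain ⟨w, hw, rfl⟩ := hy'
  rw [hψ w hw] at hy
  have hw' : w ∈ V' := by rw [hVW']; exact ⟨hy, hV.subset_normalSet hw⟩
  rw [hV.footMap_expMap hw, hV'.footMap_expMap hw']

end IsRegularDomain

-- Being parallel depends only on the germ of the foot point map, so it can be transferred between
-- regular domains.
omit [IsManifold (𝓡 3) ∞ Ω] in
theorem IsParallel.congr {δ : ℝ} {v : TangentBundle (𝓡 3) Ω} (h : IsParallel V δ v)
    (hVV' : footMap V =ᶠ[𝓝 v.proj] footMap V') : IsParallel V' δ v := by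
  have hd : (mfderiv (𝓡 3) (𝓡 3) (footMap V) v.proj : E3 →L[ℝ] E3) =
      mfderiv (𝓡 3) (𝓡 3) (footMap V') v.proj := hVV'.mfderiv_eq
  have h0 : ∀ w : TangentSpace (𝓡 3) v.proj,
      mfderiv (𝓡 3) (𝓡 3) (footMap V') v.proj w = 0 →
        mfderiv (𝓡 3) (𝓡 3) (footMap V) v.proj w = 0 := by
    intro w hw
    exact (congrArg (fun T : E3 →L[ℝ] E3 => T w) hd).trans hw
  have h0' : ∀ w : TangentSpace (𝓡 3) v.proj,
      mfderiv (𝓡 3) (𝓡 3) (footMap V) v.proj w = 0 →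
        mfderiv (𝓡 3) (𝓡 3) (footMap V') v.proj w = 0 := by
    intro w hw
    exact (congrArg (fun T : E3 →L[ℝ] E3 => T w) hd).symm.trans hw
  have hn : ‖mfderiv (𝓡 3) (𝓡 3) (footMap V) v.proj v.2‖ =
      ‖mfderiv (𝓡 3) (𝓡 3) (footMap V') v.proj v.2‖ := by
    -- The two derivatives land in tangent spaces at formally different points, so their norms are
    -- compared through the total space.
    have h1 : (⟨footMap V v.proj, mfderiv (𝓡 3) (𝓡 3) (footMap V) v.proj v.2⟩ :
        TangentBundle (𝓡 3) Ω) =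
        ⟨footMap V' v.proj, mfderiv (𝓡 3) (𝓡 3) (footMap V') v.proj v.2⟩ :=
      TotalSpace.ext hVV'.self_of_nhds
        (heq_of_eq (congrArg (fun T : E3 →L[ℝ] E3 => T v.2) hd))
    exact congrArg (fun u : TangentBundle (𝓡 3) Ω => ‖u.2‖) h1
  obtain ⟨a, b, hab, ha, hb, h1, h2, h3⟩ := h
  exact ⟨a, b, hab, h0' a ha, fun w hw => hb w (h0 w hw), h1, hn ▸ h2, hn ▸ h3⟩

omit [IsManifold (𝓡 3) ∞ Ω] in
/-- A non-zero vector which is `δ`-parallel for some `δ < 1` is not tangent to the fibre. -/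
theorem IsParallel.eq_zero_of_mfderiv_eq_zero {δ : ℝ} {v : TangentBundle (𝓡 3) Ω}
    (h : IsParallel V δ v) (hδ : 0 < δ) (hδ1 : δ < 1)
    (h0 : mfderiv (𝓡 3) (𝓡 3) (footMap V) v.proj v.2 = 0) : v.2 = 0 := by
  obtain ⟨a, b, hab, -, -, ha, hb, -⟩ := h
  rw [h0, norm_zero] at hb
  have hb0 : ‖b‖ ≤ 0 := by
    have : 0 < 1 / (1 + δ) := by positivity
    nlinarith
  rw [norm_le_zero_iff] at hb0
  rw [hb0, add_zero] at hab
  rw [← hab] at ha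
  by_contra hne
  have := norm_pos_iff.2 hne
  nlinarith

theorem exists_local_inverse {Φ : E3 → E3} {y : E3} (hΦ : ContDiffAt ℝ ∞ Φ y)
    (hinj : ∀ v, fderiv ℝ Φ y v = 0 → v = 0) :
    ∃ Ψ : E3 → E3, ContDiffAt ℝ ∞ Ψ (Φ y) ∧ (∀ᶠ z in 𝓝 y, Ψ (Φ z) = z) ∧
      ∀ᶠ z in 𝓝 (Φ y), Φ (Ψ z) = z := by
  have hker : (fderiv ℝ Φ y : E3 →ₗ[ℝ] E3).ker = ⊥ :=
    LinearMap.ker_eq_bot'.2 hinj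
  let L : E3 ≃L[ℝ] E3 := (LinearEquiv.ofInjectiveEndo (fderiv ℝ Φ y : E3 →ₗ[ℝ] E3)
    (LinearMap.ker_eq_bot.1 hker)).toContinuousLinearEquiv
  have hL : (L : E3 →L[ℝ] E3) = fderiv ℝ Φ y := by ext v : 1; rfl
  have hd : HasFDerivAt Φ (L : E3 →L[ℝ] E3) y := by
    rw [hL]; exact (hΦ.differentiableAt (by simp)).hasFDerivAt
  have hs : HasStrictFDerivAt Φ (L : E3 →L[ℝ] E3) y := hΦ.hasStrictFDerivAt' hd (by simp)
  exact ⟨hΦ.localInverse hd (by simp), hΦ.to_localInverse hd (by simp),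
    hs.eventually_left_inverse, hs.eventually_right_inverse⟩

/-- Near a point of a surface with `δ`-parallel tangent vectors, `δ < 1`, the foot point map
restricted to the surface has a smooth local inverse. -/
theorem exists_local_section (hS : IsEmbeddedSurface S) (hV : IsRegularDomain S V) {G : Set Ω}
    (hG : IsEmbeddedSurface G) {δ : ℝ} (hδ : 0 < δ) (hδ1 : δ < 1)
    (hpar : ∀ v ∈ tangentSet G, IsParallel V δ v) {q : Ω} (hqG : q ∈ G) (hq : q ∈ expMap '' V) :
    ∃ σ : Ω → Ω, ContMDiffAt (𝓡 3) (𝓡 3) ∞ σ (footMap V q) ∧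
      (∀ᶠ y in 𝓝 q, y ∈ G → σ (footMap V y) = y) ∧
      ∀ᶠ x in 𝓝 (footMap V q), x ∈ S → σ x ∈ G ∧ footMap V (σ x) = x := by
  obtain ⟨e, he, hqe⟩ := hG.exists_isSliceChart hqG
  obtain ⟨y, hy, rfl⟩ : ∃ y ∈ e.target, e.symm y = q := ⟨e q, e.map_source hqe, e.left_inv hqe⟩
  have hy2 : y 2 = 0 := (he.symm_mem_iff hy).1 hqG
  obtain ⟨e', he', hqe'⟩ := hS.exists_isSliceChart (hV.footMap_mem hq)
  set f := footMap V with hf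
  have hfs := hV.contMDiffAt_footMap hq
  have hes := he.contMDiffAt_symm hy
  have he's := he'.contMDiffAt hqe'
  set n : E3 := EuclideanSpace.single 2 1 with hn
  set F : E3 → E3 := fun z => e' (f (e.symm z)) with hF
  -- Near `y` the map `F` takes values in the coordinate plane, so it is not locally invertible.
  -- Adding the third coordinate of `z` gives a map with injective derivative that agrees with `F`
  -- on the slice `z 2 = 0`.
  set Φ : E3 → E3 := fun z => F z + z 2 • n with hΦ
  have hFs : ContDiffAt ℝ ∞ F y := (he's.comp y (hfs.comp y hes)).contDiffAt
  have hΦs : ContDiffAt ℝ ∞ Φ y := by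
    refine hFs.add ?_
    have : ContDiff ℝ ∞ (fun z : E3 => (EuclideanSpace.proj (𝕜 := ℝ) (2 : Fin 3)) z • n) := by
      fun_prop
    exact this.contDiffAt
  -- near `y` the map `F` takes values in the coordinate plane
  have hFev : ∀ᶠ z in 𝓝 y, z ∈ e.target ∧ f (e.symm z) ∈ e'.source ∧ F z 2 = 0 := by
    have h1 : ∀ᶠ z in 𝓝 y, e.symm z ∈ expMap '' V :=
      hes.continuousAt.eventually (hV.isOpen_image.mem_nhds hq)
    have h2 : ∀ᶠ z in 𝓝 y, f (e.symm z) ∈ e'.source :=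
      (hfs.comp y hes).continuousAt.eventually (e'.open_source.mem_nhds hqe')
    filter_upwards [h1, h2, e.open_target.mem_nhds hy] with z hz1 hz2 hz3
    exact ⟨hz3, hz2, (he'.apply_mem_iff hz2).2 (hV.footMap_mem hz1)⟩
  have hF2 : ∀ v, fderiv ℝ F y v 2 = 0 := by
    intro v
    have h1 : HasFDerivAt (fun z => F z 2)
        ((EuclideanSpace.proj (𝕜 := ℝ) (2 : Fin 3)).comp (fderiv ℝ F y)) y :=
      (EuclideanSpace.proj (𝕜 := ℝ) (2 : Fin 3)).hasFDerivAt.comp y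
        (hFs.differentiableAt (by simp)).hasFDerivAt
    have h2 : HasFDerivAt (fun z => F z 2) (0 : E3 →L[ℝ] ℝ) y :=
      (hasFDerivAt_const (0 : ℝ) y).congr_of_eventuallyEq (hFev.mono fun z hz => hz.2.2)
    have h3 := h1.unique h2
    exact congrArg (fun T : E3 →L[ℝ] ℝ => T v) h3
  have hΦd : ∀ v, fderiv ℝ Φ y v = fderiv ℝ F y v + v 2 • n := by
    intro v
    have h1 : HasFDerivAt (fun z : E3 => z 2 • n)
        ((EuclideanSpace.proj (𝕜 := ℝ) (2 : Fin 3)).smulRight n) y :=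
      ((EuclideanSpace.proj (𝕜 := ℝ) (2 : Fin 3)).smulRight n).hasFDerivAt
    have h0 : HasFDerivAt F (fderiv ℝ F y) y := (hFs.differentiableAt (by simp)).hasFDerivAt
    have h2 := h0.fun_add h1
    exact congrArg (fun T : E3 →L[ℝ] E3 => T v) h2.fderiv
  have hinj : ∀ v, fderiv ℝ Φ y v = 0 → v = 0 := by
    intro v hv
    rw [hΦd] at hv
    have hv2 : v 2 = 0 := by
      have := congrArg (fun w : E3 => w 2) hv
      simpa [hF2 v, hn] using this
    rw [hv2, zero_smul, add_zero] at hv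
    have hFd : fderiv ℝ F y v = mfderiv (𝓡 3) (𝓡 3) e' (f (e.symm y))
        (mfderiv (𝓡 3) (𝓡 3) f (e.symm y) (mfderiv (𝓡 3) (𝓡 3) e.symm y v)) := by
      have h1 := ((he's.mdifferentiableAt (by simp)).hasMFDerivAt.comp y
        ((hfs.mdifferentiableAt (by simp)).hasMFDerivAt.comp y
          (hes.mdifferentiableAt (by simp)).hasMFDerivAt))
      have h2 : ∀ T : E3 →L[ℝ] E3, T = (mfderiv (𝓡 3) (𝓡 3) e' (f (e.symm y))).comp
          ((mfderiv (𝓡 3) (𝓡 3) f (e.symm y)).comp (mfderiv (𝓡 3) (𝓡 3) e.symm y)) →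
          HasFDerivAt F T y := by
        rintro T rfl
        exact hasMFDerivAt_iff_hasFDerivAt.1 h1
      exact congrArg (fun T : E3 →L[ℝ] E3 => T v) (h2 _ rfl).fderiv
    have h3 := (injective_iff_map_eq_zero _).1 (he'.mdifferentiable.mfderiv_injective hqe') _
      (hFd.symm.trans hv)
    have h4 := (hpar _ (he.mfderiv_symm_mem_tangentSet hy hy2 hv2)).eq_zero_of_mfderiv_eq_zero
      hδ hδ1 h3
    exact (injective_iff_map_eq_zero _).1 (he.mdifferentiable.symm.mfderiv_injective hy) _ h4
  obtain ⟨Ψ, hΨs, hΨl, hΨr⟩ := exists_local_inverse hΦs hinj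
  have hΦy : Φ y = e' (f (e.symm y)) := by simp [hΦ, hF, hy2]
  rw [hΦy] at hΨs hΨr
  have hΨy : Ψ (e' (f (e.symm y))) = y := by rw [← hΦy]; exact hΨl.self_of_nhds
  refine ⟨fun x => e.symm (Ψ (e' x)), ?_, ?_, ?_⟩
  · have h1 : ContMDiffAt (𝓡 3) (𝓡 3) ∞ (fun x => Ψ (e' x)) (f (e.symm y)) :=
      hΨs.contMDiffAt.comp _ he's
    exact ContMDiffAt.comp _ (by rw [hΨy]; exact hes) h1
  · have hc : ContinuousAt e (e.symm y) := e.continuousAt hqe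
    have h1 : ∀ᶠ z in 𝓝 (e.symm y), Ψ (Φ (e z)) = e z :=
      hc.eventually (by rw [e.right_inv hy]; exact hΨl)
    filter_upwards [h1, e.open_source.mem_nhds hqe] with z hz1 hz2 hzG
    have hz : Φ (e z) = e' (f z) := by
      simp [hΦ, hF, (he.apply_mem_iff hz2).2 hzG, e.left_inv hz2]
    rw [← hz, hz1, e.left_inv hz2]
  · have hc : ContinuousAt e' (f (e.symm y)) := he's.continuousAt
    have h1 : ∀ᶠ x in 𝓝 (f (e.symm y)), Φ (Ψ (e' x)) = e' x := hc.eventually hΨr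
    have hc2 : ContinuousAt (fun x => Ψ (e' x)) (f (e.symm y)) :=
      ContinuousAt.comp (f := e') hΨs.continuousAt hc
    have h2 := hc2.eventually (p := fun z => z ∈ e.target ∧ f (e.symm z) ∈ e'.source ∧ F z 2 = 0)
      (by simpa only [hΨy] using hFev)
    filter_upwards [h1, h2, e'.open_source.mem_nhds hqe'] with x hx1 hx2 hx3 hxS
    have hx4 : Ψ (e' x) 2 = 0 := by
      have := congrArg (fun w : E3 => w 2) hx1
      simpa [hΦ, hx2.2.2, hn, (he'.apply_mem_iff hx3).2 hxS] using this
    refine ⟨(he.symm_mem_iff hx2.1).2 hx4, e'.injOn hx2.2.1 hx3 ?_⟩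
    simpa [hΦ, hF, hx4] using hx1

end RegularDomain

/-! ### Signed counting in a locally finite ordered set. -/

section SignedCount

/-- The number of elements of `H` in `[a, b)`, counted negatively when `b < a`. -/
noncomputable def signedCount (H : Set ℝ) (a b : ℝ) : ℤ :=
  (H ∩ Ico a b).ncard - (H ∩ Ico b a).ncard

variable {H : Set ℝ}

theorem signedCount_of_le {a b : ℝ} (h : a ≤ b) : signedCount H a b = (H ∩ Ico a b).ncard := by
  simp [signedCount, Ico_eq_empty (not_lt.2 h)]

theorem signedCount_swap (a b : ℝ) : signedCount H a b = -signedCount H b a := by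
  simp [signedCount]

/-- Measured from a common lower bound, here the least of the three points, each signed count is a
difference of two ordinary counts, and the sum telescopes. -/
theorem signedCount_add (hfin : ∀ a ∈ H, ∀ b ∈ H, (H ∩ Icc a b).Finite) {a b c : ℝ} (ha : a ∈ H)
    (hb : b ∈ H) (hc : c ∈ H) : signedCount H a b + signedCount H b c = signedCount H a c := by
  have key : ∀ {m x y : ℝ}, m ∈ H → x ∈ H → y ∈ H → m ≤ x → m ≤ y →
      signedCount H x y = signedCount H m y - signedCount H m x := by
    have main : ∀ {m x y : ℝ}, m ∈ H → y ∈ H → m ≤ x → x ≤ y →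
        signedCount H m y = signedCount H m x + signedCount H x y := by
      intro m x y hm hy hmx hxy
      rw [signedCount_of_le (hmx.trans hxy), signedCount_of_le hmx, signedCount_of_le hxy,
        ← Ico_union_Ico_eq_Ico hmx hxy, inter_union_distrib_left, ncard_union_eq
          (Ico_disjoint_Ico_same.mono inter_subset_right inter_subset_right)
          ((hfin m hm y hy).subset (inter_subset_inter_right _
            ((Ico_subset_Ico_right hxy).trans Ico_subset_Icc_self)))
          ((hfin m hm y hy).subset (inter_subset_inter_right _
            ((Ico_subset_Ico_left hmx).trans Ico_subset_Icc_self)))]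
      push_cast
      ring
    intro m x y hm hx hy hmx hmy
    rcases le_total x y with h | h
    · rw [main hm hy hmx h]; ring
    · rw [main hm hx hmy h, signedCount_swap x y]; ring
  obtain ⟨m, hm, hma, hmb, hmc⟩ : ∃ m ∈ H, m ≤ a ∧ m ≤ b ∧ m ≤ c := by
    rcases le_total a b with h1 | h1 <;> rcases le_total b c with h2 | h2 <;>
      rcases le_total a c with h3 | h3
    all_goals first
      | exact ⟨a, ha, le_rfl, by linarith, by linarith⟩
      | exact ⟨b, hb, by linarith, le_rfl, by linarith⟩
      | exact ⟨c, hc, by linarith, by linarith, le_rfl⟩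
  rw [key hm ha hb hma hmb, key hm hb hc hmb hmc, key hm ha hc hma hmc]
  ring

/-- For `x < y` the interval `[x, y)` contains `x` itself, so its count is positive; finiteness
keeps `ncard` from taking its default value `0`. -/
theorem eq_of_signedCount_eq_zero (hfin : ∀ a ∈ H, ∀ b ∈ H, (H ∩ Icc a b).Finite) {a b : ℝ}
    (ha : a ∈ H) (hb : b ∈ H) (h : signedCount H a b = 0) : a = b := by
  have main : ∀ {x y : ℝ}, x ∈ H → y ∈ H → x < y → signedCount H x y ≠ 0 := by
    intro x y hx hy hxy
    rw [signedCount_of_le hxy.le]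
    have : (H ∩ Ico x y).ncard ≠ 0 := by
      rw [Ne, ncard_eq_zero ((hfin x hx y hy).subset
        (inter_subset_inter_right _ Ico_subset_Icc_self))]
      exact Nonempty.ne_empty ⟨x, hx, le_rfl, hxy⟩
    exact_mod_cast this
  rcases lt_trichotomy a b with h1 | h1 | h1
  · exact absurd h (main ha hb h1)
  · exact h1
  · exact absurd (by rw [signedCount_swap, h, neg_zero]) (main hb ha h1)

end SignedCount

/-! ### Constancy of the number of branches between two branches. -/

section GraphFamily

/-- `Q` is, over the set `I` of times, locally the graph of a continuous function of the time. -/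
def IsLocallyGraphOver (I : Set ℝ) (Q : Set (ℝ × ℝ)) : Prop :=
  ∀ t₀ ∈ I, ∀ z₀, (t₀, z₀) ∈ Q → ∃ s : ℝ → ℝ, ContinuousWithinAt s I t₀ ∧ s t₀ = z₀ ∧
    ∀ᶠ r in 𝓝[I ×ˢ univ] (t₀, z₀), r ∈ Q ↔ r.2 = s r.1

variable {I : Set ℝ} {Q : Set (ℝ × ℝ)} {f g : ℝ → ℝ}

/-- The part of the time `t` slice of `Q` between the functions `f` and `g`. -/
def sliceBetween (Q : Set (ℝ × ℝ)) (f g : ℝ → ℝ) (t : ℝ) : Set ℝ :=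
  {z | (t, z) ∈ Q ∧ z ∈ Icc (f t) (g t)}

/-- By compactness an infinite slice would accumulate at one of its own points, but near that point
a local graph has a single point over time `t`. -/
theorem finite_sliceBetween (hQ : IsLocallyGraphOver I Q)
    (hK : IsCompact {r : ℝ × ℝ | r.1 ∈ I ∧ r.2 ∈ sliceBetween Q f g r.1}) {t : ℝ} (ht : t ∈ I) :
    (sliceBetween Q f g t).Finite := by
  have hc : IsCompact (sliceBetween Q f g t) := by
    have h1 : sliceBetween Q f g t = Prod.snd ''
        ({r : ℝ × ℝ | r.1 ∈ I ∧ r.2 ∈ sliceBetween Q f g r.1} ∩ Prod.fst ⁻¹' {t}) := by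
      ext z
      constructor
      · intro hz
        exact ⟨(t, z), ⟨⟨ht, hz⟩, rfl⟩, rfl⟩
      · rintro ⟨⟨t', z'⟩, ⟨⟨-, h2⟩, h3⟩, rfl⟩
        obtain rfl : t' = t := h3
        exact h2
    rw [h1]
    exact (hK.inter_right (isClosed_singleton.preimage continuous_fst)).image continuous_snd
  by_contra hinf
  obtain ⟨z, hz, hacc⟩ := Set.Infinite.exists_accPt_of_subset_isCompact hinf hc Subset.rfl
  obtain ⟨s, -, hs0, hs⟩ := hQ t ht z hz.1
  have h1 : Tendsto (fun w : ℝ => (t, w)) (𝓝 z) (𝓝[I ×ˢ univ] (t, z)) :=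
    tendsto_nhdsWithin_iff.2 ⟨by
      have : Continuous fun w : ℝ => (t, w) := by fun_prop
      exact this.tendsto z, .of_forall fun w => ⟨ht, mem_univ _⟩⟩
  have h2 := h1.eventually hs
  obtain ⟨w, ⟨hw1, hw2⟩⟩ := (accPt_iff_frequently.1 hacc).and_eventually h2 |>.exists
  exact hw1.1 ((hw2.1 hw1.2.1).trans hs0)

/-- The finitely many points over `t₀` continue as branches `s z` that keep their order. The lowest
and highest branches are `f` and `g`, so all branches stay between these, and compactness excludes
further points. -/
theorem eventually_ncard_sliceBetween_eq (hQ : IsLocallyGraphOver I Q)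
    (hK : IsCompact {r : ℝ × ℝ | r.1 ∈ I ∧ r.2 ∈ sliceBetween Q f g r.1})
    (hf : ContinuousOn f I) (hg : ContinuousOn g I) (hfg : ∀ t ∈ I, f t ≤ g t)
    (hfQ : ∀ t ∈ I, (t, f t) ∈ Q) (hgQ : ∀ t ∈ I, (t, g t) ∈ Q) {t₀ : ℝ} (ht₀ : t₀ ∈ I) :
    ∀ᶠ t in 𝓝[I] t₀, (sliceBetween Q f g t).ncard = (sliceBetween Q f g t₀).ncard := by
  have hfin := finite_sliceBetween hQ hK ht₀
  set F := sliceBetween Q f g t₀ with hF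
  have hI : ∀ᶠ t in 𝓝[I] t₀, t ∈ I := self_mem_nhdsWithin
  have hlift : ∀ {u : ℝ → ℝ}, ContinuousWithinAt u I t₀ →
      Tendsto (fun t => (t, u t)) (𝓝[I] t₀) (𝓝[I ×ˢ univ] (t₀, u t₀)) := fun hu =>
    tendsto_nhdsWithin_iff.2 ⟨(continuousWithinAt_id.prodMk hu :
      ContinuousWithinAt (fun t => (t, _)) I t₀), hI.mono fun t ht => ⟨ht, mem_univ _⟩⟩
  have hch : ∀ z, ∃ s : ℝ → ℝ, z ∈ F → ContinuousWithinAt s I t₀ ∧ s t₀ = z ∧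
      ∀ᶠ r in 𝓝[I ×ˢ univ] (t₀, z), r ∈ Q ↔ r.2 = s r.1 := by
    intro z
    by_cases hz : z ∈ F
    · obtain ⟨s, hs⟩ := hQ t₀ ht₀ z hz.1
      exact ⟨s, fun _ => hs⟩
    · exact ⟨0, fun h => absurd h hz⟩
  choose s hs using hch
  have hfF : f t₀ ∈ F := ⟨hfQ t₀ ht₀, le_rfl, hfg t₀ ht₀⟩
  have hgF : g t₀ ∈ F := ⟨hgQ t₀ ht₀, hfg t₀ ht₀, le_rfl⟩
  have e1 : ∀ᶠ t in 𝓝[I] t₀, ∀ z ∈ F, (t, s z t) ∈ Q := by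
    rw [eventually_all_finite hfin]
    intro z hz
    obtain ⟨h1, h2, h3⟩ := hs z hz
    have := (hlift h1).eventually (h2.symm ▸ h3)
    exact this.mono fun t ht => ht.2 (by rw [h2])
  have e2 : ∀ {u : ℝ → ℝ}, ContinuousWithinAt u I t₀ → (∀ t ∈ I, (t, u t) ∈ Q) → u t₀ ∈ F →
      ∀ᶠ t in 𝓝[I] t₀, u t = s (u t₀) t := by
    intro u hu huQ huF
    filter_upwards [(hlift hu).eventually (hs _ huF).2.2, hI] with t ht htI
    exact ht.1 (huQ t htI)
  have e3 : ∀ᶠ t in 𝓝[I] t₀, ∀ z ∈ F, ∀ z' ∈ F, z < z' → s z t < s z' t := by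
    rw [eventually_all_finite hfin]
    intro z hz
    rw [eventually_all_finite hfin]
    intro z' hz'
    by_cases hzz : z < z'
    · have : ∀ᶠ t in 𝓝[I] t₀, s z t < s z' t :=
        (hs z hz).1.eventually_lt (hs z' hz').1 (by rwa [(hs z hz).2.1, (hs z' hz').2.1])
      exact this.mono fun t ht _ => ht
    · exact .of_forall fun t h => absurd h hzz
  -- The part of the compact region outside the neighbourhoods `O z` projects to a compact set of
  -- times that misses `t₀`, so no new points appear nearby.
  have e4 : ∀ᶠ t in 𝓝[I] t₀, ∀ w ∈ sliceBetween Q f g t, ∃ z ∈ F, w = s z t := by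
    have hO : ∀ z, ∃ O : Set (ℝ × ℝ), IsOpen O ∧ (z ∈ F → (t₀, z) ∈ O ∧
        ∀ r ∈ O, r.1 ∈ I → r ∈ Q → r.2 = s z r.1) := by
      intro z
      by_cases hz : z ∈ F
      · obtain ⟨O, hO1, hO2, hO3⟩ := eventually_nhds_iff.1 (eventually_nhdsWithin_iff.1 (hs z hz).2.2)
        exact ⟨O, hO2, fun _ => ⟨hO3, fun r hr hrI hrQ => (hO1 r hr ⟨hrI, mem_univ _⟩).1 hrQ⟩⟩
      · exact ⟨∅, isOpen_empty, fun h => absurd h hz⟩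
    choose O hOo hO using hO
    have hK' : IsCompact ({r : ℝ × ℝ | r.1 ∈ I ∧ r.2 ∈ sliceBetween Q f g r.1} \
        ⋃ z ∈ F, O z) := hK.diff (isOpen_biUnion fun z _ => hOo z)
    have hnot : t₀ ∉ Prod.fst '' ({r : ℝ × ℝ | r.1 ∈ I ∧ r.2 ∈ sliceBetween Q f g r.1} \
        ⋃ z ∈ F, O z) := by
      rintro ⟨⟨t, z⟩, ⟨⟨-, h1⟩, h2⟩, rfl⟩
      exact h2 (mem_biUnion h1 (hO z h1).1)
    filter_upwards [nhdsWithin_le_nhds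
      ((hK'.image continuous_fst).isClosed.isOpen_compl.mem_nhds hnot), hI] with t ht htI w hw
    by_contra hcon
    refine ht ⟨(t, w), ⟨⟨htI, hw⟩, ?_⟩, rfl⟩
    intro hmem
    obtain ⟨z, hz, hzO⟩ := mem_iUnion₂.1 hmem
    exact hcon ⟨z, hz, (hO z hz).2 _ hzO htI hw.1⟩
  filter_upwards [e1, e2 (hf t₀ ht₀) hfQ hfF, e2 (hg t₀ ht₀) hgQ hgF, e3, e4]
    with t h1 h2 h2' h3 h4
  have hmono : ∀ z ∈ F, ∀ z' ∈ F, z ≤ z' → s z t ≤ s z' t := by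
    intro z hz z' hz' h
    rcases h.eq_or_lt with rfl | h
    · exact le_rfl
    · exact (h3 z hz z' hz' h).le
  have himg : sliceBetween Q f g t = (fun z => s z t) '' F := by
    ext w
    constructor
    · intro hw
      obtain ⟨z, hz, rfl⟩ := h4 w hw
      exact ⟨z, hz, rfl⟩
    · rintro ⟨z, hz, rfl⟩
      refine ⟨h1 z hz, ?_, ?_⟩
      · rw [h2]; exact hmono _ hfF _ hz hz.2.1
      · rw [h2']; exact hmono _ hz _ hgF hz.2.2
  rw [himg]
  refine InjOn.ncard_image ?_
  intro z hz z' hz' h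
  rcases lt_trichotomy z z' with h' | h' | h'
  · exact absurd h (h3 z hz z' hz' h').ne
  · exact h'
  · exact absurd h (h3 z' hz' z hz h').ne'

theorem ncard_sliceBetween_eq (hI : IsPreconnected I) (hQ : IsLocallyGraphOver I Q)
    (hK : IsCompact {r : ℝ × ℝ | r.1 ∈ I ∧ r.2 ∈ sliceBetween Q f g r.1})
    (hf : ContinuousOn f I) (hg : ContinuousOn g I) (hfg : ∀ t ∈ I, f t ≤ g t)
    (hfQ : ∀ t ∈ I, (t, f t) ∈ Q) (hgQ : ∀ t ∈ I, (t, g t) ∈ Q) {a b : ℝ} (ha : a ∈ I)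
    (hb : b ∈ I) : (sliceBetween Q f g a).ncard = (sliceBetween Q f g b).ncard := by
  refine hI.constant (f := fun t => (sliceBetween Q f g t).ncard) ?_ ha hb
  intro t ht
  refine continuousWithinAt_const.congr_of_eventuallyEq
    (eventually_ncard_sliceBetween_eq hQ hK hf hg hfg hfQ hgQ ht) rfl

theorem signedCount_slice_eq (hI : IsPreconnected I) (hQ : IsLocallyGraphOver I Q)
    (hK : IsCompact {r : ℝ × ℝ | r.1 ∈ I ∧ r.2 ∈ sliceBetween Q f g r.1})
    (hf : ContinuousOn f I) (hg : ContinuousOn g I) (hfg : ∀ t ∈ I, f t ≤ g t)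
    (hfQ : ∀ t ∈ I, (t, f t) ∈ Q) (hgQ : ∀ t ∈ I, (t, g t) ∈ Q) {a b : ℝ} (ha : a ∈ I)
    (hb : b ∈ I) :
    signedCount {z | (a, z) ∈ Q} (f a) (g a) = signedCount {z | (b, z) ∈ Q} (f b) (g b) := by
  -- The slice contains both ends, whereas `signedCount` omits the right one; hence the `- 1`.
  have key : ∀ t ∈ I, signedCount {z | (t, z) ∈ Q} (f t) (g t) =
      ((sliceBetween Q f g t).ncard - 1 : ℕ) := by
    intro t ht
    rw [signedCount_of_le (hfg t ht), ← ncard_sdiff_singleton_of_mem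
      (show g t ∈ sliceBetween Q f g t from ⟨hgQ t ht, hfg t ht, le_rfl⟩)]
    congr 2
    ext z
    simp only [sliceBetween, mem_inter_iff, mem_ofPred_eq, mem_Ico, mem_Icc, Set.mem_sdiff,
      mem_singleton_iff]
    constructor
    · rintro ⟨h1, h2, h3⟩
      exact ⟨⟨h1, h2, h3.le⟩, h3.ne⟩
    · rintro ⟨⟨h1, h2, h3⟩, h4⟩
      exact ⟨h1, h2, lt_of_le_of_ne h3 h4⟩
  rw [key a ha, key b hb, ncard_sliceBetween_eq hI hQ hK hf hg hfg hfQ hgQ ha hb]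

end GraphFamily

/-! ### Normal frames and heights. -/

section NormalFrame

variable {Ω : Type*} [TopologicalSpace Ω] [ChartedSpace E3 Ω] [IsManifold (𝓡 3) ∞ Ω]
  [RiemannianBundle (fun x : Ω => TangentSpace (𝓡 3) x)]

/-- `ν` is a continuous nowhere vanishing normal vector field of `S` over `U`. -/
structure IsNormalFrame (S U : Set Ω) (ν : (x : Ω) → TangentSpace (𝓡 3) x) : Prop where
  continuousOn : ContinuousOn (fun x => (⟨x, ν x⟩ : TangentBundle (𝓡 3) Ω)) U
  mem_normalSet : ∀ x ∈ U, (⟨x, ν x⟩ : TangentBundle (𝓡 3) Ω) ∈ normalSet S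
  ne_zero : ∀ x ∈ U, ν x ≠ 0

/-- The multiple `z • ν x` of the normal vector `ν x`. -/
noncomputable def frameVec (ν : (x : Ω) → TangentSpace (𝓡 3) x) (x : Ω) (z : ℝ) : TangentBundle (𝓡 3) Ω :=
  ⟨x, z • ν x⟩

/-- The heights, in terms of the normal frame `ν`, of the points of `G` above `x`. -/
def fibreHeights (ν : (x : Ω) → TangentSpace (𝓡 3) x) (ε : ℝ) (G : Set Ω) (x : Ω) : Set ℝ :=
  {z | |z| * ‖ν x‖ < ε ∧ expMap (frameVec ν x z) ∈ G}

variable {S U G : Set Ω} {ν : (x : Ω) → TangentSpace (𝓡 3) x} {V : Set (TangentBundle (𝓡 3) Ω)}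
  {δ ε : ℝ}

omit [RiemannianBundle (fun x : Ω => TangentSpace (𝓡 3) x)] in
theorem continuousWithinAt_frameVec {X : Type*} [TopologicalSpace X] {s : Set X} {x₀ : X}
    (hν : ContinuousOn (fun x => (⟨x, ν x⟩ : TangentBundle (𝓡 3) Ω)) U)
    {c : X → Ω} {ζ : X → ℝ} (hc : ContinuousWithinAt c s x₀) (hcU : MapsTo c s U) (hx₀ : x₀ ∈ s)
    (hζ : ContinuousWithinAt ζ s x₀) :
    ContinuousWithinAt (fun x => frameVec ν (c x) (ζ x)) s x₀ := by
  have h1 : ContinuousWithinAt (fun x => (⟨c x, ν (c x)⟩ : TangentBundle (𝓡 3) Ω)) s x₀ :=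
    ContinuousWithinAt.comp (f := c) (hν _ (hcU hx₀)) hc hcU
  rw [FiberBundle.continuousWithinAt_totalSpace] at h1 ⊢
  refine ⟨hc, ?_⟩
  have h2 := hζ.smul h1.2
  set e := trivializationAt E3 (TangentSpace (𝓡 3) : Ω → Type _) (c x₀) with he
  have hev : ∀ᶠ x in 𝓝[s] x₀, c x ∈ e.baseSet :=
    hc.eventually (e.open_baseSet.mem_nhds (mem_baseSet_trivializationAt E3 _ (c x₀)))
  refine h2.congr_of_eventuallyEq ?_ ?_
  · filter_upwards [hev] with x hx
    exact (e.linear ℝ hx).map_smul _ _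
  · exact (e.linear ℝ (mem_baseSet_trivializationAt E3 _ (c x₀))).map_smul _ _

omit [IsManifold (𝓡 3) ∞ Ω] in
theorem smul_mem_normalSet {x : Ω} {v : TangentSpace (𝓡 3) x}
    (hv : (⟨x, v⟩ : TangentBundle (𝓡 3) Ω) ∈ normalSet S) (z : ℝ) :
    (⟨x, z • v⟩ : TangentBundle (𝓡 3) Ω) ∈ normalSet S := by
  refine ⟨hv.1, fun w hw => ?_⟩
  have h := hv.2 w hw
  exact (real_inner_smul_left _ _ _).trans (by rw [h, mul_zero])

namespace IsNormalFrame

theorem mono {U' : Set Ω} (hν : IsNormalFrame S U ν) (h : U' ⊆ U) : IsNormalFrame S U' ν :=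
  ⟨hν.continuousOn.mono h, fun x hx => hν.mem_normalSet x (h hx), fun x hx => hν.ne_zero x (h hx)⟩

theorem frameVec_mem_normalDisc (hν : IsNormalFrame S U ν) {x : Ω} (hx : x ∈ U) {z : ℝ}
    (hz : |z| * ‖ν x‖ < ε) : frameVec ν x z ∈ normalDisc S U ε := by
  refine ⟨smul_mem_normalSet (hν.mem_normalSet x hx) z, hx, ?_⟩
  change ‖z • ν x‖ < ε
  rwa [norm_smul, Real.norm_eq_abs]

theorem exists_eq_frameVec (hν : IsNormalFrame S U ν) (hS : IsEmbeddedSurface S)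
    {v : TangentBundle (𝓡 3) Ω} (hv : v ∈ normalDisc S U ε) :
    ∃ z : ℝ, |z| * ‖ν v.proj‖ < ε ∧ v = frameVec ν v.proj z := by
  obtain ⟨x, v⟩ := v
  obtain ⟨h1, h2, h3⟩ := hv
  have h := eq_smul_of_mem_normalSet hS (hν.mem_normalSet x h2) (hν.ne_zero x h2) h1
  refine ⟨inner ℝ v (ν x) / inner ℝ (ν x) (ν x), ?_, congrArg (TotalSpace.mk x) h⟩
  have h4 : ‖v‖ < ε := h3
  rwa [h, norm_smul, Real.norm_eq_abs] at h4

variable [IsContinuousRiemannianBundle E3 (fun x : Ω => TangentSpace (𝓡 3) x)]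

theorem continuousOn_norm (hν : IsNormalFrame S U ν) : ContinuousOn (fun x => ‖ν x‖) U := by
  have h := (hν.continuousOn.inner_bundle hν.continuousOn).sqrt
  refine h.congr fun x _ => ?_
  simp only
  rw [real_inner_self_eq_norm_sq, Real.sqrt_sq (norm_nonneg _)]

/-- The height in terms of the normal frame, as a continuous function on the tube. -/
theorem exists_height (hν : IsNormalFrame S U ν) (hV : IsRegularDomain S V)
    (hUV : normalDisc S U ε ⊆ V) :
    ∃ h : Ω → ℝ, ContinuousOn h (tube S U ε) ∧
      ∀ x ∈ U, ∀ z : ℝ, |z| * ‖ν x‖ < ε → h (expMap (frameVec ν x z)) = z := by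
  obtain ⟨-, -, -, ho, ψ, hψs, hψ⟩ := id hV
  have hψc : ContinuousOn (fun y => (⟨(ψ y).proj, (ψ y).2⟩ : TangentBundle (𝓡 3) Ω))
      (tube S U ε) := hψs.continuousOn.mono (image_mono hUV)
  have hproj : ContinuousOn (fun y => (ψ y).proj) (tube S U ε) :=
    (FiberBundle.continuous_proj E3 (TangentSpace (𝓡 3) : Ω → Type _)).comp_continuousOn
      (hψs.continuousOn.mono (image_mono hUV))
  have hmaps : MapsTo (fun y => (ψ y).proj) (tube S U ε) U := by
    rintro y ⟨v, hv, rfl⟩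
    simp only
    rw [hψ v (hUV hv)]
    exact hv.2.1
  have hνc : ContinuousOn (fun y => (⟨(ψ y).proj, ν (ψ y).proj⟩ : TangentBundle (𝓡 3) Ω))
      (tube S U ε) := hν.continuousOn.comp hproj hmaps
  refine ⟨fun y => inner ℝ (ψ y).2 (ν (ψ y).proj) / inner ℝ (ν (ψ y).proj) (ν (ψ y).proj),
    (hψc.inner_bundle hνc).div (hνc.inner_bundle hνc) ?_, ?_⟩
  · intro y hy
    exact inner_self_eq_zero.not.2 (hν.ne_zero _ (hmaps hy))
  · intro x hx z hz
    have h1 := hψ _ (hUV (hν.frameVec_mem_normalDisc hx hz))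
    have h2 : inner ℝ (ν x) (ν x) ≠ 0 := inner_self_eq_zero.not.2 (hν.ne_zero x hx)
    simp only
    rw [h1]
    change inner ℝ (z • ν x) (ν x) / inner ℝ (ν x) (ν x) = z
    rw [real_inner_smul_left]
    field_simp

end IsNormalFrame
end NormalFrame

/-! ### Connected graphs over a framed open set. -/

section FramedCover

variable {Ω : Type*} [TopologicalSpace Ω] [ChartedSpace E3 Ω] [IsManifold (𝓡 3) ∞ Ω]
  [RiemannianBundle (fun x : Ω => TangentSpace (𝓡 3) x)]

/-- `G` is a connected `δ`-graph over the open set `U`, over which `S` has the normal frame `ν`. -/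
structure IsFramedCover (S U : Set Ω) (δ ε : ℝ) (V : Set (TangentBundle (𝓡 3) Ω)) (G : Set Ω)
    (ν : (x : Ω) → TangentSpace (𝓡 3) x) : Prop where
  surface : IsEmbeddedSurface S
  isOpen : ∃ W : Set Ω, IsOpen W ∧ U = W ∩ S
  graph : IsDeltaGraphIn S U δ ε V G
  isPreconnected : IsPreconnected G
  frame : IsNormalFrame S U ν
  delta_pos : 0 < δ
  delta_lt_one : δ < 1
  eps_pos : 0 < ε

namespace IsFramedCover

variable {S U G : Set Ω} {ν : (x : Ω) → TangentSpace (𝓡 3) x} {V : Set (TangentBundle (𝓡 3) Ω)}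
  {δ ε : ℝ}

theorem subset_surface (H : IsFramedCover S U δ ε V G ν) : U ⊆ S := by
  obtain ⟨W, -, rfl⟩ := H.isOpen
  exact inter_subset_right

theorem subset_tube (H : IsFramedCover S U δ ε V G ν) : G ⊆ tube S U ε := by
  rcases H.graph.2.2.2.1 with h | h
  · exact h.1
  · exact h.1.trans sdiff_subset

theorem tube_subset (H : IsFramedCover S U δ ε V G ν) : tube S U ε ⊆ expMap '' V :=
  image_mono H.graph.2.1

theorem footMap_frameVec (H : IsFramedCover S U δ ε V G ν) {x : Ω} (hx : x ∈ U) {z : ℝ}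
    (hz : |z| * ‖ν x‖ < ε) : footMap V (expMap (frameVec ν x z)) = x :=
  H.graph.1.footMap_expMap (H.graph.2.1 (H.frame.frameVec_mem_normalDisc hx hz))

theorem exists_frameVec (H : IsFramedCover S U δ ε V G ν) {y : Ω} (hy : y ∈ tube S U ε) :
    footMap V y ∈ U ∧ ∃ z : ℝ, |z| * ‖ν (footMap V y)‖ < ε ∧
      y = expMap (frameVec ν (footMap V y) z) := by
  obtain ⟨v, hv, rfl⟩ := hy
  rw [H.graph.1.footMap_expMap (H.graph.2.1 hv)]
  obtain ⟨z, hz, hvz⟩ := H.frame.exists_eq_frameVec H.surface hv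
  exact ⟨hv.2.1, z, hz, congrArg expMap hvz⟩

theorem exists_section (H : IsFramedCover S U δ ε V G ν) {q : Ω} (hq : q ∈ G) :
    ∃ σ : Ω → Ω, ContMDiffAt (𝓡 3) (𝓡 3) ∞ σ (footMap V q) ∧
      (∀ᶠ y in 𝓝 q, y ∈ G → σ (footMap V y) = y) ∧
      ∀ᶠ x in 𝓝 (footMap V q), x ∈ S → σ x ∈ G ∧ footMap V (σ x) = x :=
  exists_local_section H.surface H.graph.1 H.graph.2.2.1 H.delta_pos H.delta_lt_one
    H.graph.2.2.2.2 hq (H.tube_subset (H.subset_tube hq))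

/-- Two continuous lifts to `G` of the same curve coincide if they meet. -/
theorem lift_unique [T2Space Ω] (H : IsFramedCover S U δ ε V G ν) {l m : ℝ → Ω} {I : Set ℝ}
    (hI : IsPreconnected I)
    (hl : ContinuousOn l I) (hm : ContinuousOn m I) (hlG : MapsTo l I G) (hmG : MapsTo m I G)
    (hlm : ∀ t ∈ I, footMap V (l t) = footMap V (m t)) {t₀ : ℝ} (ht₀ : t₀ ∈ I)
    (h0 : l t₀ = m t₀) : EqOn l m I := by
  classical
  -- Agreement is an open condition because of the local section of the foot point map, disagreement
  -- because the space is Hausdorff; so this indicator is locally constant.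
  have hc : ContinuousOn (fun t => if l t = m t then (0 : ℕ) else 1) I := by
    intro t ht
    have hI' : ∀ᶠ s in 𝓝[I] t, s ∈ I := self_mem_nhdsWithin
    refine continuousWithinAt_const.congr_of_eventuallyEq ?_ rfl
    by_cases h : l t = m t
    · obtain ⟨σ, -, hσ, -⟩ := H.exists_section (hlG ht)
      have h1 := (hl t ht).eventually hσ
      have h2 := (hm t ht).eventually (h ▸ hσ)
      filter_upwards [h1, h2, hI'] with s hs1 hs2 hsI
      have : l s = m s := by rw [← hs1 (hlG hsI), ← hs2 (hmG hsI), hlm s hsI]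
      rw [if_pos this, if_pos h]
    · have h1 : ∀ᶠ s in 𝓝[I] t, l s ≠ m s := 
        ((hl t ht).prodMk (hm t ht)).eventually (isClosed_diagonal.isOpen_compl.mem_nhds h)
      filter_upwards [h1] with s hs
      rw [if_neg hs, if_neg h]
  intro t ht
  have h := hI.constant hc ht ht₀
  simp only [h0, if_true] at h
  by_contra hne
  simp [hne] at h

variable [IsContMDiffRiemannianBundle (𝓡 3) ∞ E3 (fun x : Ω => TangentSpace (𝓡 3) x)]

/-- The part of the fibre between two points of `G` meets the closure of `G` only in `G`. -/
theorem mem_fibreHeights_of_mem_closure [T2Space Ω] (H : IsFramedCover S U δ ε V G ν) {x : Ω}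
    (hx : x ∈ U)
    {z₁ z₂ z : ℝ} (h₁ : z₁ ∈ fibreHeights ν ε G x) (h₂ : z₂ ∈ fibreHeights ν ε G x)
    (hz : z ∈ Icc z₁ z₂) (hcl : expMap (frameVec ν x z) ∈ closure G) :
    z ∈ fibreHeights ν ε G x := by
  have hzε : |z| * ‖ν x‖ < ε := by
    rcases le_max_iff.1 (abs_le_max_abs_abs hz.1 hz.2) with h | h
    · exact (mul_le_mul_of_nonneg_right h (norm_nonneg _)).trans_lt h₁.1
    · exact (mul_le_mul_of_nonneg_right h (norm_nonneg _)).trans_lt h₂.1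
  have htube : expMap (frameVec ν x z) ∈ tube S U ε :=
    mem_image_of_mem _ (H.frame.frameVec_mem_normalDisc hx hzε)
  refine ⟨hzε, ?_⟩
  rcases H.graph.2.2.2.1 with ⟨-, h⟩ | ⟨hGU, h⟩
  · exact h ⟨hcl, htube⟩
  -- Here `G` is closed only off `U`. Were the point on `U`, then `z` would be `0`. The heights of
  -- the connected set `G` form an interval containing `z₁` and `z₂`, so `G` would have a point of
  -- height `0`, that is, a point of `U`.
  refine h ⟨hcl, htube, fun hU => ?_⟩
  have hzero : ∀ {u : Ω}, u ∈ U → expMap (frameVec ν u 0) = u := by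
    intro u hu
    have h1 : frameVec ν u 0 ∈ expDomain := H.graph.1.2.1
      (H.graph.2.1 (H.frame.frameVec_mem_normalDisc hu (by simpa using H.eps_pos)))
    have h2 : frameVec ν u 0 = ⟨u, 0⟩ := congrArg (TotalSpace.mk u) (zero_smul ℝ (ν u))
    rw [h2] at h1 ⊢
    exact expMap_zero h1
  have hcont := isContinuousRiemannianBundle_tangentSpace (Ω := Ω)
  obtain ⟨h', hh', hhz⟩ := H.frame.exists_height H.graph.1 H.graph.2.1
  have hz0 : z = 0 := by
    rw [← hhz x hx z hzε, ← hzero hU, hhz _ hU 0 (by simpa using H.eps_pos)]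
  have hpre := (H.isPreconnected.image h' (hh'.mono H.subset_tube)).ordConnected
  obtain ⟨y, hyG, hy0⟩ := hpre.out ⟨_, h₁.2, hhz x hx z₁ h₁.1⟩ ⟨_, h₂.2, hhz x hx z₂ h₂.1⟩ hz
  obtain ⟨hyU, w, hw, hyw⟩ := H.exists_frameVec (H.subset_tube hyG)
  have hw0 : w = 0 := by
    rw [hyw, hhz _ hyU w hw] at hy0
    rw [hy0, hz0]
  rw [hw0, hzero hyU] at hyw
  exact (hGU hyG).2 (hyw ▸ hyU)

theorem continuousWithinAt_expMap_frameVec {X : Type*} [TopologicalSpace X] {s : Set X} {x₀ : X}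
    (H : IsFramedCover S U δ ε V G ν) {c : X → Ω} {ζ : X → ℝ} (hc : ContinuousWithinAt c s x₀)
    (hcU : MapsTo c s U) (hx₀ : x₀ ∈ s) (hζ : ContinuousWithinAt ζ s x₀)
    (hε : |ζ x₀| * ‖ν (c x₀)‖ < ε) :
    ContinuousWithinAt (fun x => expMap (frameVec ν (c x) (ζ x))) s x₀ := by
  have hcont := isContinuousRiemannianBundle_tangentSpace (Ω := Ω)
  have h1 := continuousWithinAt_frameVec H.frame.continuousOn hc hcU hx₀ hζ
  have h2 : ContinuousWithinAt (fun x => |ζ x| * ‖ν (c x)‖) s x₀ :=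
    hζ.abs.mul (ContinuousWithinAt.comp (f := c) (H.frame.continuousOn_norm _ (hcU hx₀)) hc hcU)
  have h3 : ∀ᶠ x in 𝓝[s] x₀, frameVec ν (c x) (ζ x) ∈ V := by
    filter_upwards [h2.eventually (gt_mem_nhds hε), self_mem_nhdsWithin] with x hx hxs
    exact H.graph.2.1 (H.frame.frameVec_mem_normalDisc (hcU hxs) hx)
  have h4 : frameVec ν (c x₀) (ζ x₀) ∈ V :=
    H.graph.2.1 (H.frame.frameVec_mem_normalDisc (hcU hx₀) hε)
  exact Tendsto.comp (H.graph.1.2.2.1.continuousOn _ h4) (tendsto_nhdsWithin_iff.2 ⟨h1, h3⟩)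

/-- Above a curve, `G` is locally the graph of a continuous height function. -/
theorem isLocallyGraphOver (H : IsFramedCover S U δ ε V G ν) {c : ℝ → Ω} {I : Set ℝ}
    (hc : ContinuousOn c I) (hcU : MapsTo c I U) :
    IsLocallyGraphOver I {r : ℝ × ℝ | r.2 ∈ fibreHeights ν ε G (c r.1)} := by
  intro t₀ ht₀ z₀ hz₀
  have hcont := isContinuousRiemannianBundle_tangentSpace (Ω := Ω)
  obtain ⟨h, hh, hhz⟩ := H.frame.exists_height H.graph.1 H.graph.2.1
  have hc₀ := hcU ht₀
  have hz₀' : z₀ ∈ fibreHeights ν ε G (c t₀) := hz₀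
  set q := expMap (frameVec ν (c t₀) z₀) with hq
  have hqfoot : footMap V q = c t₀ := H.footMap_frameVec hc₀ hz₀'.1
  obtain ⟨σ, hσs, hσ1, hσ2⟩ := H.exists_section hz₀'.2
  rw [← hq] at hσ1 hσ2 hσs
  have hσq : σ (c t₀) = q := by rw [← hqfoot]; exact hσ1.self_of_nhds hz₀'.2
  rw [hqfoot] at hσs hσ2
  have hI : ∀ᶠ t in 𝓝[I] t₀, t ∈ I := self_mem_nhdsWithin
  have hσc : ContinuousWithinAt (fun t => σ (c t)) I t₀ :=
    hσs.continuousAt.comp_continuousWithinAt (hc t₀ ht₀)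
  have hσG : ∀ᶠ t in 𝓝[I] t₀, σ (c t) ∈ G ∧ footMap V (σ (c t)) = c t := by
    filter_upwards [(hc t₀ ht₀).eventually hσ2, hI] with t ht htI
    exact ht (H.subset_surface (hcU htI))
  -- The branch through `q` is the height of the local section `σ` along `c`.
  refine ⟨fun t => h (σ (c t)), ?_, ?_, ?_⟩
  · have h1 : σ (c t₀) ∈ tube S U ε := by rw [hσq]; exact H.subset_tube hz₀'.2
    exact Tendsto.comp (hh _ h1)
      (tendsto_nhdsWithin_iff.2 ⟨hσc, hσG.mono fun t ht => H.subset_tube ht.1⟩)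
  · simp only
    rw [hσq, hq, hhz _ hc₀ z₀ hz₀'.1]
  · have hfst : Tendsto (Prod.fst : ℝ × ℝ → ℝ) (𝓝[I ×ˢ univ] (t₀, z₀)) (𝓝[I] t₀) :=
      tendsto_nhdsWithin_iff.2 ⟨(continuous_fst.tendsto _).mono_left nhdsWithin_le_nhds, by
        filter_upwards [self_mem_nhdsWithin] with r hr using hr.1⟩
    have hE : Tendsto (fun r : ℝ × ℝ => expMap (frameVec ν (c r.1) r.2)) (𝓝[I ×ˢ univ] (t₀, z₀))
        (𝓝 q) :=
      H.continuousWithinAt_expMap_frameVec (c := fun r : ℝ × ℝ => c r.1) (ζ := Prod.snd)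
        ((hc t₀ ht₀).tendsto.comp hfst) (fun r hr => hcU hr.1) ⟨ht₀, mem_univ _⟩
        continuousWithinAt_snd hz₀'.1
    filter_upwards [hE.eventually hσ1, hfst.eventually hσG, hfst.eventually hI] with r h1 h2 h3
    constructor
    · intro hr
      have hr' : r.2 ∈ fibreHeights ν ε G (c r.1) := hr
      have h4 := h1 hr'.2
      rw [H.footMap_frameVec (hcU h3) hr'.1] at h4
      rw [h4, hhz _ (hcU h3) _ hr'.1]
    · intro hr
      obtain ⟨-, w, hw, hyw⟩ := H.exists_frameVec (H.subset_tube h2.1)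
      rw [h2.2] at hw hyw
      have hrw : r.2 = w := by rw [hr, hyw, hhz _ (hcU h3) _ hw]
      change r.2 ∈ fibreHeights ν ε G (c r.1)
      rw [hrw]
      exact ⟨hw, hyw ▸ h2.1⟩

/-- The full strip between `f` and `g` is compact, and inside it the region is the preimage of
`closure G`, because `mem_fibreHeights_of_mem_closure` shows that the closure adds nothing there. -/
theorem isCompact_between [T2Space Ω] (H : IsFramedCover S U δ ε V G ν) {c : ℝ → Ω} {I : Set ℝ}
    (hI : IsCompact I) (hc : ContinuousOn c I) (hcU : MapsTo c I U) {f g : ℝ → ℝ}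
    (hf : ContinuousOn f I) (hg : ContinuousOn g I)
    (hfG : ∀ t ∈ I, f t ∈ fibreHeights ν ε G (c t))
    (hgG : ∀ t ∈ I, g t ∈ fibreHeights ν ε G (c t)) :
    IsCompact {r : ℝ × ℝ | r.1 ∈ I ∧
      r.2 ∈ sliceBetween {r : ℝ × ℝ | r.2 ∈ fibreHeights ν ε G (c r.1)} f g r.1} := by
  set strip : Set (ℝ × ℝ) := {r | r.1 ∈ I ∧ r.2 ∈ Icc (f r.1) (g r.1)} with hstrip
  have hsc : IsCompact strip := by
    have h1 : strip ⊆ (fun r : ℝ × ℝ => (r.1, f r.1 + r.2 * (g r.1 - f r.1))) ''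
        (I ×ˢ Icc (0 : ℝ) 1) := by
      rintro ⟨t, z⟩ ⟨ht, h1, h2⟩
      simp only at h1 h2
      rcases (h1.trans h2).eq_or_lt with h | h
      · exact ⟨(t, 0), ⟨ht, by simp⟩, Prod.ext rfl (by simp; linarith)⟩
      · have hd : 0 < g t - f t := by linarith
        refine ⟨(t, (z - f t) / (g t - f t)), ⟨ht, ?_, ?_⟩, Prod.ext rfl ?_⟩
        · exact div_nonneg (by linarith) hd.le
        · exact (div_le_one hd).2 (by linarith)
        · simp only
          field_simp
          ring
    have hI' : IsCompact (I ×ˢ Icc (0 : ℝ) 1) := hI.prod isCompact_Icc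
    have hf' : ContinuousOn (fun r : ℝ × ℝ => f r.1) (I ×ˢ Icc (0 : ℝ) 1) :=
      hf.comp continuousOn_fst fun r hr => hr.1
    have hg' : ContinuousOn (fun r : ℝ × ℝ => g r.1) (I ×ˢ Icc (0 : ℝ) 1) :=
      hg.comp continuousOn_fst fun r hr => hr.1
    have h2 := hI'.image_of_continuousOn (f := fun r : ℝ × ℝ => (r.1, f r.1 + r.2 * (g r.1 - f r.1)))
      (continuousOn_fst.prodMk (hf'.add (continuousOn_snd.mul (hg'.sub hf'))))
    refine h2.of_isClosed_subset ?_ h1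
    have hIu : IsClosed (I ×ˢ (univ : Set ℝ)) := hI.isClosed.prod isClosed_univ
    have hf2 : ContinuousOn (fun r : ℝ × ℝ => f r.1) (I ×ˢ univ) :=
      hf.comp continuousOn_fst fun r hr => hr.1
    have hg2 : ContinuousOn (fun r : ℝ × ℝ => g r.1) (I ×ˢ univ) :=
      hg.comp continuousOn_fst fun r hr => hr.1
    have h3 := ((continuousOn_snd.sub hf2).preimage_isClosed_of_isClosed hIu isClosed_Ici
      (t := Ici 0)).inter ((hg2.sub continuousOn_snd).preimage_isClosed_of_isClosed hIu isClosed_Ici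
      (t := Ici 0))
    convert h3 using 1
    ext r
    simp [hstrip]
    tauto
  have hbound : ∀ r ∈ strip, |r.2| * ‖ν (c r.1)‖ < ε := by
    rintro ⟨t, z⟩ ⟨ht, h1, h2⟩
    rcases le_max_iff.1 (abs_le_max_abs_abs h1 h2) with h | h
    · exact (mul_le_mul_of_nonneg_right h (norm_nonneg _)).trans_lt (hfG t ht).1
    · exact (mul_le_mul_of_nonneg_right h (norm_nonneg _)).trans_lt (hgG t ht).1
  have hE : ContinuousOn (fun r : ℝ × ℝ => expMap (frameVec ν (c r.1) r.2)) strip := by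
    intro r hr
    exact H.continuousWithinAt_expMap_frameVec (c := fun r : ℝ × ℝ => c r.1) (ζ := Prod.snd)
      (ContinuousWithinAt.comp (f := Prod.fst) (hc _ hr.1) continuousWithinAt_fst
        fun r hr => hr.1) (fun r hr => hcU hr.1) hr continuousWithinAt_snd (hbound r hr)
  refine hsc.of_isClosed_subset (?_ : IsClosed _) fun r hr => ⟨hr.1, hr.2.2⟩
  convert hE.preimage_isClosed_of_isClosed hsc.isClosed (isClosed_closure (s := G)) using 1
  ext r
  constructor
  · intro hr
    exact ⟨⟨hr.1, hr.2.2⟩, subset_closure hr.2.1.2⟩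
  · intro hr
    exact ⟨hr.1.1, H.mem_fibreHeights_of_mem_closure (hcU hr.1.1) (hfG _ hr.1.1) (hgG _ hr.1.1)
      hr.1.2 hr.2, hr.1.2⟩

/-- This is the case of a constant curve over a single time. -/
theorem finite_fibreHeights_inter [T2Space Ω] (H : IsFramedCover S U δ ε V G ν) {x : Ω}
    (hx : x ∈ U) {a b : ℝ} (ha : a ∈ fibreHeights ν ε G x) (hb : b ∈ fibreHeights ν ε G x) :
    (fibreHeights ν ε G x ∩ Icc a b).Finite :=
  finite_sliceBetween (I := {0}) (f := fun _ => a) (g := fun _ => b)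
    (H.isLocallyGraphOver (c := fun _ => x) continuousOn_const fun _ _ => hx)
    (H.isCompact_between isCompact_singleton continuousOn_const (fun _ _ => hx) continuousOn_const
      continuousOn_const (fun _ _ => ha) (fun _ _ => hb)) (mem_singleton 0)

/-- The number of sheets of `G` between two lifts of a curve is the same at both ends. -/
theorem exists_height_signedCount_eq [T2Space Ω] (H : IsFramedCover S U δ ε V G ν) :
    ∃ h : Ω → ℝ, (∀ y ∈ G, h y ∈ fibreHeights ν ε G (footMap V y)) ∧
      (∀ y ∈ G, ∀ y' ∈ G, footMap V y = footMap V y' → h y = h y' → y = y') ∧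
      ∀ l m : ℝ → Ω, ContinuousOn l (Icc 0 1) → ContinuousOn m (Icc 0 1) →
        MapsTo l (Icc 0 1) G → MapsTo m (Icc 0 1) G →
        (∀ t ∈ Icc (0 : ℝ) 1, footMap V (l t) = footMap V (m t)) →
        signedCount (fibreHeights ν ε G (footMap V (l 0))) (h (l 0)) (h (m 0)) =
          signedCount (fibreHeights ν ε G (footMap V (l 1))) (h (l 1)) (h (m 1)) := by
  have hcont := isContinuousRiemannianBundle_tangentSpace (Ω := Ω)
  obtain ⟨h, hh, hhz⟩ := H.frame.exists_height H.graph.1 H.graph.2.1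
  have hGh : ∀ y ∈ G, footMap V y ∈ U ∧ h y ∈ fibreHeights ν ε G (footMap V y) ∧
      expMap (frameVec ν (footMap V y) (h y)) = y := by
    intro y hy
    obtain ⟨hyU, w, hw, hyw⟩ := H.exists_frameVec (H.subset_tube hy)
    have : h y = w := by
      conv_lhs => rw [hyw]
      exact hhz _ hyU w hw
    rw [this]
    exact ⟨hyU, ⟨hw, hyw ▸ hy⟩, hyw.symm⟩
  refine ⟨h, fun y hy => (hGh y hy).2.1, fun y hy y' hy' h1 h2 => ?_, ?_⟩
  · rw [← (hGh y hy).2.2, ← (hGh y' hy').2.2, h1, h2]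
  intro l m hl hm hlG hmG hlm
  have h0I : (0 : ℝ) ∈ Icc (0 : ℝ) 1 := ⟨le_rfl, zero_le_one⟩
  have h1I : (1 : ℝ) ∈ Icc (0 : ℝ) 1 := ⟨zero_le_one, le_rfl⟩
  have hfoot : ∀ {l : ℝ → Ω}, ContinuousOn l (Icc 0 1) → MapsTo l (Icc 0 1) G →
      ContinuousOn (fun t => footMap V (l t)) (Icc 0 1) := fun hl hlG t ht =>
    ((H.graph.1.contMDiffAt_footMap (H.tube_subset (H.subset_tube (hlG ht)))).continuousAt
      ).comp_continuousWithinAt (hl t ht)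
  have hcont' : ∀ {l : ℝ → Ω}, ContinuousOn l (Icc 0 1) → MapsTo l (Icc 0 1) G →
      ContinuousOn (fun t => h (l t)) (Icc 0 1) := fun hl hlG =>
    hh.comp hl fun t ht => H.subset_tube (hlG ht)
  have key : ∀ {l m : ℝ → Ω}, ContinuousOn l (Icc 0 1) → ContinuousOn m (Icc 0 1) →
      MapsTo l (Icc 0 1) G → MapsTo m (Icc 0 1) G →
      (∀ t ∈ Icc (0 : ℝ) 1, footMap V (l t) = footMap V (m t)) →
      (∀ t ∈ Icc (0 : ℝ) 1, h (l t) ≤ h (m t)) →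
      signedCount (fibreHeights ν ε G (footMap V (l 0))) (h (l 0)) (h (m 0)) =
        signedCount (fibreHeights ν ε G (footMap V (l 1))) (h (l 1)) (h (m 1)) := by
    intro l m hl hm hlG hmG hlm hle
    have hlf : ∀ t ∈ Icc (0 : ℝ) 1, h (l t) ∈ fibreHeights ν ε G (footMap V (l t)) :=
      fun t ht => (hGh _ (hlG ht)).2.1
    have hmf : ∀ t ∈ Icc (0 : ℝ) 1, h (m t) ∈ fibreHeights ν ε G (footMap V (l t)) :=
      fun t ht => hlm t ht ▸ (hGh _ (hmG ht)).2.1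
    have hU : MapsTo (fun t => footMap V (l t)) (Icc 0 1) U := fun t ht => (hGh _ (hlG ht)).1
    exact signedCount_slice_eq isPreconnected_Icc (H.isLocallyGraphOver (hfoot hl hlG) hU)
      (H.isCompact_between isCompact_Icc (hfoot hl hlG) hU (hcont' hl hlG) (hcont' hm hmG) hlf hmf)
      (hcont' hl hlG) (hcont' hm hmG) hle hlf hmf h0I h1I
  -- Lifts that meet agree throughout. If they never meet, the intermediate value theorem keeps one
  -- above the other, so up to a swap the ordered case `key` suffices.
  by_cases hmeet : ∃ t ∈ Icc (0 : ℝ) 1, h (l t) = h (m t)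
  · obtain ⟨t, ht, htm⟩ := hmeet
    have hlm' : l t = m t := by
      rw [← (hGh _ (hlG ht)).2.2, ← (hGh _ (hmG ht)).2.2, hlm t ht, htm]
    have heq := H.lift_unique isPreconnected_Icc hl hm hlG hmG hlm ht hlm'
    exact key hl hm hlG hmG hlm fun t ht => (congrArg h (heq ht)).le
  · push Not at hmeet
    by_cases hall : ∀ t ∈ Icc (0 : ℝ) 1, h (l t) ≤ h (m t)
    · exact key hl hm hlG hmG hlm hall
    · push Not at hall
      obtain ⟨t, ht, hlt⟩ := hall
      have hge : ∀ t ∈ Icc (0 : ℝ) 1, h (m t) ≤ h (l t) := by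
        intro t' ht'
        by_contra hcon
        obtain ⟨u, hu, hu'⟩ := isPreconnected_Icc.intermediate_value₂ ht' ht (hcont' hl hlG)
          (hcont' hm hmG) (not_le.1 hcon).le hlt.le
        exact hmeet u hu hu'
      rw [signedCount_swap, signedCount_swap (h (l 1)), hlm 0 h0I, hlm 1 h1I,
        key hm hl hmG hlG (fun t ht => (hlm t ht).symm) hge]

end IsFramedCover
end FramedCover

/-! ### Concatenation, reversal and piecewise smoothness. -/

section Curves

variable {Ω : Type*}

theorem one_sub_mem_Icc {t : ℝ} (ht : t ∈ Icc (0 : ℝ) 1) : 1 - t ∈ Icc (0 : ℝ) 1 :=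
  ⟨by linarith [ht.2], by linarith [ht.1]⟩

theorem zero_mem_Icc : (0 : ℝ) ∈ Icc (0 : ℝ) 1 := ⟨le_rfl, zero_le_one⟩

theorem one_mem_Icc : (1 : ℝ) ∈ Icc (0 : ℝ) 1 := ⟨zero_le_one, le_rfl⟩

theorem concatCurve_of_le (c d : ℝ → Ω) {t : ℝ} (ht : t ≤ 1 / 2) :
    concatCurve c d t = c (2 * t) := if_pos ht

theorem concatCurve_of_ge {c d : ℝ → Ω} (hcd : c 1 = d 0) {t : ℝ} (ht : 1 / 2 ≤ t) :
    concatCurve c d t = d (2 * t - 1) := by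
  rcases ht.eq_or_lt with rfl | ht
  · rw [concatCurve, if_pos le_rfl]
    norm_num [hcd]
  · rw [concatCurve, if_neg (not_le.2 ht)]

theorem concatCurve_zero (c d : ℝ → Ω) : concatCurve c d 0 = c 0 := by
  rw [concatCurve_of_le c d (by norm_num)]; norm_num

theorem concatCurve_one (c d : ℝ → Ω) : concatCurve c d 1 = d 1 := by
  rw [concatCurve, if_neg (by norm_num)]; norm_num

theorem exists_concatCurve_eq {t : ℝ} (ht : t ∈ Icc (0 : ℝ) 1) :
    (t ≤ 1 / 2 ∧ 2 * t ∈ Icc (0 : ℝ) 1 ∧ ∀ c d : ℝ → Ω, concatCurve c d t = c (2 * t)) ∨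
      (1 / 2 < t ∧ 2 * t - 1 ∈ Icc (0 : ℝ) 1 ∧ ∀ c d : ℝ → Ω,
        concatCurve c d t = d (2 * t - 1)) := by
  rcases le_or_gt t (1 / 2) with h | h
  · exact .inl ⟨h, ⟨by linarith [ht.1], by linarith⟩, fun c d => if_pos h⟩
  · exact .inr ⟨h, ⟨by linarith, by linarith [ht.2]⟩, fun c d => if_neg (not_le.2 h)⟩

theorem mapsTo_concatCurve {c d : ℝ → Ω} {A : Set Ω} (hc : MapsTo c (Icc 0 1) A)
    (hd : MapsTo d (Icc 0 1) A) : MapsTo (concatCurve c d) (Icc 0 1) A := by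
  intro t ht
  rcases exists_concatCurve_eq ht with ⟨-, h1, h2⟩ | ⟨-, h1, h2⟩
  · rw [h2]; exact hc h1
  · rw [h2]; exact hd h1

theorem mapsTo_revCurve {c : ℝ → Ω} {A : Set Ω} (hc : MapsTo c (Icc 0 1) A) :
    MapsTo (revCurve c) (Icc 0 1) A := fun _ ht => hc (one_sub_mem_Icc ht)

theorem continuousOn_concatCurve [TopologicalSpace Ω] {c d : ℝ → Ω} (hc : ContinuousOn c (Icc 0 1))
    (hd : ContinuousOn d (Icc 0 1)) (hcd : c 1 = d 0) :
    ContinuousOn (concatCurve c d) (Icc 0 1) := by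
  have h1 : ContinuousOn (concatCurve c d) (Icc 0 (1 / 2)) := by
    refine (hc.comp (f := fun t : ℝ => 2 * t) (by fun_prop) fun t ht =>
      ⟨by linarith [ht.1], by linarith [ht.2]⟩).congr fun t ht => concatCurve_of_le c d ht.2
  have h2 : ContinuousOn (concatCurve c d) (Icc (1 / 2) 1) := by
    refine (hd.comp (f := fun t : ℝ => 2 * t - 1) (by fun_prop) fun t ht =>
      ⟨by linarith [ht.1], by linarith [ht.2]⟩).congr fun t ht => concatCurve_of_ge hcd ht.1
  have h3 := h1.union_of_isClosed h2 isClosed_Icc isClosed_Icc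
  rwa [Icc_union_Icc_eq_Icc (by norm_num) (by norm_num)] at h3

theorem continuousOn_revCurve [TopologicalSpace Ω] {c : ℝ → Ω} (hc : ContinuousOn c (Icc 0 1)) :
    ContinuousOn (revCurve c) (Icc 0 1) :=
  hc.comp (f := fun t : ℝ => 1 - t) (by fun_prop) fun _ ht => one_sub_mem_Icc ht

variable [TopologicalSpace Ω] [ChartedSpace E3 Ω]

/-- The curve `c : [0,1] → Ω` is piecewise smooth. -/
def IsPiecewiseSmooth (c : ℝ → Ω) : Prop :=
  ∃ (k : ℕ) (s : ℕ → ℝ), s 0 = 0 ∧ s k = 1 ∧ ∀ i < k, s i < s (i + 1) ∧ 0 ≤ s i ∧ s (i + 1) ≤ 1 ∧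
    ContMDiffOn 𝓘(ℝ, ℝ) (𝓡 3) ∞ c (Icc (s i) (s (i + 1)))

theorem IsPiecewiseSmooth.of_contMDiffOn {c : ℝ → Ω}
    (hc : ContMDiffOn 𝓘(ℝ, ℝ) (𝓡 3) ∞ c (Icc 0 1)) : IsPiecewiseSmooth c := by
  refine ⟨1, fun i => i, by simp, by simp, fun i hi => ?_⟩
  obtain rfl : i = 0 := by omega
  simpa using hc

theorem contMDiffOn_revCurve {c : ℝ → Ω} (hc : ContMDiffOn 𝓘(ℝ, ℝ) (𝓡 3) ∞ c (Icc 0 1)) :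
    ContMDiffOn 𝓘(ℝ, ℝ) (𝓡 3) ∞ (revCurve c) (Icc 0 1) := by
  have h : ContMDiff 𝓘(ℝ, ℝ) 𝓘(ℝ, ℝ) ∞ (fun t : ℝ => 1 - t) :=
    contMDiff_iff_contDiff.2 (by fun_prop)
  exact hc.comp h.contMDiffOn fun t ht => one_sub_mem_Icc ht

theorem IsPiecewiseSmooth.concatCurve {c d : ℝ → Ω} (hc : IsPiecewiseSmooth c)
    (hd : IsPiecewiseSmooth d) (hcd : c 1 = d 0) : IsPiecewiseSmooth (concatCurve c d) := by
  obtain ⟨k, s, hs0, hs1, hs⟩ := hc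
  obtain ⟨k', s', hs0', hs1', hs'⟩ := hd
  -- The two partitions share the breakpoint of index `k`: `s k / 2 = (1 + s' 0) / 2 = 1 / 2`. This
  -- makes the formula for the second half valid at `j = 0` too.
  refine ⟨k + k', fun i => if i ≤ k then s i / 2 else (1 + s' (i - k)) / 2, ?_, ?_, ?_⟩
  · simp [hs0]
  · rcases Nat.eq_zero_or_pos k' with rfl | h
    · rw [hs0'] at hs1'; norm_num at hs1'
    · simp [hs1', show ¬ k' = 0 by omega]
  · intro i hi
    by_cases hik : i < k
    · obtain ⟨h1, h2, h3, h4⟩ := hs i hik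
      simp only [hik.le, if_true, show i + 1 ≤ k from hik]
      refine ⟨by linarith, by linarith, by linarith, ?_⟩
      have h : ContMDiff 𝓘(ℝ, ℝ) 𝓘(ℝ, ℝ) ∞ (fun t : ℝ => 2 * t) :=
        contMDiff_iff_contDiff.2 (by fun_prop)
      refine (h4.comp (h.contMDiffOn (s := Icc (s i / 2) (s (i + 1) / 2))) fun t ht =>
        ⟨by linarith [ht.1], by linarith [ht.2]⟩).congr fun t ht => ?_
      exact concatCurve_of_le c d (by linarith [ht.2])
    · obtain ⟨j, rfl⟩ := Nat.exists_eq_add_of_le (not_lt.1 hik)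
      obtain ⟨h1, h2, h3, h4⟩ := hs' j (by omega)
      have e1 : (if k + j ≤ k then s (k + j) / 2 else (1 + s' (k + j - k)) / 2) =
          (1 + s' j) / 2 := by
        rcases Nat.eq_zero_or_pos j with rfl | h
        · simp [hs1, hs0']
        · simp [show ¬ j = 0 by omega]
      have e2 : (if k + j + 1 ≤ k then s (k + j + 1) / 2 else (1 + s' (k + j + 1 - k)) / 2) =
          (1 + s' (j + 1)) / 2 := by
        rw [if_neg (by omega), show k + j + 1 - k = j + 1 by omega]
      simp only [e1, e2]
      refine ⟨by linarith, by linarith, by linarith, ?_⟩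
      have h : ContMDiff 𝓘(ℝ, ℝ) 𝓘(ℝ, ℝ) ∞ (fun t : ℝ => 2 * t - 1) :=
        contMDiff_iff_contDiff.2 (by fun_prop)
      refine (h4.comp (h.contMDiffOn (s := Icc ((1 + s' j) / 2) ((1 + s' (j + 1)) / 2)))
        fun t ht => ⟨by linarith [ht.1], by linarith [ht.2]⟩).congr fun t ht => ?_
      exact concatCurve_of_ge hcd (by linarith [ht.1])

omit [ChartedSpace E3 Ω] in
theorem continuousOn_of_pieces {l : ℝ → Ω} {k : ℕ} {s : ℕ → ℝ} (h0 : s 0 = 0) (h1 : s k = 1)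
    (h : ∀ i < k, s i < s (i + 1) ∧ ContinuousOn l (Icc (s i) (s (i + 1)))) :
    ContinuousOn l (Icc 0 1) := by
  have key : ∀ j ≤ k, 0 ≤ s j ∧ ContinuousOn l (Icc 0 (s j)) := by
    intro j
    induction j with
    | zero => intro _; simp [h0]
    | succ j ih =>
      intro hj
      obtain ⟨h2, h3⟩ := ih (by omega)
      obtain ⟨h4, h5⟩ := h j (by omega)
      refine ⟨h2.trans h4.le, ?_⟩
      have h6 := h3.union_of_isClosed h5 isClosed_Icc isClosed_Icc
      rwa [Icc_union_Icc_eq_Icc h2 h4.le] at h6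
  exact h1 ▸ (key k le_rfl).2

end Curves

/-! ### Continuous lifts inside one component of the disk. -/

section LiftSetting

variable {Ω : Type*} [TopologicalSpace Ω] [ChartedSpace E3 Ω] [IsManifold (𝓡 3) ∞ Ω]
  [RiemannianBundle (fun x : Ω => TangentSpace (𝓡 3) x)]

/-- `G` is the component of `D ∩ tube S U ε` formed by the lifts of a generalised simple `δ`-lift,
framed by `ν`, and `V₀` is a regular domain containing the `δ`-neighbourhood of `U`. -/
structure LiftSetting (S U : Set Ω) (δ ε : ℝ) (D : Set Ω) (ε' : ℝ)
    (V : Set (TangentBundle (𝓡 3) Ω)) (G : Set Ω) (ν : (x : Ω) → TangentSpace (𝓡 3) x)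
    (V₀ : Set (TangentBundle (𝓡 3) Ω)) : Prop where
  framed : IsFramedCover S U δ ε' V G ν
  precompact : IsPrecompactOpenIn S U
  eps_pos : 0 < ε
  disk : IsEmbeddedDisk D
  graph : IsDeltaGraph S U δ (D ∩ tube S U ε)
  cover : IsDeltaCover S U δ G
  component : ∃ x, G = connectedComponentIn (D ∩ tube S U ε) x
  regular : IsRegularDomain S V₀
  subset_regular : normalDisc S U δ ⊆ V₀

/-- `l` is a continuous lift of `c` to `G` within the `δ`-neighbourhood of `c`. -/
structure IsContLift (S G : Set Ω) (δ : ℝ) (c l : ℝ → Ω) : Prop where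
  continuousOn : ContinuousOn l (Icc 0 1)
  mapsTo : MapsTo l (Icc 0 1) G
  mem_tube : ∀ t ∈ Icc (0 : ℝ) 1, l t ∈ tube S {c t} δ

variable {S U D G : Set Ω} {δ ε ε' : ℝ} {V V₀ : Set (TangentBundle (𝓡 3) Ω)}
  {ν : (x : Ω) → TangentSpace (𝓡 3) x} {c d l m : ℝ → Ω}

omit [IsManifold (𝓡 3) ∞ Ω] in
theorem IsContLift.concatCurve (hl : IsContLift S G δ c l) (hm : IsContLift S G δ d m)
    (h : l 1 = m 0) : IsContLift S G δ (concatCurve c d) (concatCurve l m) := by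
  refine ⟨continuousOn_concatCurve hl.continuousOn hm.continuousOn h,
    mapsTo_concatCurve hl.mapsTo hm.mapsTo, fun t ht => ?_⟩
  rcases exists_concatCurve_eq ht with ⟨-, h1, h2⟩ | ⟨-, h1, h2⟩
  · rw [h2, h2]; exact hl.mem_tube _ h1
  · rw [h2, h2]; exact hm.mem_tube _ h1

omit [IsManifold (𝓡 3) ∞ Ω] in
theorem IsContLift.revCurve (hl : IsContLift S G δ c l) :
    IsContLift S G δ (revCurve c) (revCurve l) :=
  ⟨continuousOn_revCurve hl.continuousOn, mapsTo_revCurve hl.mapsTo,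
    fun _ ht => hl.mem_tube _ (one_sub_mem_Icc ht)⟩

namespace LiftSetting

/-- A point of a tube over `U` which is close to `x ∈ U` lies over `x`. -/
theorem exists_normal (L : LiftSetting S U δ ε D ε' V G ν V₀) {x y : Ω} {η : ℝ} (hx : x ∈ U)
    (hy : y ∈ tube S {x} δ) (hy' : y ∈ tube S U η) :
    ∃ w ∈ normalDisc S U δ, w.proj = x ∧ w ∈ normalDisc S U η ∧ expMap w = y := by
  obtain ⟨w, ⟨hw1, hw2, hw3⟩, rfl⟩ := hy
  obtain rfl : w.proj = x := hw2
  have hw : w ∈ normalDisc S U δ := ⟨hw1, hx, hw3⟩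
  refine ⟨w, hw, rfl, ?_, rfl⟩
  obtain ⟨v, hv, hvw⟩ := hy'
  -- For `η ≤ δ` both normal vectors lie in `V₀`, where the exponential map is injective; for `η >
  -- δ` the length bound is immediate.
  rcases le_or_gt η δ with h | h
  · have hv' : v ∈ normalDisc S U δ := ⟨hv.1, hv.2.1, hv.2.2.trans_le h⟩
    rwa [← L.regular.injOn (L.subset_regular hv') (L.subset_regular hw) hvw]
  · exact ⟨hw1, hx, hw3.trans h⟩

theorem exists_normal_of_mem (L : LiftSetting S U δ ε D ε' V G ν V₀) {x y : Ω} (hx : x ∈ U)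
    (hy : y ∈ tube S {x} δ) (hyG : y ∈ G) :
    ∃ w ∈ V, w ∈ V₀ ∧ w.proj = x ∧ expMap w = y := by
  obtain ⟨w, h1, h2, h3, h4⟩ := L.exists_normal hx hy (L.framed.subset_tube hyG)
  exact ⟨w, L.framed.graph.2.1 h3, L.subset_regular h1, h2, h4⟩

theorem footMap_eq (L : LiftSetting S U δ ε D ε' V G ν V₀) {x y : Ω} (hx : x ∈ U)
    (hy : y ∈ tube S {x} δ) (hyG : y ∈ G) : footMap V y = x := by
  obtain ⟨w, h1, -, rfl, rfl⟩ := L.exists_normal_of_mem hx hy hyG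
  exact L.framed.graph.1.footMap_expMap h1

theorem footMap_eq' (L : LiftSetting S U δ ε D ε' V G ν V₀) {x y : Ω} (hx : x ∈ U)
    (hy : y ∈ tube S {x} δ) (hyG : y ∈ G) : footMap V₀ y = x := by
  obtain ⟨w, -, h2, rfl, rfl⟩ := L.exists_normal_of_mem hx hy hyG
  exact L.regular.footMap_expMap h2

theorem footMap_eventuallyEq (L : LiftSetting S U δ ε D ε' V G ν V₀) {x y : Ω} (hx : x ∈ U)
    (hy : y ∈ tube S {x} δ) (hyG : y ∈ G) : footMap V =ᶠ[𝓝 y] footMap V₀ := by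
  obtain ⟨w, h1, h2, rfl, rfl⟩ := L.exists_normal_of_mem hx hy hyG
  exact L.framed.graph.1.footMap_eventuallyEq L.regular h1 h2

theorem subset (L : LiftSetting S U δ ε D ε' V G ν V₀) : G ⊆ D ∩ tube S U ε := by
  obtain ⟨x, rfl⟩ := L.component
  exact connectedComponentIn_subset _ _

/-- Locally `l = σ ∘ c` for a smooth section `σ`, so a continuous lift is as smooth as the curve
below it. -/
theorem contMDiffOn (L : LiftSetting S U δ ε D ε' V G ν V₀) (hl : IsContLift S G δ c l)
    (hcU : MapsTo c (Icc 0 1) U) {J : Set ℝ} (hJ : J ⊆ Icc 0 1)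
    (hc : ContMDiffOn 𝓘(ℝ, ℝ) (𝓡 3) ∞ c J) : ContMDiffOn 𝓘(ℝ, ℝ) (𝓡 3) ∞ l J := by
  have hfoot : ∀ t ∈ Icc (0 : ℝ) 1, footMap V (l t) = c t := fun t ht =>
    L.footMap_eq (hcU ht) (hl.mem_tube t ht) (hl.mapsTo ht)
  intro t ht
  obtain ⟨σ, hσs, hσ, -⟩ := L.framed.exists_section (hl.mapsTo (hJ ht))
  rw [hfoot t (hJ ht)] at hσs
  have h1 : ContMDiffWithinAt 𝓘(ℝ, ℝ) (𝓡 3) ∞ (fun s => σ (c s)) J t :=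
    hσs.comp_contMDiffWithinAt t (hc t ht)
  have h2 : ∀ᶠ s in 𝓝[J] t, l s = σ (c s) := by
    filter_upwards [((hl.continuousOn.mono hJ) t ht).eventually hσ, self_mem_nhdsWithin]
      with s hs hsJ
    rw [← hfoot s (hJ hsJ)]
    exact (hs (hl.mapsTo (hJ hsJ))).symm
  exact h1.congr_of_eventuallyEq h2 (h2.self_of_nhdsWithin ht)

/-- The velocities of `l` are tangent to `G`, hence parallel with respect to `V`. Since the foot
point maps of `V` and `V₀` have the same germ along `l`, they are parallel with respect to `V₀`,
which contains the `δ`-neighbourhood required of a lift. -/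
theorem isDeltaLift (L : LiftSetting S U δ ε D ε' V G ν V₀) (hl : IsContLift S G δ c l)
    (hcU : MapsTo c (Icc 0 1) U) (hc : IsPiecewiseSmooth c) : IsDeltaLift S δ c l := by
  obtain ⟨k, s, hs0, hs1, hs⟩ := hc
  refine ⟨V₀, L.regular, fun v hv => L.subset_regular ⟨hv.1, ?_, hv.2.2⟩, fun t ht => ?_,
    fun t ht => L.footMap_eq' (hcU ht) (hl.mem_tube t ht) (hl.mapsTo ht), k, s, hs0, hs1,
    fun i hi => ?_⟩
  · obtain ⟨t, ht, htv⟩ := hv.2.1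
    exact htv ▸ hcU ht
  · obtain ⟨w, ⟨h1, h2, h3⟩, h4⟩ := hl.mem_tube t ht
    exact ⟨w, ⟨h1, ⟨t, ht, h2.symm⟩, h3⟩, h4⟩
  · obtain ⟨h1, h2, h3, h4⟩ := hs i hi
    have hJ : Icc (s i) (s (i + 1)) ⊆ Icc (0 : ℝ) 1 := Icc_subset_Icc h2 h3
    have h5 := L.contMDiffOn hl hcU hJ h4
    refine ⟨h1, h5, fun t ht => ?_⟩
    have h6 := velocity_mem_tangentSet L.framed.graph.2.2.1 (uniqueDiffOn_Icc h1 t ht) ht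
      (hl.mapsTo.mono_left hJ) ((h5 t ht).mdifferentiableWithinAt (by simp))
    exact (L.framed.graph.2.2.2.2 _ h6).congr
      (L.footMap_eventuallyEq (hcU (hJ ht)) (hl.mem_tube t (hJ ht)) (hl.mapsTo (hJ ht)))

/-- The disk and the component are those already at hand, and the lift is pointed at its own
starting point. Thus every piece, reversal or concatenation of lifts in `G` is again a simple lift,
to which the open lift property can be applied. -/
theorem isSimpleLift (L : LiftSetting S U δ ε D ε' V G ν V₀) (hl : IsContLift S G δ c l)
    (hcU : MapsTo c (Icc 0 1) U) (hc : IsPiecewiseSmooth c) : IsSimpleLift S δ c l := by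
  have h0 := zero_mem_Icc
  have hcomp : connectedComponentIn (D ∩ tube S U ε) (l 0) = G := by
    obtain ⟨x, hx⟩ := L.component
    rw [hx]
    exact (connectedComponentIn_eq (hx ▸ hl.mapsTo h0)).symm
  obtain ⟨w, hw1, hw2, hw3, hw4⟩ := L.exists_normal (hcU h0) (hl.mem_tube 0 h0)
    (L.subset (hl.mapsTo h0)).2
  refine ⟨U, L.precompact, ?_, ε, L.eps_pos, D, c 0, l 0, mem_image_of_mem _ h0,
    L.disk, fun _ => L.isDeltaLift hl hcU hc, fun _ => hl.mapsTo.mono_right L.subset, L.graph,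
    ⟨⟨w, ⟨hw1.1, hw2, hw3.2.2⟩, hw4⟩, (L.subset (hl.mapsTo h0)).1⟩,
    fun _ => mem_image_of_mem _ h0, fun _ => hcomp.symm ▸ L.cover⟩
  rintro - ⟨t, ht, rfl⟩
  exact hcU ht

theorem apply_eq_of_eq (L : LiftSetting S U δ ε D ε' V G ν V₀) (hl : IsContLift S G δ c l)
    (hm : IsContLift S G δ d m) (hcU : MapsTo c (Icc 0 1) U) (hdU : MapsTo d (Icc 0 1) U) {s t : ℝ}
    (hs : s ∈ Icc (0 : ℝ) 1) (ht : t ∈ Icc (0 : ℝ) 1) (h : l s = m t) : c s = d t := by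
  rw [← L.footMap_eq (hcU hs) (hl.mem_tube s hs) (hl.mapsTo hs), h,
    L.footMap_eq (hdU ht) (hm.mem_tube t ht) (hm.mapsTo ht)]

theorem eqOn_of_eq (L : LiftSetting S U δ ε D ε' V G ν V₀) [T2Space Ω] (hl : IsContLift S G δ c l)
    (hm : IsContLift S G δ c m) (hcU : MapsTo c (Icc 0 1) U) {t : ℝ} (ht : t ∈ Icc (0 : ℝ) 1)
    (h : l t = m t) : EqOn l m (Icc 0 1) :=
  L.framed.lift_unique isPreconnected_Icc hl.continuousOn hm.continuousOn hl.mapsTo hm.mapsTo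
    (fun s hs => by rw [L.footMap_eq (hcU hs) (hl.mem_tube s hs) (hl.mapsTo hs),
      L.footMap_eq (hcU hs) (hm.mem_tube s hs) (hm.mapsTo hs)]) ht h

/-- The lift of a commutator is closed. -/
theorem commutator_closed [T2Space Ω]
    [IsContMDiffRiemannianBundle (𝓡 3) ∞ E3 (fun x : Ω => TangentSpace (𝓡 3) x)]
    (L : LiftSetting S U δ ε D ε' V G ν V₀) {l₁ l₂ l₃ l₄ : ℝ → Ω}
    (h₁ : IsContLift S G δ c l₁) (h₂ : IsContLift S G δ d l₂)
    (h₃ : IsContLift S G δ (revCurve c) l₃) (h₄ : IsContLift S G δ (revCurve d) l₄)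
    (hcU : MapsTo c (Icc 0 1) U) (hdU : MapsTo d (Icc 0 1) U) (hc : c 0 = c 1) (hd : d 0 = d 1)
    (hcd : c 0 = d 0) (h₁₂ : l₁ 1 = l₂ 0) (h₂₃ : l₂ 1 = l₃ 0) (h₃₄ : l₃ 1 = l₄ 0) :
    l₄ 1 = l₁ 0 := by
  obtain ⟨h, hG, hinj, hcount⟩ := L.framed.exists_height_signedCount_eq
  have hrr : ∀ c : ℝ → Ω, revCurve (revCurve c) = c := fun c => by
    funext t; simp [revCurve]
  have k₃ : IsContLift S G δ c (revCurve l₃) := by simpa only [hrr] using h₃.revCurve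
  have k₄ : IsContLift S G δ d (revCurve l₄) := by simpa only [hrr] using h₄.revCurve
  have hfoot : ∀ {e l : ℝ → Ω}, IsContLift S G δ e l → MapsTo e (Icc 0 1) U → ∀ t ∈ Icc (0 : ℝ) 1,
      footMap V (l t) = e t := fun hl heU t ht =>
    L.footMap_eq (heU ht) (hl.mem_tube t ht) (hl.mapsTo ht)
  have i0 := zero_mem_Icc
  have i1 := one_mem_Icc
  -- Reversing `l₃` and `l₄` turns them into second lifts of `c` and `d`, to be compared with `l₁`
  -- and `l₂`.
  have n1 := hcount l₁ (revCurve l₃) h₁.continuousOn k₃.continuousOn h₁.mapsTo k₃.mapsTo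
    fun t ht => by rw [hfoot h₁ hcU t ht, hfoot k₃ hcU t ht]
  have n2 := hcount l₂ (revCurve l₄) h₂.continuousOn k₄.continuousOn h₂.mapsTo k₄.mapsTo
    fun t ht => by rw [hfoot h₂ hdU t ht, hfoot k₄ hdU t ht]
  rw [hfoot h₁ hcU 0 i0, hfoot h₁ hcU 1 i1, ← hc] at n1
  rw [hfoot h₂ hdU 0 i0, hfoot h₂ hdU 1 i1, ← hd, ← hcd, ← h₁₂] at n2
  simp only [revCurve, sub_zero, sub_self] at n1 n2
  rw [h₃₄] at n1
  rw [← h₂₃] at n1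
  rw [← h₃₄] at n1 n2
  set p := c 0 with hp
  have f0 : footMap V (l₁ 0) = p := hfoot h₁ hcU 0 i0
  have f1 : footMap V (l₁ 1) = p := (hfoot h₁ hcU 1 i1).trans hc.symm
  have f2 : footMap V (l₂ 1) = p := (hfoot h₂ hdU 1 i1).trans (hd.symm.trans hcd.symm)
  have f3 : footMap V (l₃ 1) = p := by
    have := hfoot k₃ hcU 0 i0
    simpa [revCurve] using this
  have f4 : footMap V (l₄ 1) = p := by
    have := hfoot k₄ hdU 0 i0
    simpa [revCurve, ← hcd] using this
  have m0 := f0 ▸ hG _ (h₁.mapsTo i0)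
  have m1 := f1 ▸ hG _ (h₁.mapsTo i1)
  have m2 := f2 ▸ hG _ (h₂.mapsTo i1)
  have m3 := f3 ▸ hG _ (h₃.mapsTo i1)
  have m4 := f4 ▸ hG _ (h₄.mapsTo i1)
  have hpU : p ∈ U := hcU i0
  have hfin : ∀ a ∈ fibreHeights ν ε' G p, ∀ b ∈ fibreHeights ν ε' G p,
      (fibreHeights ν ε' G p ∩ Icc a b).Finite := fun a ha b hb =>
    L.framed.finite_fibreHeights_inter hpU ha hb
  -- Write `[i, j]` for the signed count from the end of `lᵢ` to the end of `lⱼ`, with `0` standing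
  -- for the start of `l₁`. Then `n1` reads `[0, 3] = [1, 2]` and `n2` reads `[1, 4] = [2, 3]`;
  -- these three sums leave `[0, 4] = 0`.
  have a1 := signedCount_add hfin m1 m2 m4
  have a2 := signedCount_add hfin m2 m4 m3
  have a3 := signedCount_add hfin m0 m4 m3
  refine hinj _ (h₄.mapsTo i1) _ (h₁.mapsTo i0) (f4.trans f0.symm)
    (eq_of_signedCount_eq_zero hfin m0 m4 ?_).symm
  linarith

end LiftSetting

end LiftSetting

/-! ### Components of open subsets of a surface. -/

section Component

variable {Ω : Type*} [TopologicalSpace Ω] [ChartedSpace E3 Ω]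

/-- A connected component of a pre-compact open subset of a surface is pre-compact and open. -/
theorem IsPrecompactOpenIn.connectedComponentIn {S U : Set Ω} (hS : IsEmbeddedSurface S)
    (hU : IsPrecompactOpenIn S U) (p : Ω) : IsPrecompactOpenIn S (connectedComponentIn U p) := by
  obtain ⟨⟨W, hW, hUW⟩, K, hK, hKS, hUK⟩ := hU
  refine ⟨?_, K, hK, hKS, (connectedComponentIn_subset U p).trans hUK⟩
  have hloc : ∀ x ∈ _root_.connectedComponentIn U p, ∃ O : Set Ω, IsOpen O ∧ x ∈ O ∧
      O ∩ S ⊆ _root_.connectedComponentIn U p := by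
    intro x hx
    have hxU : x ∈ U := connectedComponentIn_subset U p hx
    have hxS : x ∈ S := hKS (hUK hxU)
    obtain ⟨e, he, hxe⟩ := hS.exists_isSliceChart hxS
    have hopen : IsOpen (e.target ∩ e.symm ⁻¹' W) := e.symm.isOpen_inter_preimage hW
    have hxm : e x ∈ e.target ∩ e.symm ⁻¹' W := by
      refine ⟨e.map_source hxe, ?_⟩
      rw [mem_preimage, e.left_inv hxe]
      rw [hUW] at hxU
      exact hxU.1
    obtain ⟨r, hr, hball⟩ := Metric.isOpen_iff.1 hopen _ hxm
    refine ⟨e.source ∩ e ⁻¹' Metric.ball (e x) r, e.isOpen_inter_preimage Metric.isOpen_ball,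
      ⟨hxe, Metric.mem_ball_self hr⟩, ?_⟩
    -- A coordinate ball intersected with the slice is convex, so its image in `U` is connected and
    -- stays in the component of `x`.
    have hconv : Convex ℝ (Metric.ball (e x) r ∩ {y : E3 | y 2 = 0}) := by
      refine (convex_ball _ _).inter ?_
      intro y hy z hz a b _ _ _
      have hy' : y 2 = 0 := hy
      have hz' : z 2 = 0 := hz
      simp [hy', hz']
    have hpre : IsPreconnected (e.symm '' (Metric.ball (e x) r ∩ {y : E3 | y 2 = 0})) :=
      hconv.isPreconnected.image _ (e.continuousOn_symm.mono fun y hy => (hball hy.1).1)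
    have hsub : e.symm '' (Metric.ball (e x) r ∩ {y : E3 | y 2 = 0}) ⊆ U := by
      rintro - ⟨y, ⟨hy1, hy2⟩, rfl⟩
      rw [hUW]
      exact ⟨(hball hy1).2, (he.symm_mem_iff (hball hy1).1).2 hy2⟩
    have hxim : x ∈ e.symm '' (Metric.ball (e x) r ∩ {y : E3 | y 2 = 0}) :=
      ⟨e x, ⟨Metric.mem_ball_self hr, (he.apply_mem_iff hxe).2 hxS⟩, e.left_inv hxe⟩
    have hcc := hpre.subset_connectedComponentIn hxim hsub
    rw [← connectedComponentIn_eq hx] at hcc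
    rintro y ⟨⟨hye, hyb⟩, hyS⟩
    exact hcc ⟨e y, ⟨hyb, (he.apply_mem_iff hye).2 hyS⟩, e.left_inv hye⟩
  choose! O hO using hloc
  refine ⟨⋃ x ∈ _root_.connectedComponentIn U p, O x,
    isOpen_biUnion fun x hx => (hO x hx).1, ?_⟩
  ext x
  constructor
  · intro hx
    exact ⟨mem_biUnion hx (hO x hx).2.1, hKS (hUK (connectedComponentIn_subset U p hx))⟩
  · rintro ⟨hx, hxS⟩
    obtain ⟨y, hy, hxy⟩ := mem_iUnion₂.1 hx
    exact (hO y hy).2.2 ⟨hxy, hxS⟩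

end Component

/-! ### A smooth step and its right inverse. -/

section SmoothStep

theorem strictMonoOn_expNegInvGlue : StrictMonoOn expNegInvGlue (Ici 0) := by
  intro x hx y _ hxy
  rcases (mem_Ici.1 hx).eq_or_lt with rfl | hx
  · rw [expNegInvGlue.zero]
    exact expNegInvGlue.pos_of_pos hxy
  · have hy := hx.trans hxy
    simp only [expNegInvGlue, not_le.2 hx, not_le.2 hy, if_false]
    exact Real.exp_lt_exp.2 (neg_lt_neg (inv_strictAnti₀ hx hxy))

theorem strictMonoOn_smoothTransition : StrictMonoOn Real.smoothTransition (Icc 0 1) := by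
  intro x hx y hy hxy
  have h1 := strictMonoOn_expNegInvGlue (mem_Ici.2 hx.1) (mem_Ici.2 hy.1) hxy
  have h2 := strictMonoOn_expNegInvGlue (show (1 - y) ∈ Ici (0 : ℝ) by simp [hy.2])
    (show (1 - x) ∈ Ici (0 : ℝ) by simp [hx.2]) (by linarith : 1 - y < 1 - x)
  rw [Real.smoothTransition, Real.smoothTransition,
    div_lt_div_iff₀ (Real.smoothTransition.pos_denom x) (Real.smoothTransition.pos_denom y)]
  nlinarith [expNegInvGlue.nonneg x, expNegInvGlue.nonneg (1 - y)]

/-- A smooth monotone step from `0` to `1`, constant outside `[1/3, 2/3]`. -/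
noncomputable def smoothStep (x : ℝ) : ℝ := Real.smoothTransition (3 * x - 1)

theorem contDiff_smoothStep : ContDiff ℝ ∞ smoothStep := by
  have h : ContDiff ℝ ∞ fun x : ℝ => 3 * x - 1 := by fun_prop
  exact Real.smoothTransition.contDiff.comp h

theorem smoothStep_mem (x : ℝ) : smoothStep x ∈ Icc (0 : ℝ) 1 :=
  ⟨Real.smoothTransition.nonneg _, Real.smoothTransition.le_one _⟩

theorem smoothStep_of_le {x : ℝ} (hx : x ≤ 1 / 3) : smoothStep x = 0 :=
  Real.smoothTransition.zero_of_nonpos (by linarith)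

theorem smoothStep_of_ge {x : ℝ} (hx : 2 / 3 ≤ x) : smoothStep x = 1 :=
  Real.smoothTransition.one_of_one_le (by linarith)

theorem injOn_smoothStep : InjOn smoothStep (Icc (1 / 3) (2 / 3)) := by
  intro x hx y hy h
  have := strictMonoOn_smoothTransition.injOn (show 3 * x - 1 ∈ Icc (0 : ℝ) 1 from
    ⟨by linarith [hx.1], by linarith [hx.2]⟩) (show 3 * y - 1 ∈ Icc (0 : ℝ) 1 from
    ⟨by linarith [hy.1], by linarith [hy.2]⟩) h
  linarith

/-- The smooth step has a continuous right inverse on `[0, 1]`. -/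
theorem exists_rightInverse_smoothStep : ∃ ρ : ℝ → ℝ, ContinuousOn ρ (Icc 0 1) ∧
    ρ 0 = 1 / 3 ∧ ρ 1 = 2 / 3 ∧
    ∀ t ∈ Icc (0 : ℝ) 1, ρ t ∈ Icc (1 / 3 : ℝ) (2 / 3) ∧ smoothStep (ρ t) = t := by
  have hsurj : ∀ t ∈ Icc (0 : ℝ) 1, ∃ x ∈ Icc (1 / 3 : ℝ) (2 / 3), smoothStep x = t := by
    intro t ht
    have h := intermediate_value_Icc (by norm_num : (1 / 3 : ℝ) ≤ 2 / 3)
      contDiff_smoothStep.continuous.continuousOn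
    rw [smoothStep_of_le le_rfl, smoothStep_of_ge le_rfl] at h
    exact h ht
  choose! ρ hρ hρ' using hsurj
  refine ⟨ρ, ?_, ?_, ?_, fun t ht => ⟨hρ t ht, hρ' t ht⟩⟩
  -- The step is injective on the compact interval `[1/3, 2/3]`, so preimages under `ρ` of closed
  -- sets are images of compact sets under the step.
  · rw [continuousOn_iff_isClosed]
    intro C hC
    refine ⟨smoothStep '' (Icc (1 / 3) (2 / 3) ∩ C),
      ((isCompact_Icc.inter_right hC).image contDiff_smoothStep.continuous).isClosed, ?_⟩
    ext t
    constructor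
    · rintro ⟨h1, h2⟩
      exact ⟨⟨ρ t, ⟨hρ t h2, h1⟩, hρ' t h2⟩, h2⟩
    · rintro ⟨⟨x, ⟨hx, hxC⟩, rfl⟩, h2⟩
      refine ⟨?_, h2⟩
      rw [mem_preimage, injOn_smoothStep (hρ _ h2) hx (hρ' _ h2)]
      exact hxC
  · exact injOn_smoothStep (hρ 0 zero_mem_Icc) (by norm_num)
      ((hρ' 0 zero_mem_Icc).trans (smoothStep_of_le le_rfl).symm)
  · exact injOn_smoothStep (hρ 1 one_mem_Icc) (by norm_num)
      ((hρ' 1 one_mem_Icc).trans (smoothStep_of_ge le_rfl).symm)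

end SmoothStep

/-! ### Loops constant near their ends. -/

section FlatLoops

variable {Ω : Type*} [TopologicalSpace Ω] [ChartedSpace E3 Ω]

/-- `c` is a smooth loop at `p` which is constant near its end points. -/
structure IsFlatLoop (p : Ω) (c : ℝ → Ω) : Prop where
  contMDiff : ContMDiff 𝓘(ℝ, ℝ) (𝓡 3) ∞ c
  start : ∃ η > 0, ∀ t ≤ η, c t = p
  finish : ∃ η > 0, ∀ t ≥ 1 - η, c t = p

variable {p : Ω} {c d : ℝ → Ω}

theorem IsFlatLoop.one (hc : IsFlatLoop p c) : c 1 = p := by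
  obtain ⟨η, hη, h⟩ := hc.finish
  exact h 1 (by linarith)

theorem IsFlatLoop.zero (hc : IsFlatLoop p c) : c 0 = p := by
  obtain ⟨η, hη, h⟩ := hc.start
  exact h 0 hη.le

theorem isFlatLoop_comp_smoothStep (hc : ContMDiffOn 𝓘(ℝ, ℝ) (𝓡 3) ∞ c (Icc 0 1)) (h0 : c 0 = p)
    (h1 : c 1 = p) : IsFlatLoop p (c ∘ smoothStep) := by
  refine ⟨hc.comp_contMDiff (contMDiff_iff_contDiff.2 contDiff_smoothStep) smoothStep_mem,
    ⟨1 / 3, by norm_num, fun t ht => ?_⟩, ⟨1 / 3, by norm_num, fun t ht => ?_⟩⟩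
  · rw [Function.comp_apply, smoothStep_of_le ht, h0]
  · rw [Function.comp_apply, smoothStep_of_ge (by linarith), h1]

/-- Both loops are constantly `p` near the junction, so no corner arises there. -/
theorem IsFlatLoop.concatCurve (hc : IsFlatLoop p c) (hd : IsFlatLoop p d) :
    IsFlatLoop p (concatCurve c d) := by
  obtain ⟨η, hη, h1⟩ := hc.finish
  obtain ⟨η', hη', h2⟩ := hd.start
  obtain ⟨θ, hθ, h3⟩ := hc.start
  obtain ⟨θ', hθ', h4⟩ := hd.finish
  refine ⟨fun t => ?_, ⟨min (θ / 2) (1 / 2), by positivity, fun t ht => ?_⟩,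
    ⟨min (θ' / 2) (1 / 4), by positivity, fun t ht => ?_⟩⟩
  · rcases lt_trichotomy t (1 / 2) with h | rfl | h
    · have hs : ContMDiff 𝓘(ℝ, ℝ) 𝓘(ℝ, ℝ) ∞ (fun t : ℝ => 2 * t) :=
        contMDiff_iff_contDiff.2 (by fun_prop)
      refine ((hc.contMDiff.comp hs) t).congr_of_eventuallyEq ?_
      filter_upwards [Iio_mem_nhds h] with s hs using if_pos (le_of_lt hs)
    · refine (contMDiffAt_const (c := p)).congr_of_eventuallyEq ?_
      filter_upwards [Ioo_mem_nhds (show 1 / 2 - η / 2 < (1 / 2 : ℝ) by linarith)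
        (show (1 / 2 : ℝ) < 1 / 2 + η' / 2 by linarith)] with s hs
      rcases le_or_gt s (1 / 2) with h | h
      · rw [concatCurve_of_le c d h, h1 _ (by linarith [hs.1])]
      · rw [concatCurve_of_ge (hc.one.trans hd.zero.symm) h.le, h2 _ (by linarith [hs.2])]
    · have hs : ContMDiff 𝓘(ℝ, ℝ) 𝓘(ℝ, ℝ) ∞ (fun t : ℝ => 2 * t - 1) :=
        contMDiff_iff_contDiff.2 (by fun_prop)
      refine ((hd.contMDiff.comp hs) t).congr_of_eventuallyEq ?_
      filter_upwards [Ioi_mem_nhds h] with s hs using if_neg (not_le.2 hs)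
  · rw [concatCurve_of_le c d (ht.trans (min_le_right _ _)),
      h3 _ (by linarith [min_le_left (θ / 2) (1 / 2 : ℝ)])]
  · rw [concatCurve_of_ge (hc.one.trans hd.zero.symm)
      (by linarith [min_le_right (θ' / 2) (1 / 4 : ℝ)]),
      h4 _ (by linarith [min_le_left (θ' / 2) (1 / 4 : ℝ)])]

end FlatLoops

/-! ### Existence of composable lifts. -/

section Existence

variable {Ω : Type*} [TopologicalSpace Ω] [ChartedSpace E3 Ω] [IsManifold (𝓡 3) ∞ Ω]
  [RiemannianBundle (fun x : Ω => TangentSpace (𝓡 3) x)]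
  {S U D G : Set Ω} {δ ε ε' : ℝ} {V V₀ : Set (TangentBundle (𝓡 3) Ω)}
  {ν : (x : Ω) → TangentSpace (𝓡 3) x} {c d l : ℝ → Ω}

omit [IsManifold (𝓡 3) ∞ Ω] in
/-- A lift of a concatenation is a concatenation of lifts. -/
theorem IsContLift.exists_halves (h : IsContLift S G δ (LiftProperty.concatCurve c d) l) (hcd : c 1 = d 0) :
    ∃ l₁ l₂ : ℝ → Ω, IsContLift S G δ c l₁ ∧ IsContLift S G δ d l₂ ∧ l₁ 0 = l 0 ∧ l₁ 1 = l₂ 0 ∧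
      l₂ 1 = l 1 := by
  have m1 : MapsTo (fun t : ℝ => t / 2) (Icc 0 1) (Icc 0 1) := fun t ht =>
    ⟨by linarith [ht.1], by linarith [ht.2]⟩
  have m2 : MapsTo (fun t : ℝ => (1 + t) / 2) (Icc 0 1) (Icc 0 1) := fun t ht =>
    ⟨by linarith [ht.1], by linarith [ht.2]⟩
  refine ⟨fun t => l (t / 2), fun t => l ((1 + t) / 2),
    ⟨h.continuousOn.comp (by fun_prop) m1, h.mapsTo.comp m1, fun t ht => ?_⟩,
    ⟨h.continuousOn.comp (by fun_prop) m2, h.mapsTo.comp m2, fun t ht => ?_⟩, by simp, by simp,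
    by norm_num⟩
  · have := h.mem_tube _ (m1 ht)
    rwa [concatCurve_of_le c d (by linarith [ht.2]), show 2 * (t / 2) = t by ring] at this
  · have := h.mem_tube _ (m2 ht)
    rwa [concatCurve_of_ge hcd (by linarith [ht.1]),
      show 2 * ((1 + t) / 2) - 1 = t by ring] at this

/-- A lift of a curve slowed down near its end points yields a lift of the curve. -/
theorem LiftSetting.exists_lift_of_comp_smoothStep [T2Space Ω]
    (L : LiftSetting S U δ ε D ε' V G ν V₀)
    (hl : IsContLift S G δ (c ∘ smoothStep) l) (hcU : MapsTo c (Icc 0 1) U) :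
    ∃ m : ℝ → Ω, IsContLift S G δ c m ∧ m 0 = l 0 ∧ m 1 = l 1 := by
  obtain ⟨ρ, hρc, hρ0, hρ1, hρ⟩ := exists_rightInverse_smoothStep
  have hmaps : MapsTo ρ (Icc 0 1) (Icc 0 1) := fun t ht =>
    Icc_subset_Icc (by norm_num) (by norm_num) (hρ t ht).1
  have hfoot : ∀ t ∈ Icc (0 : ℝ) 1, footMap V (l t) = c (smoothStep t) := fun t ht =>
    L.footMap_eq (hcU (smoothStep_mem t)) (hl.mem_tube t ht) (hl.mapsTo ht)
  -- Where the slowed curve is constant, uniqueness makes its lift constant. So restricting the lift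
  -- to `[1/3, 2/3]`, the range of `ρ`, preserves the end points.
  have hconst : ∀ {a b x : ℝ}, Icc a b ⊆ Icc 0 1 → (∀ t ∈ Icc a b, smoothStep t = x) →
      a ≤ b → l a = l b := by
    intro a b x hab hx hle
    have hb : b ∈ Icc a b := ⟨hle, le_rfl⟩
    exact L.framed.lift_unique (m := fun _ => l b) isPreconnected_Icc (hl.continuousOn.mono hab)
      continuousOn_const (hl.mapsTo.mono_left hab) (fun _ _ => hl.mapsTo (hab hb))
      (fun t ht => by rw [hfoot t (hab ht), hfoot b (hab hb), hx t ht, hx b hb]) hb rfl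
      ⟨le_rfl, hle⟩
  refine ⟨l ∘ ρ, ⟨hl.continuousOn.comp hρc hmaps, hl.mapsTo.comp hmaps, fun t ht => ?_⟩, ?_, ?_⟩
  · have h := hl.mem_tube _ (hmaps ht)
    rwa [Function.comp_apply, (hρ t ht).2] at h
  · rw [Function.comp_apply, hρ0]
    exact (hconst (x := 0) (Icc_subset_Icc le_rfl (by norm_num))
      (fun t ht => smoothStep_of_le ht.2) (by norm_num)).symm
  · rw [Function.comp_apply, hρ1]
    exact hconst (x := 1) (Icc_subset_Icc (by norm_num) le_rfl)
      (fun t ht => smoothStep_of_ge ht.1) (by norm_num)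

/-- A `δ`-lift contained in `D ∩ tube S U ε` is a continuous lift to a component of this set. -/
theorem IsDeltaLift.isContLift (h : IsDeltaLift S δ c l) {A : Set Ω}
    (hl : MapsTo l (Icc 0 1) A) : IsContLift S (connectedComponentIn A (l 0)) δ c l := by
  obtain ⟨V, hV, hcV, hmaps, hfoot, k, s, hs0, hs1, hs⟩ := h
  have hcont : ContinuousOn l (Icc 0 1) :=
    continuousOn_of_pieces hs0 hs1 fun i hi => ⟨(hs i hi).1, (hs i hi).2.1.continuousOn⟩
  refine ⟨hcont, ?_, fun t ht => ?_⟩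
  · rw [mapsTo_iff_image_subset]
    exact (isPreconnected_Icc.image l hcont).subset_connectedComponentIn
      (mem_image_of_mem _ zero_mem_Icc) hl.image_subset
  · obtain ⟨w, hw, hwl⟩ := hmaps ht
    have h1 := hfoot t ht
    rw [← hwl, hV.footMap_expMap (hcV hw)] at h1
    exact ⟨w, ⟨hw.1, h1, hw.2.2⟩, hwl⟩

/-- For all small `δ` there are lifts of `α`, `β`, `α⁻¹`, `β⁻¹` which fit together to a lift of the
commutator of `α` and `β`. -/
theorem HasGenSimpleLiftProperty.exists_lifts [T2Space Ω] (hlift : HasGenSimpleLiftProperty S)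
    (hS : IsEmbeddedSurface S) (hU : IsPrecompactOpenIn S U) (hUc : IsConnected U)
    (hν : IsNormalFrame S U ν) {α β : ℝ → Ω} {p : Ω} (hα : IsSmoothCurveIn U α)
    (hβ : IsSmoothCurveIn U β) (hα0 : α 0 = p) (hα1 : α 1 = p) (hβ0 : β 0 = p) (hβ1 : β 1 = p) :
    ∃ δ₁ > 0, ∀ δ : ℝ, 0 < δ → δ < δ₁ → ∃ (ε : ℝ) (D : Set Ω) (ε' : ℝ)
      (V : Set (TangentBundle (𝓡 3) Ω)) (G : Set Ω) (V₀ : Set (TangentBundle (𝓡 3) Ω)),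
      LiftSetting S U δ ε D ε' V G ν V₀ ∧ ∃ l₁ l₂ l₃ l₄ : ℝ → Ω, IsContLift S G δ α l₁ ∧
        IsContLift S G δ β l₂ ∧ IsContLift S G δ (revCurve α) l₃ ∧
        IsContLift S G δ (revCurve β) l₄ ∧ l₁ 1 = l₂ 0 ∧ l₂ 1 = l₃ 0 ∧ l₃ 1 = l₄ 0 := by
  have hα' : IsFlatLoop p (α ∘ smoothStep) := isFlatLoop_comp_smoothStep hα.1 hα0 hα1
  have hβ' : IsFlatLoop p (β ∘ smoothStep) := isFlatLoop_comp_smoothStep hβ.1 hβ0 hβ1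
  have hαr : IsFlatLoop p (revCurve α ∘ smoothStep) :=
    isFlatLoop_comp_smoothStep (contMDiffOn_revCurve hα.1) (by simp [revCurve, hα1])
      (by simp [revCurve, hα0])
  have hβr : IsFlatLoop p (revCurve β ∘ smoothStep) :=
    isFlatLoop_comp_smoothStep (contMDiffOn_revCurve hβ.1) (by simp [revCurve, hβ1])
      (by simp [revCurve, hβ0])
  have h₁ := hα'.concatCurve hβ'
  have h₂ := hαr.concatCurve hβr
  -- The lift property is applied to this one smooth curve, so all four lifts lie in the same disk
  -- and fit together.
  set γ := concatCurve (concatCurve (α ∘ smoothStep) (β ∘ smoothStep))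
    (concatCurve (revCurve α ∘ smoothStep) (revCurve β ∘ smoothStep)) with hγ
  have hflat : IsFlatLoop p γ := h₁.concatCurve h₂
  have hstep : ∀ {c : ℝ → Ω}, MapsTo c (Icc 0 1) U → MapsTo (c ∘ smoothStep) (Icc 0 1) U :=
    fun hc t _ => hc (smoothStep_mem t)
  have hγU : MapsTo γ (Icc 0 1) U :=
    mapsTo_concatCurve (mapsTo_concatCurve (hstep hα.2) (hstep hβ.2))
      (mapsTo_concatCurve (hstep (mapsTo_revCurve hα.2)) (hstep (mapsTo_revCurve hβ.2)))
  have hγs : IsSmoothCurveIn U γ := ⟨hflat.contMDiff.contMDiffOn, hγU⟩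
  have hpγ : p ∈ curveImage γ := ⟨0, zero_mem_Icc, hflat.zero⟩
  have hpU : p ∈ U := hα0 ▸ hα.2 zero_mem_Icc
  obtain ⟨δ₁, hδ₁, hδ⟩ := hlift U hU hUc
  -- A lift for the auxiliary value `δ₁ / 2` supplies a regular neighbourhood of `U` whose size does
  -- not depend on `δ`.
  obtain ⟨V₀, ε₀, hε₀, hV₀, hUV₀⟩ : ∃ (V₀ : Set (TangentBundle (𝓡 3) Ω)) (ε₀ : ℝ), 0 < ε₀ ∧
      IsRegularDomain S V₀ ∧ normalDisc S U ε₀ ⊆ V₀ := by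
    obtain ⟨ε, -, D, q, l, hl⟩ := hδ (δ₁ / 2) (by linarith) (by linarith) p hpU 1 (fun _ => γ)
      one_pos (fun _ => hγs) (fun _ => hpγ)
    obtain ⟨ε₀, hε₀, V₀, hG, -⟩ := hl.cover 0
    exact ⟨V₀, ε₀, hε₀, hG.1, hG.2.1⟩
  -- `δ < ε₀` puts the `δ`-neighbourhood of `U` inside `V₀`, and `δ < 1` makes non-zero parallel
  -- vectors transverse to the fibres.
  refine ⟨min δ₁ (min ε₀ 1), by positivity, fun δ hδ0 hδlt => ?_⟩
  obtain ⟨hlt1, hlt2⟩ := lt_min_iff.1 hδlt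
  obtain ⟨hlt2, hlt3⟩ := lt_min_iff.1 hlt2
  obtain ⟨ε, hε, D, q, l, hl⟩ := hδ δ hδ0 hlt1 p hpU 1 (fun _ => γ)
      one_pos (fun _ => hγs) (fun _ => hpγ)
  have hcover := hl.cover 0
  obtain ⟨ε', hε', V, hG, hGc, -⟩ := id hcover
  have L : LiftSetting S U δ ε D ε' V (connectedComponentIn (D ∩ tube S U ε) (l 0 0)) ν V₀ :=
    ⟨⟨hS, hU.1, hG, hGc.isPreconnected, hν, hδ0, hlt3, hε'⟩, hU, hε, hl.disk, hl.graph, hcover,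
      ⟨_, rfl⟩, hV₀, fun v hv => hUV₀ ⟨hv.1, hv.2.1, hv.2.2.trans hlt2⟩⟩
  refine ⟨ε, D, ε', V, _, V₀, L, ?_⟩
  have hlc := (hl.lift 0).isContLift (hl.mapsTo 0)
  obtain ⟨k, k', hk, hk', -, hkk, -⟩ := hlc.exists_halves (h₁.one.trans h₂.zero.symm)
  obtain ⟨k₁, k₂, hk₁, hk₂, -, e₁₂, e₂⟩ := hk.exists_halves (hα'.one.trans hβ'.zero.symm)
  obtain ⟨k₃, k₄, hk₃, hk₄, e₃, e₃₄, -⟩ := hk'.exists_halves (hαr.one.trans hβr.zero.symm)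
  obtain ⟨l₁, hl₁, -, f₁⟩ := L.exists_lift_of_comp_smoothStep hk₁ hα.2
  obtain ⟨l₂, hl₂, g₂, f₂⟩ := L.exists_lift_of_comp_smoothStep hk₂ hβ.2
  obtain ⟨l₃, hl₃, g₃, f₃⟩ := L.exists_lift_of_comp_smoothStep hk₃ (mapsTo_revCurve hα.2)
  obtain ⟨l₄, hl₄, g₄, -⟩ := L.exists_lift_of_comp_smoothStep hk₄ (mapsTo_revCurve hβ.2)
  exact ⟨l₁, l₂, l₃, l₄, hl₁, hl₂, hl₃, hl₄, by rw [f₁, g₂, e₁₂], by rw [f₂, g₃, e₂, hkk, e₃],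
    by rw [f₃, g₄, e₃₄]⟩

end Existence

/-! ### Self-intersections of concatenated and reversed curves. -/

section Embedded

variable {Ω : Type*} {l m : ℝ → Ω}

theorem injOn_concatCurve (hl : InjOn l (Icc 0 1)) (hm : InjOn m (Icc 0 1))
    (h : ∀ s ∈ Icc (0 : ℝ) 1, ∀ t ∈ Icc (0 : ℝ) 1, l s = m t → s = 1 ∧ t = 0) :
    InjOn (concatCurve l m) (Icc 0 1) := by
  intro s hs t ht hst
  rcases exists_concatCurve_eq hs with ⟨s1, s2, s3⟩ | ⟨s1, s2, s3⟩ <;>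
    rcases exists_concatCurve_eq ht with ⟨t1, t2, t3⟩ | ⟨t1, t2, t3⟩ <;> rw [s3, t3] at hst
  · linarith [hl s2 t2 hst]
  · linarith [(h _ s2 _ t2 hst).2]
  · linarith [(h _ t2 _ s2 hst.symm).2]
  · linarith [hm s2 t2 hst]

theorem isEmbeddedCurve_concatCurve [TopologicalSpace Ω] [ChartedSpace E3 Ω]
    (hl : InjOn l (Icc 0 1)) (hm : InjOn m (Icc 0 1))
    (h : ∀ s ∈ Icc (0 : ℝ) 1, ∀ t ∈ Icc (0 : ℝ) 1, l s = m t →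
      (s = 1 ∧ t = 0) ∨ (s = 0 ∧ t = 1)) : IsEmbeddedCurve (concatCurve l m) := by
  intro s hs t ht hst
  rcases exists_concatCurve_eq hs with ⟨s1, s2, s3⟩ | ⟨s1, s2, s3⟩ <;>
    rcases exists_concatCurve_eq ht with ⟨t1, t2, t3⟩ | ⟨t1, t2, t3⟩ <;> rw [s3, t3] at hst
  · exact .inl (by linarith [hl s2 t2 hst])
  · rcases h _ s2 _ t2 hst with ⟨h1, h2⟩ | ⟨h1, h2⟩
    · linarith
    · exact .inr (.inl ⟨by linarith, by linarith⟩)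
  · rcases h _ t2 _ s2 hst.symm with ⟨h1, h2⟩ | ⟨h1, h2⟩
    · linarith
    · exact .inr (.inr ⟨by linarith, by linarith⟩)
  · exact .inl (by linarith [hm s2 t2 hst])

theorem revCurve_revCurve (c : ℝ → Ω) : revCurve (revCurve c) = c := by
  funext t
  simp [revCurve]

theorem IsEmbeddedCurve.revCurve {c : ℝ → Ω} (hc : IsEmbeddedCurve c) :
    IsEmbeddedCurve (revCurve c) := by
  intro s hs t ht hst
  rcases hc _ (one_sub_mem_Icc hs) _ (one_sub_mem_Icc ht) hst with h | ⟨h1, h2⟩ | ⟨h1, h2⟩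
  · exact .inl (by linarith)
  · exact .inr (.inr ⟨by linarith, by linarith⟩)
  · exact .inr (.inl ⟨by linarith, by linarith⟩)

theorem IsEmbeddedCurve.eq_zero_or_one {c : ℝ → Ω} (hc : IsEmbeddedCurve c) {s : ℝ}
    (hs : s ∈ Icc (0 : ℝ) 1) (h : c s = c 0) : s = 0 ∨ s = 1 := by
  rcases hc s hs 0 zero_mem_Icc h with h | ⟨h, -⟩ | ⟨h, -⟩
  · exact .inl h
  · exact .inl h
  · exact .inr h

end Embedded

/-! ### Embeddedness of the lifts and the lifting lemma. -/

section Main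

variable {Ω : Type*} [TopologicalSpace Ω] [ChartedSpace E3 Ω] [IsManifold (𝓡 3) ∞ Ω]
  [RiemannianBundle (fun x : Ω => TangentSpace (𝓡 3) x)]
  {S U D G : Set Ω} {δ ε ε' : ℝ} {V V₀ : Set (TangentBundle (𝓡 3) Ω)}
  {ν : (x : Ω) → TangentSpace (𝓡 3) x} {c d l m : ℝ → Ω}

namespace LiftSetting

/-- A self-intersection of the lift projects to one of `c`, which can only be the coincidence of the
two ends; these are distinct upstairs. -/
theorem injOn_of_isEmbeddedCurve (L : LiftSetting S U δ ε D ε' V G ν V₀)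
    (hl : IsContLift S G δ c l) (hcU : MapsTo c (Icc 0 1) U) (hc : IsEmbeddedCurve c)
    (h : l 0 ≠ l 1) : InjOn l (Icc 0 1) := by
  intro s hs t ht hst
  rcases hc s hs t ht (L.apply_eq_of_eq hl hl hcU hcU hs ht hst) with
    h1 | ⟨rfl, rfl⟩ | ⟨rfl, rfl⟩
  · exact h1
  · exact absurd hst h
  · exact absurd hst.symm h

/-- Two lifts of an embedded curve in opposite directions are disjoint if their end points are
suitably distinct. -/
theorem ne_of_revCurve [T2Space Ω] (L : LiftSetting S U δ ε D ε' V G ν V₀)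
    (hl : IsContLift S G δ c l) (hm : IsContLift S G δ (revCurve c) m)
    (hcU : MapsTo c (Icc 0 1) U) (hc : IsEmbeddedCurve c) (h01 : l 0 ≠ m 1) (h00 : l 0 ≠ m 0)
    (h11 : l 1 ≠ m 1) {s t : ℝ} (hs : s ∈ Icc (0 : ℝ) 1) (ht : t ∈ Icc (0 : ℝ) 1) :
    l s ≠ m t := by
  intro hst
  have h1 : c s = c (1 - t) := L.apply_eq_of_eq hl hm hcU (mapsTo_revCurve hcU) hs ht hst
  rcases hc s hs _ (one_sub_mem_Icc ht) h1 with h | ⟨rfl, h⟩ | ⟨rfl, h⟩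
  · have hm' : IsContLift S G δ c (revCurve m) := by
      simpa only [revCurve_revCurve] using hm.revCurve
    have h2 : l s = revCurve m s := by
      rw [hst, revCurve, h, sub_sub_cancel]
    have h3 := L.eqOn_of_eq hl hm' hcU hs h2 zero_mem_Icc
    rw [revCurve, sub_zero] at h3
    exact h01 h3
  · obtain rfl : t = 0 := by linarith
    exact h00 hst
  · obtain rfl : t = 1 := by linarith
    exact h11 hst

/-- Lifts of two loops which meet only in their base point meet only in their end points. -/
theorem endpoints_of_eq (L : LiftSetting S U δ ε D ε' V G ν V₀)
    (hl : IsContLift S G δ c l) (hm : IsContLift S G δ d m)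
    (hcU : MapsTo c (Icc 0 1) U) (hdU : MapsTo d (Icc 0 1) U)
    (hcd : ∀ s ∈ Icc (0 : ℝ) 1, ∀ t ∈ Icc (0 : ℝ) 1, c s = d t →
      (s = 0 ∨ s = 1) ∧ (t = 0 ∨ t = 1)) {s t : ℝ} (hs : s ∈ Icc (0 : ℝ) 1)
    (ht : t ∈ Icc (0 : ℝ) 1) (hst : l s = m t) :
    (s = 0 ∧ t = 0 ∧ l 0 = m 0) ∨ (s = 0 ∧ t = 1 ∧ l 0 = m 1) ∨
      (s = 1 ∧ t = 0 ∧ l 1 = m 0) ∨ (s = 1 ∧ t = 1 ∧ l 1 = m 1) := by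
  obtain ⟨rfl | rfl, rfl | rfl⟩ := hcd s hs t ht (L.apply_eq_of_eq hl hm hcU hdU hs ht hst)
  all_goals simp [hst]

end LiftSetting

theorem hasEmbeddedClosedLiftProperty_of_forall
    (h : ∀ η > 0, ∃ δ : ℝ, 0 < δ ∧ δ < η ∧ ∃ l : ℝ → Ω, IsSimpleLift S δ c l ∧ IsClosedCurve l ∧
      IsEmbeddedCurve l) : HasEmbeddedClosedLiftProperty S c := by
  have h' : ∀ i : ℕ, ∃ δ : ℝ, 0 < δ ∧ δ < 1 / ((i : ℝ) + 1) ∧ ∃ l : ℝ → Ω,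
      IsSimpleLift S δ c l ∧ IsClosedCurve l ∧ IsEmbeddedCurve l := fun i => h _ (by positivity)
  choose δ h1 h2 l h3 using h'
  exact ⟨δ, l, h1, squeeze_zero (fun i => (h1 i).le) (fun i => (h2 i).le)
    tendsto_one_div_add_atTop_nhds_zero_nat, h3⟩

end Main

end LiftProperty

theorem mainTheorem6 {Ω : Type*} [TopologicalSpace Ω] [T2Space Ω] [SecondCountableTopology Ω]
    [ChartedSpace E3 Ω] [IsManifold (𝓡 3) ∞ Ω]
    [RiemannianBundle (fun x : Ω => TangentSpace (𝓡 3) x)]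
    [IsContMDiffRiemannianBundle (𝓡 3) ∞ E3 (fun x : Ω => TangentSpace (𝓡 3) x)]
    (S : Set Ω) (hS : IsEmbeddedSurface S) (hlift : HasGenSimpleLiftProperty S)
    (α β : ℝ → Ω) (hα : IsSmoothCurveIn S α) (hβ : IsSmoothCurveIn S β)
    (hαc : IsClosedCurve α) (hβc : IsClosedCurve β)
    (hαo : HasOpenLiftProperty S α) (hβo : HasOpenLiftProperty S β)
    (p : Ω) (hαp : α 0 = p) (hβp : β 0 = p) (hp : curveImage α ∩ curveImage β = {p})
    (U : Set Ω) (hU : IsPrecompactOpenIn S U) (hU2 : IsTwoSided S U)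
    (hαU : curveImage α ⊆ U) (hβU : curveImage β ⊆ U) :
    HasClosedLiftProperty S (commutatorCurve α β) ∧
    (IsEmbeddedCurve α → IsEmbeddedCurve β →
      HasEmbeddedLiftProperty S α → HasEmbeddedLiftProperty S β →
      HasEmbeddedClosedLiftProperty S (commutatorCurve α β) ∨
      HasEmbeddedClosedLiftProperty S (concatCurve α β) ∨
      HasEmbeddedClosedLiftProperty S (concatCurve β (revCurve α))) := by
  have i0 := zero_mem_Icc
  have i1 := one_mem_Icc
  have hα1 : α 1 = p := hαc.symm.trans hαp
  have hβ1 : β 1 = p := hβc.symm.trans hβp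
  have hpU : p ∈ U := hαp ▸ hαU (mem_image_of_mem α i0)
  -- The lift property is stated for connected open sets; both loops pass through `p` and so lie in
  -- its component.
  set U' := connectedComponentIn U p with hU'
  have hsub : ∀ {c : ℝ → Ω}, IsSmoothCurveIn S c → c 0 = p → curveImage c ⊆ U →
      MapsTo c (Icc 0 1) U' := by
    intro c hc hcp hcU
    have h1 : IsPreconnected (curveImage c) := isPreconnected_Icc.image c hc.1.continuousOn
    have h2 := h1.subset_connectedComponentIn (show p ∈ curveImage c from ⟨0, i0, hcp⟩) hcU
    exact fun t ht => h2 (mem_image_of_mem c ht)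
  have hαU' := hsub hα hαp hαU
  have hβU' := hsub hβ hβp hβU
  have hαr := mapsTo_revCurve hαU'
  have hβr := mapsTo_revCurve hβU'
  obtain ⟨ν, hν1, hν2⟩ := hU2
  have hν : IsNormalFrame S U ν := ⟨hν1, fun x hx => (hν2 x hx).1, fun x hx => (hν2 x hx).2⟩
  have sα := IsPiecewiseSmooth.of_contMDiffOn hα.1
  have sβ := IsPiecewiseSmooth.of_contMDiffOn hβ.1
  have sα' := IsPiecewiseSmooth.of_contMDiffOn (contMDiffOn_revCurve hα.1)
  have sβ' := IsPiecewiseSmooth.of_contMDiffOn (contMDiffOn_revCurve hβ.1)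
  have rα0 : revCurve α 0 = p := by simp [revCurve, hα1]
  have rα1 : revCurve α 1 = p := by simp [revCurve, hαp]
  have rβ0 : revCurve β 0 = p := by simp [revCurve, hβ1]
  have sαβ := sα.concatCurve sβ (hα1.trans hβp.symm)
  have sβα := sβ.concatCurve sα' (hβ1.trans rα0.symm)
  have sμ : IsPiecewiseSmooth (commutatorCurve α β) :=
    sαβ.concatCurve (sα'.concatCurve sβ' (rα1.trans rβ0.symm))
      (by rw [concatCurve_one, concatCurve_zero, hβ1, rα0])
  have uμ : MapsTo (commutatorCurve α β) (Icc 0 1) U' :=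
    mapsTo_concatCurve (mapsTo_concatCurve hαU' hβU') (mapsTo_concatCurve hαr hβr)
  obtain ⟨δ₁, hδ₁, hδ⟩ := hlift.exists_lifts hS (hU.connectedComponentIn hS p)
    (isConnected_connectedComponentIn_iff.2 hpU) (hν.mono (connectedComponentIn_subset U p))
    ⟨hα.1, hαU'⟩ ⟨hβ.1, hβU'⟩ hαp hα1 hβp hβ1
  constructor
  · rintro ⟨δ₀, hδ₀, hno⟩
    obtain ⟨δ, hδpos, hδlt⟩ := exists_between (lt_min hδ₁ hδ₀)
    obtain ⟨hlt1, hlt2⟩ := lt_min_iff.1 hδlt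
    obtain ⟨ε, D, ε', V, G, V₀, L, l₁, l₂, l₃, l₄, h₁, h₂, h₃, h₄, h₁₂, h₂₃, h₃₄⟩ :=
      hδ δ hδpos hlt1
    have hclosed := L.commutator_closed h₁ h₂ h₃ h₄ hαU' hβU' hαc hβc (hαp.trans hβp.symm)
      h₁₂ h₂₃ h₃₄
    refine hno δ hδpos hlt2 ⟨_, L.isSimpleLift ((h₁.concatCurve h₂ h₁₂).concatCurve
      (h₃.concatCurve h₄ h₃₄) (by rw [concatCurve_one, concatCurve_zero, h₂₃])) uμ sμ, ?_⟩
    rw [IsClosedCurve, concatCurve_zero, concatCurve_zero, concatCurve_one, concatCurve_one,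
      hclosed]
  intro hαe hβe _ _
  obtain ⟨δα, hδα, hα'⟩ := hαo
  obtain ⟨δβ, hδβ, hβ'⟩ := hβo
  have hends : ∀ {c d : ℝ → Ω}, IsEmbeddedCurve c → IsEmbeddedCurve d → c 0 = p → d 0 = p →
      MapsTo c (Icc 0 1) (curveImage α) → MapsTo d (Icc 0 1) (curveImage β) →
      ∀ s ∈ Icc (0 : ℝ) 1, ∀ t ∈ Icc (0 : ℝ) 1, c s = d t →
        (s = 0 ∨ s = 1) ∧ (t = 0 ∨ t = 1) := by
    intro c d hc hd hc0 hd0 hcα hdβ s hs t ht hst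
    have h1 : c s ∈ curveImage α ∩ curveImage β := ⟨hcα hs, hst ▸ hdβ ht⟩
    rw [hp, mem_singleton_iff] at h1
    exact ⟨hc.eq_zero_or_one hs (h1.trans hc0.symm),
      hd.eq_zero_or_one ht (hst.symm.trans (h1.trans hd0.symm))⟩
  have mα : MapsTo α (Icc 0 1) (curveImage α) := mapsTo_image _ _
  have mβ : MapsTo β (Icc 0 1) (curveImage β) := mapsTo_image _ _
  -- for every small `δ` one of the three curves has a closed embedded lift
  have main : ∀ δ : ℝ, 0 < δ → δ < δ₁ → δ < δα → δ < δβ → ∃ l : ℝ → Ω, IsClosedCurve l ∧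
      IsEmbeddedCurve l ∧ (IsSimpleLift S δ (commutatorCurve α β) l ∨
        IsSimpleLift S δ (concatCurve α β) l ∨
        IsSimpleLift S δ (concatCurve β (revCurve α)) l) := by
    intro δ hδpos hlt1 hltα hltβ
    obtain ⟨ε, D, ε', V, G, V₀, L, l₁, l₂, l₃, l₄, h₁, h₂, h₃, h₄, h₁₂, h₂₃, h₃₄⟩ :=
      hδ δ hδpos hlt1
    have h₄₁ := L.commutator_closed h₁ h₂ h₃ h₄ hαU' hβU' hαc hβc (hαp.trans hβp.symm)
      h₁₂ h₂₃ h₃₄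
    -- Each piece, reversed where necessary, is a simple lift of `α` or `β`, so the open lift
    -- property keeps its ends apart.
    have n₁ : l₁ 0 ≠ l₁ 1 := fun h => hα' δ hδpos hltα ⟨l₁, L.isSimpleLift h₁ hαU' sα, h⟩
    have n₂ : l₂ 0 ≠ l₂ 1 := fun h => hβ' δ hδpos hltβ ⟨l₂, L.isSimpleLift h₂ hβU' sβ, h⟩
    have n₃ : l₃ 0 ≠ l₃ 1 := fun h => hα' δ hδpos hltα ⟨revCurve l₃, L.isSimpleLift
      (by simpa only [revCurve_revCurve] using h₃.revCurve) hαU' sα,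
      by simpa [IsClosedCurve, revCurve] using h.symm⟩
    have n₄ : l₄ 0 ≠ l₄ 1 := fun h => hβ' δ hδpos hltβ ⟨revCurve l₄, L.isSimpleLift
      (by simpa only [revCurve_revCurve] using h₄.revCurve) hβU' sβ,
      by simpa [IsClosedCurve, revCurve] using h.symm⟩
    have j₁ := L.injOn_of_isEmbeddedCurve h₁ hαU' hαe n₁
    have j₂ := L.injOn_of_isEmbeddedCurve h₂ hβU' hβe n₂
    have j₃ := L.injOn_of_isEmbeddedCurve h₃ hαr hαe.revCurve n₃
    have j₄ := L.injOn_of_isEmbeddedCurve h₄ hβr hβe.revCurve n₄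
    -- Everything is now expressed through the four corners `l₁ 0`, `l₁ 1`, `l₂ 1`, `l₃ 1`; `n₁` to
    -- `n₄` say that consecutive ones differ.
    rw [h₄₁] at n₄
    rw [← h₁₂] at n₂
    rw [← h₂₃] at n₃
    rw [← h₃₄] at n₄
    have e₁₂ := fun s hs t ht => L.endpoints_of_eq (s := s) (t := t) h₁ h₂ hαU' hβU'
      (hends hαe hβe hαp hβp mα mβ) hs ht
    have e₃₄ := fun s hs t ht => L.endpoints_of_eq (s := s) (t := t) h₃ h₄ hαr hβr
      (hends hαe.revCurve hβe.revCurve rα0 rβ0 (mapsTo_revCurve mα) (mapsTo_revCurve mβ)) hs ht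
    have e₁₄ := fun s hs t ht => L.endpoints_of_eq (s := s) (t := t) h₁ h₄ hαU' hβr
      (hends hαe hβe.revCurve hαp rβ0 mα (mapsTo_revCurve mβ)) hs ht
    have e₃₂ := fun s hs t ht => L.endpoints_of_eq (s := s) (t := t) h₃ h₂ hαr hβU'
      (hends hαe.revCurve hβe rα0 hβp (mapsTo_revCurve mα) mβ) hs ht
    rw [h₄₁, ← h₃₄] at e₁₄ e₃₄
    rw [← h₁₂] at e₁₂ e₃₂
    rw [← h₂₃] at e₃₂ e₃₄
    -- If one pair of opposite corners coincides, half of the quadrilateral is already a closed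
    -- embedded lift.
    by_cases h02 : l₁ 0 = l₂ 1
    · refine ⟨concatCurve l₁ l₂, by rw [IsClosedCurve, concatCurve_zero, concatCurve_one, h02],
        isEmbeddedCurve_concatCurve j₁ j₂ fun s hs t ht hst => ?_,
        .inr (.inl (L.isSimpleLift (h₁.concatCurve h₂ h₁₂) (mapsTo_concatCurve hαU' hβU') sαβ))⟩
      have := e₁₂ s hs t ht hst
      tauto
    by_cases h13 : l₁ 1 = l₃ 1
    · refine ⟨concatCurve l₂ l₃,
        by rw [IsClosedCurve, concatCurve_zero, concatCurve_one, ← h₁₂, h13],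
        isEmbeddedCurve_concatCurve j₂ j₃ fun s hs t ht hst => ?_,
        .inr (.inr (L.isSimpleLift (h₂.concatCurve h₃ h₂₃) (mapsTo_concatCurve hβU' hαr) sβα))⟩
      have := e₃₂ t ht s hs hst.symm
      tauto
    -- All four corners are now distinct, so the two lifts over `α` are disjoint, and so are the two
    -- over `β`.
    have d₁₃ := fun s hs t ht => L.ne_of_revCurve (s := s) (t := t) h₁ h₃ hαU' hαe
      (fun h => n₄ h.symm) (fun h => h02 (h.trans h₂₃.symm)) h13 hs ht
    have d₂₄ := fun s hs t ht => L.ne_of_revCurve (s := s) (t := t) h₂ h₄ hβU' hβe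
      (fun h => n₁ (h₁₂.trans (h.trans h₄₁)).symm) (fun h => h13 (h₁₂.trans (h.trans h₃₄.symm)))
      (fun h => h02 (h.trans h₄₁).symm) hs ht
    refine ⟨concatCurve (concatCurve l₁ l₂) (concatCurve l₃ l₄), ?_, ?_,
      .inl (L.isSimpleLift ((h₁.concatCurve h₂ h₁₂).concatCurve
      (h₃.concatCurve h₄ h₃₄) (by rw [concatCurve_one, concatCurve_zero, h₂₃])) uμ sμ)⟩
    · rw [IsClosedCurve, concatCurve_zero, concatCurve_zero, concatCurve_one, concatCurve_one,
        h₄₁]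
    · refine isEmbeddedCurve_concatCurve (injOn_concatCurve j₁ j₂ fun s hs t ht hst => ?_)
        (injOn_concatCurve j₃ j₄ fun s hs t ht hst => ?_) fun s hs t ht hst => ?_
      · have := e₁₂ s hs t ht hst
        tauto
      · have := e₃₄ s hs t ht hst
        have h20 := Ne.symm h02
        tauto
      · rcases exists_concatCurve_eq hs with ⟨s1, s2, s3⟩ | ⟨s1, s2, s3⟩ <;>
          rcases exists_concatCurve_eq ht with ⟨t1, t2, t3⟩ | ⟨t1, t2, t3⟩ <;> rw [s3, t3] at hst
        · exact absurd hst (d₁₃ _ s2 _ t2)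
        · obtain ⟨h5, h6⟩ : 2 * s = 0 ∧ 2 * t - 1 = 1 := by
            have := e₁₄ _ s2 _ t2 hst
            have n1' := n₁.symm
            have n4' := n₄.symm
            tauto
          exact .inr ⟨by linarith, by linarith⟩
        · obtain ⟨h5, h6⟩ : 2 * t = 0 ∧ 2 * s - 1 = 1 := by
            have := e₃₂ _ t2 _ s2 hst.symm
            have n2' := n₂.symm
            have n3' := n₃.symm
            have h31 := Ne.symm h13
            tauto
          exact .inl ⟨by linarith, by linarith⟩
        · exact absurd hst (d₂₄ _ s2 _ t2)
  -- If all three properties failed, each would fail for every `δ` below some threshold,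
  -- contradicting `main` below the least threshold.
  by_contra hcon
  push Not at hcon
  obtain ⟨c1, c2, c3⟩ := hcon
  have hfail : ∀ {c : ℝ → Ω}, ¬ HasEmbeddedClosedLiftProperty S c → ∃ η > 0, ∀ δ : ℝ, 0 < δ →
      δ < η → ∀ l : ℝ → Ω, IsSimpleLift S δ c l → IsClosedCurve l → ¬ IsEmbeddedCurve l := by
    intro c hc
    by_contra h
    push Not at h
    refine hc (hasEmbeddedClosedLiftProperty_of_forall fun η hη => ?_)
    obtain ⟨δ, h1, h2, l, h3⟩ := h η hη
    exact ⟨δ, h1, h2, l, h3⟩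
  obtain ⟨η₁, hη₁, k₁⟩ := hfail c1
  obtain ⟨η₂, hη₂, k₂⟩ := hfail c2
  obtain ⟨η₃, hη₃, k₃⟩ := hfail c3
  obtain ⟨δ, hδpos, hδlt⟩ := exists_between
    (lt_min (lt_min hδ₁ (lt_min hδα hδβ)) (lt_min hη₁ (lt_min hη₂ hη₃)))
  simp only [lt_min_iff] at hδlt
  obtain ⟨⟨q1, q2, q3⟩, q4, q5, q6⟩ := hδlt
  obtain ⟨l, hl1, hl2, hl | hl | hl⟩ := main δ hδpos q1 q2 q3
  · exact k₁ δ hδpos q4 l hl hl1 hl2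
  · exact k₂ δ hδpos q5 l hl hl1 hl2
  · exact k₃ δ hδpos q6 l hl hl1 hl2
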